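/- Let $R$ be a local Noetherian ring with infinite residue field such that $2$ is invertible in $R$ and $\operatorname{Spec} R$ is irreducible. Let $p\ge 1$, $q\ge 3$ be integers and put $n=p+2$. Let $B_0$, $B_1$, $B_2$ be free $R$-modules of ranks $q-2$, $p+q$, $2n$, where $B_2$ carries a perfect symmetric bilinear form $\langle\cdot,\cdot\rangle$ and has a hyperbolic basis, i.e. a basis $e_1,\dots,e_n,e_1',\dots,e_n'$ with $\langle e_i,e_j\rangle=\langle e_i',e_j'\rangle=0$ and $\langle e_i,e_j'\rangle=\delta_{ij}$. Let $$\mathbb B\colon\ 0\to B_0^*\xrightarrow{\delta_4=\delta_1^*}B_1^*\xrightarrow{\delta_3=\delta_2^*}B_2^*\cong B_2\xrightarrow{\delta_2}B_1\xrightarrow{\delta_1}B_0$$ be an acyclic self-dual complex, where $B_2^*\cong B_2$ is given by the form. For a decomposition $B_2=H\oplus H^*$ into totally isotropic submodules (the second being identified with the dual of $H$ by the form), let $V_{\rm even}=\bigwedge^{\rm even}H$ and $V_{\rm odd}=\bigwedge^{\rm odd}H$, and let $x=f+f'\in H\oplus H^*$ act on $\bigwedge H$ by $x\cdot s=f\wedge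 s+f'\lrcorner s$, where $\lrcorner$ is contraction. Spinor coordinates of $\mathbb B$ with respect to the decomposition are an element $a\in V_{\rm odd}$ that is annihilated by the action of $\operatorname{im}\delta_3$ and that does not vanish at any prime outside the support of $\operatorname{coker}\delta_1$; in other words, outside that support, $a$ gives the homogeneous coordinates of the isotropic summand $\operatorname{im}\delta_3$ under the spinor embedding of the orthogonal Grassmannian in $\mathbb P(V_{\rm odd})$. Given $a$, let $w\colon V_{\rm even}^*\to B_1^*$ be a lift along $\delta_3$ of the dual $V_{\rm even}^*\to B_2^*\cong B_2$ of the map $x\mapsto x\cdot a$, and consider $$\mathbb A\colon\ 0\to B_0^*\oplus R\xrightarrow{d_3}B_1^*\xrightarrow{d_2}H^*\xrightarrow{d_1}R,$$ where $d_3=[\,\delta_4\ \ w|_R\,]$ with $R=\bigwedge^0H^*\subset V_{\rm even}^*$, where $d_2$ is the dual of $\delta_2|_H$, and where $d_1$ is the restriction of $a\in V_{\rm odd}=(V_{\rm odd}^*)^*$ to $H^*=\bigwedge^1 H^*\subset V_{\rm odd}^*$. Then: (1) If $R$ is a unique factorization domain, then $\mathbb B$ has spinor coordinates with respect to some decomposition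 $B_2=H\oplus H^*$. (2) If $\mathbb B$ has spinor coordinates with respect to some decomposition (in particular, if $R$ is a unique factorization domain), then there is a decomposition $B_2=H\oplus H^*$ with respect to which spinor coordinates exist and such that, for every choice of spinor coordinates $a$, a lift $w$ exists and, for every choice of the lift $w$, the sequence $\mathbb A$ is an acyclic complex and the ideal $I=\operatorname{im}d_1$ is either a perfect ideal of grade $3$ or the unit ideal. Here the grade of $I$ is the least $i$ with $\operatorname{Ext}^i_R(R/I,R)\neq0$, and $I$ is perfect if the projective dimension of $R/I$ equals this grade. -/

import Mathlib

open CategoryTheory Module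

universe u v

noncomputable section

/-- The grade of an `R`-module `M`: the least `i` with `Ext^i(M, R) ≠ 0` (`⊤` if there is none). -/
def moduleGrade (R M : Type u) [CommRing R] [AddCommGroup M] [Module R M] : ℕ∞ :=
  sInf {n : ℕ∞ | ∃ i : ℕ, n = i ∧
    Nontrivial (Abelian.Ext (ModuleCat.of R M) (ModuleCat.of R R) i)}

/-- `M` is perfect if its projective dimension equals its grade. -/
def IsPerfectModule (R M : Type u) [CommRing R] [AddCommGroup M] [Module R M] : Prop :=
  projectiveDimension (ModuleCat.of R M) = ((moduleGrade R M : ℕ∞) : WithBot ℕ∞)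

/-- The data of a sequence `0 → B₀* → B₁* → B₂* ≅ B₂ → B₁ → B₀` which is self-dual with respect to
a perfect symmetric bilinear form on `B₂`. -/
structure SelfDualSequence (R : Type u) [CommRing R] (B₀ B₁ B₂ : Type v)
    [AddCommGroup B₀] [Module R B₀] [AddCommGroup B₁] [Module R B₁]
    [AddCommGroup B₂] [Module R B₂] where
  /-- the symmetric bilinear form on the middle module -/
  form : LinearMap.BilinForm R B₂
  form_symm : ∀ x y, form x y = form y x
  form_bijective : Function.Bijective form
  δ₁ : B₁ →ₗ[R] B₀
  δ₂ : B₂ →ₗ[R] B₁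

/-- A decomposition of a module with a symmetric bilinear form as a direct sum of two totally
isotropic submodules `H` and `H'`. When the form is perfect, it identifies `H'` with the dual
`H*`. -/
structure IsotropicDecomposition {R : Type u} [CommRing R] {E : Type v} [AddCommGroup E]
    [Module R E] (form : LinearMap.BilinForm R E) where
  H : Submodule R E
  H' : Submodule R E
  isCompl : IsCompl H H'
  isotropic : ∀ x ∈ H, ∀ y ∈ H, form x y = 0
  isotropic' : ∀ x ∈ H', ∀ y ∈ H', form x y = 0

/-- A hyperbolic basis of rank `2 n`: vectors `e i` (`inl`) and `e' i` (`inr`) with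
`⟨e i, e j⟩ = ⟨e' i, e' j⟩ = 0` and `⟨e i, e' j⟩ = δ_{ij}`. -/
def HasHyperbolicBasis {R : Type u} [CommRing R] {E : Type v} [AddCommGroup E]
    [Module R E] (form : LinearMap.BilinForm R E) (n : ℕ) : Prop :=
  ∃ e : Basis (Fin n ⊕ Fin n) R E,
    (∀ i j, form (e (.inl i)) (e (.inl j)) = 0) ∧
    (∀ i j, form (e (.inr i)) (e (.inr j)) = 0) ∧
    (∀ i j, form (e (.inl i)) (e (.inr j)) = if i = j then 1 else 0)

namespace IsotropicDecomposition

variable {R : Type u} [CommRing R] {E : Type v} [AddCommGroup E] [Module R E]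
  {form : LinearMap.BilinForm R E} (D : IsotropicDecomposition form)

/-- The even half-spinor module `⋀^even H`. -/
abbrev VEven : Submodule R (ExteriorAlgebra R D.H) :=
  CliffordAlgebra.evenOdd (0 : QuadraticForm R D.H) 0

/-- The odd half-spinor module `⋀^odd H`. -/
abbrev VOdd : Submodule R (ExteriorAlgebra R D.H) :=
  CliffordAlgebra.evenOdd (0 : QuadraticForm R D.H) 1

/-- The Clifford action of `E = H ⊕ H'` on `⋀ H`: for `x = f + f'`, one has
`x • s = f ∧ s + (contraction of s by ⟨f', -⟩)`. Since `H` is isotropic, `⟨x, -⟩` and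
`⟨f', -⟩` agree on `H`. -/
def cliffordAction : E →ₗ[R] ExteriorAlgebra R D.H →ₗ[R] ExteriorAlgebra R D.H :=
  (LinearMap.mul R (ExteriorAlgebra R D.H)) ∘ₗ (ExteriorAlgebra.ι R) ∘ₗ
      (D.H.projectionOnto D.H' D.isCompl)
    + (CliffordAlgebra.contractLeft (Q := (0 : QuadraticForm R D.H))) ∘ₗ
      D.H.subtype.dualMap ∘ₗ form

theorem contractLeft_mem_VEven (d : Dual R D.H) {s : ExteriorAlgebra R D.H} (hs : s ∈ D.VOdd) :
    CliffordAlgebra.contractLeft (Q := (0 : QuadraticForm R D.H)) d s ∈ D.VEven := by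
  induction s, hs using CliffordAlgebra.odd_induction with
  | ι v =>
    rw [CliffordAlgebra.contractLeft_ι, Algebra.algebraMap_eq_smul_one]
    exact D.VEven.smul_mem _ (Submodule.one_le.mp (CliffordAlgebra.one_le_evenOdd_zero _))
  | add x y hx hy ihx ihy =>
    rw [map_add]
    exact add_mem ihx ihy
  | ι_mul_ι_mul m₁ m₂ x hx ih =>
    rw [mul_assoc, CliffordAlgebra.contractLeft_ι_mul, CliffordAlgebra.contractLeft_ι_mul]
    have h1 (m : D.H) : CliffordAlgebra.ι (0 : QuadraticForm R D.H) m * x ∈ D.VEven := by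
      have := CliffordAlgebra.evenOdd_mul_le (0 : QuadraticForm R D.H) 1 1
        (Submodule.mul_mem_mul (CliffordAlgebra.ι_mem_evenOdd_one _ m) hx)
      simpa [show (1 : ZMod 2) + 1 = 0 from rfl] using this
    refine sub_mem (D.VEven.smul_mem _ (h1 m₂)) ?_
    rw [mul_sub, mul_smul_comm, ← mul_assoc]
    refine sub_mem (D.VEven.smul_mem _ (h1 m₁)) ?_
    have := CliffordAlgebra.evenOdd_mul_le (0 : QuadraticForm R D.H) 0 0
      (Submodule.mul_mem_mul (CliffordAlgebra.ι_mul_ι_mem_evenOdd_zero _ m₁ m₂) ih)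
    simpa using this

theorem cliffordAction_mem_VEven (x : E) {s : ExteriorAlgebra R D.H} (hs : s ∈ D.VOdd) :
    D.cliffordAction x s ∈ D.VEven := by
  refine add_mem ?_ (D.contractLeft_mem_VEven _ hs)
  have := CliffordAlgebra.evenOdd_mul_le (0 : QuadraticForm R D.H) 1 1
    (Submodule.mul_mem_mul (CliffordAlgebra.ι_mem_evenOdd_one _
      (D.H.projectionOnto D.H' D.isCompl x)) hs)
  simpa [show (1 : ZMod 2) + 1 = 0 from rfl] using this

/-- For an odd spinor `a`, the map `H ⊕ H' → ⋀^even H`, `x ↦ x • a`. -/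
def actOn (a : D.VOdd) : E →ₗ[R] D.VEven :=
  (D.cliffordAction.flip (a : ExteriorAlgebra R D.H)).codRestrict D.VEven
    fun x => D.cliffordAction_mem_VEven x a.2

/-- The inclusion of `H* = ⋀^1 H*` in the dual of `⋀^odd H`. -/
def dualInclOdd : Dual R D.H →ₗ[R] Dual R D.VOdd :=
  (ExteriorAlgebra.ιInv ∘ₗ D.VOdd.subtype).dualMap

/-- The element `1 ∈ R = ⋀^0 H*` in the dual of `⋀^even H`. -/
def dualOneEven : Dual R D.VEven :=
  (ExteriorAlgebra.algebraMapInv (R := R) (M := D.H)).toLinearMap ∘ₗ D.VEven.subtype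

/-- `d₁ : H* → R`, the restriction of the dual of the spinor coordinates
`a : R → ⋀^odd H` to `H* = ⋀^1 H*`. -/
def d₁ (a : D.VOdd) : Dual R D.H →ₗ[R] R := (Dual.eval R D.VOdd a) ∘ₗ D.dualInclOdd

/-- The ideal generated by the entries of `d₁`. -/
def idealOf (a : D.VOdd) : Ideal R := LinearMap.range (D.d₁ a)

end IsotropicDecomposition

namespace SelfDualSequence

variable {R : Type u} [CommRing R] {B₀ B₁ B₂ : Type v}
  [AddCommGroup B₀] [Module R B₀] [AddCommGroup B₁] [Module R B₁]
  [AddCommGroup B₂] [Module R B₂] (B : SelfDualSequence R B₀ B₁ B₂)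

/-- The isomorphism `B₂ ≅ B₂*` given by the form. -/
def formEquiv : B₂ ≃ₗ[R] Dual R B₂ := LinearEquiv.ofBijective B.form B.form_bijective

/-- `δ₃` is the dual of `δ₂`, through `B₂* ≅ B₂`. -/
def δ₃ : Dual R B₁ →ₗ[R] B₂ := B.formEquiv.symm.toLinearMap ∘ₗ B.δ₂.dualMap

/-- `δ₄` is the dual of `δ₁`. -/
def δ₄ : Dual R B₀ →ₗ[R] Dual R B₁ := B.δ₁.dualMap

/-- `0 → B₀* → B₁* → B₂ → B₁ → B₀` is an acyclic complex: exact except at `B₀`. -/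
structure IsAcyclic : Prop where
  injective : Function.Injective B.δ₄
  exact₃ : Function.Exact B.δ₄ B.δ₃
  exact₂ : Function.Exact B.δ₃ B.δ₂
  exact₁ : Function.Exact B.δ₂ B.δ₁

variable (D : IsotropicDecomposition B.form)

/-- `a ∈ ⋀^odd H` is a system of spinor coordinates for `B`: over the complement `U` of the support
of the module `B₀ / im δ₁`, where `im δ₃` is an isotropic direct summand of rank `n`, the element
`a` has no zero, and it is the pure spinor of `im δ₃`, i.e. it spans the line of spinors that are
annihilated by the Clifford action of `im δ₃`. So `a` consists of homogeneous coordinates of the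
morphism from `U` to the projective space of `⋀^odd H` that is given by `im δ₃` and the spinor
embedding of the orthogonal Grassmannian. (Existence of such an odd `a` means in particular that
`im δ₃` and `H'` belong to different families of isotropic subspaces.) -/
structure IsSpinorCoordinates (a : D.VOdd) : Prop where
  annihilated : ∀ φ : Dual R B₁, D.actOn a (B.δ₃ φ) = 0
  nonvanishing : ∀ P : PrimeSpectrum R, P ∉ Module.support R (B₀ ⧸ LinearMap.range B.δ₁) →
    ∃ l : Dual R D.VOdd, l a ∉ P.asIdeal

/-- `B` admits spinor coordinates with respect to some decomposition of `B₂`. -/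
def HasSpinorCoordinates : Prop :=
  ∃ (D : IsotropicDecomposition B.form) (a : D.VOdd), B.IsSpinorCoordinates D a

/-- `w : (⋀^even H)* → B₁*` is a lift along `δ₃` of the dual of `x ↦ x • a`. -/
def IsSpinorLift (a : D.VOdd) (w : Dual R D.VEven →ₗ[R] Dual R B₁) : Prop :=
  B.δ₃ ∘ₗ w = B.formEquiv.symm.toLinearMap ∘ₗ (D.actOn a).dualMap

/-- `d₃ = [δ₄, w|_R] : B₀* ⊕ R → B₁*`. -/
def d₃ (w : Dual R D.VEven →ₗ[R] Dual R B₁) : (Dual R B₀ × R) →ₗ[R] Dual R B₁ :=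
  B.δ₄.coprod (LinearMap.toSpanSingleton R (Dual R B₁) (w D.dualOneEven))

/-- `d₂ : B₁* → H*`, the dual of the restriction of `δ₂` to `H`. -/
def d₂ : Dual R B₁ →ₗ[R] Dual R D.H := (B.δ₂ ∘ₗ D.H.subtype).dualMap

/-- `0 → B₀* ⊕ R → B₁* → H* → R` is an acyclic complex: exact except at `R`, so it is a
resolution of the quotient of `R` by the image of `d₁`. -/
structure IsAcyclicA (a : D.VOdd) (w : Dual R D.VEven →ₗ[R] Dual R B₁) : Prop where
  injective : Function.Injective (B.d₃ D w)
  exact₂ : Function.Exact (B.d₃ D w) (B.d₂ D)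
  exact₁ : Function.Exact (B.d₂ D) (D.d₁ a)

end SelfDualSequence

end

/-! Write L for the image of `δ₃`. Acyclicity makes L its own orthogonal (`IsAcyclic.mem_range_δ₃`).
Since the complex has length four, `δ₄` stays injective modulo a regular sequence of length at most
three, so no prime associated to such a sequence lies in the support of the cokernel of `δ₁`
(`IsAcyclic.notMem_support`). Hence the coordinates of a spinor that vanishes nowhere outside the
support generate an ideal of grade at least three.

Only the degree one coordinates enter the ideal I, so the decomposition has to be chosen
generically. A shear of the hyperbolic coordinates acts on spinors by `1 + x • (annih j * annih k)`,
which adds a multiple of the coordinate at T to the one at T without j and k. Three shears with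
generic parameters make the coordinate at T superfluous for the grade
(`exists_gradeGEAt_linear_family`), and induction leaves only degree one
(`IsSpinorOf.exists_generic`). By `mem_of_singleton_mem` the result does not depend on the choice of
spinor coordinates.

The Clifford relations show that I annihilates the homology of the constructed complex
(`mul_eq_mul_of_mem`, `exists_mem_of_sum_eq_zero`). A complex of three free modules ending in R
whose homology is killed by an ideal of grade three is exact; this instance of the acyclicity lemma
is proved by a Koszul chase. If Ext³ of R/I vanished, the projection of the last term to its summand
R would extend along `d₃`, and this would force I to be the unit ideal.

Over a factorial domain, the spinors killed by L have rank one (`two_pow_mul_finrank_annihilated`),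
and near each prime outside the support a product of n vectors of L produces one that does not
vanish there. Dividing a generator by the gcd of its coordinates gives a spinor that vanishes
nowhere outside the support. It is even or odd, and a reflection corrects the parity.

Localization is expressed throughout by multipliers outside a prime. -/

/-! ### Regular sequences at a prime -/

section RegularAt

variable {A : Type u} [CommRing A]

/-- `x` is regular on the localization of `A ⧸ c` at `P`. -/
def RegModAt (P c : Ideal A) (x : A) : Prop :=
  ∀ g, x * g ∈ c → ∃ s, s ∉ P ∧ s * g ∈ c

/-- The list, read from its last entry to its head, is weakly regular on the localization
of `A` at `P`. -/
def RegSeqAt (P : Ideal A) : List A → Prop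
  | [] => True
  | x :: l => RegModAt P (Ideal.ofList l) x ∧ RegSeqAt P l

/-- `P` is associated to `A ⧸ c`, after localization at `P`. -/
def HasSocleAt (P c : Ideal A) : Prop :=
  ∃ g, (∀ y ∈ P, ∃ s, s ∉ P ∧ s * (y * g) ∈ c) ∧ ∀ s, s * g ∈ c → s ∈ P

/-- There is a regular sequence of length `k` on `A ⧸ c` in `P` with associated prime `P`. -/
def HasDepthAt (P : Ideal A) : ℕ → Ideal A → Prop
  | 0, c => HasSocleAt P c
  | k + 1, c => ∃ x ∈ P, RegModAt P c x ∧ HasDepthAt P k (Ideal.span {x} ⊔ c)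

theorem RegModAt.mono {P Q c : Ideal A} {x : A} (h : RegModAt P c x) (hQ : Q ≤ P) :
    RegModAt Q c x := fun g hg =>
  let ⟨s, hs, hsg⟩ := h g hg
  ⟨s, fun hs' => hs (hQ hs'), hsg⟩

theorem RegSeqAt.mono {P Q : Ideal A} (hQ : Q ≤ P) :
    ∀ {l : List A}, RegSeqAt P l → RegSeqAt Q l
  | [], _ => trivial
  | _ :: _, h => ⟨h.1.mono hQ, RegSeqAt.mono hQ h.2⟩

theorem mem_span_singleton_sup' {c : Ideal A} {x g : A} :
    g ∈ Ideal.span {x} ⊔ c ↔ ∃ h, g - x * h ∈ c := by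
  rw [Submodule.mem_sup]
  constructor
  · rintro ⟨y, hy, z, hz, rfl⟩
    obtain ⟨h, rfl⟩ := Ideal.mem_span_singleton'.mp hy
    exact ⟨h, by convert hz using 1; ring⟩
  · rintro ⟨h, hh⟩
    exact ⟨x * h, Ideal.mem_span_singleton'.mpr ⟨h, mul_comm _ _⟩, _, hh, by ring⟩

/-- If `Q` runs through the primes below `P` associated to the quotients `A ⧸ c`, an ideal
contained in no `Q` contains an element regular on all `A ⧸ c` at `P`. -/
theorem exists_regModAt [IsNoetherianRing A] (P F : Ideal A) [P.IsPrime] (C : Finset (Ideal A))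
    (h : ∀ c ∈ C, ∀ Q : Ideal A, Q.IsPrime → Q ≤ P → ∀ g, (∀ y ∈ Q, y * g ∈ c) →
      (∀ s, s * g ∈ c → s ∈ Q) → ¬ F ≤ Q) :
    ∃ x ∈ F, ∀ c ∈ C, RegModAt P c x := by
  classical
  let T : Set (Ideal A) := ⋃ c ∈ C, {Q ∈ associatedPrimes A (A ⧸ c) | Q ≤ P}
  have hT : T.Finite := C.finite_toSet.biUnion fun c _ =>
    (associatedPrimes.finite A (A ⧸ c)).subset (Set.sep_subset _ _)
  have hmem : ∀ Q ∈ T, ∃ c ∈ C, Q ∈ associatedPrimes A (A ⧸ c) ∧ Q ≤ P := by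
    intro Q hQ
    obtain ⟨c, hc, hQ⟩ := Set.mem_iUnion₂.mp hQ
    exact ⟨c, hc, hQ⟩
  have hprime : ∀ Q ∈ T, Q.IsPrime := fun Q hQ => by
    obtain ⟨c, -, hQ, -⟩ := hmem Q hQ
    exact hQ.1
  have hnot : ∀ Q ∈ T, ¬ F ≤ Q := by
    intro Q hQ
    obtain ⟨c, hc, hQ, hQP⟩ := hmem Q hQ
    obtain ⟨hp, x, hx⟩ := isAssociatedPrime_iff.mp hQ
    obtain ⟨g, rfl⟩ := Ideal.Quotient.mk_surjective x
    have key : ∀ s, s ∈ Q ↔ s * g ∈ c := by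
      intro s
      rw [hx, Submodule.mem_colon_singleton, Submodule.mem_bot, Algebra.smul_def]
      rw [Ideal.Quotient.algebraMap_eq, ← map_mul, Ideal.Quotient.eq_zero_iff_mem]
    exact h c hc Q hp hQP g (fun y hy => (key y).1 hy) fun s hs => (key s).2 hs
  -- Prime avoidance for the finitely many associated primes below `P`.
  obtain ⟨x, hxF, hx⟩ : ∃ x ∈ F, ∀ Q ∈ T, x ∉ Q := by
    by_contra! hcon
    have := (F.subset_union_prime_finite hT (f := id) ⊥ ⊥ fun Q hQ _ _ => hprime Q hQ).1
      fun x hx => by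
        obtain ⟨Q, hQ, hxQ⟩ := hcon x hx
        exact Set.mem_biUnion hQ hxQ
    obtain ⟨Q, hQ, hle⟩ := this
    exact hnot Q hQ hle
  refine ⟨x, hxF, fun c hc g hg => ?_⟩
  by_contra! hcon
  -- If regularity failed at `g`, the annihilator of its class would lie in `P`. A minimal prime
  -- over this annihilator is associated, lies below `P` and contains `x`.
  let N : Submodule A (A ⧸ c) := A ∙ (Ideal.Quotient.mk c g)
  have key : ∀ s, s ∈ Module.annihilator A N ↔ s * g ∈ c := by
    intro s
    rw [Submodule.mem_annihilator_span_singleton, Algebra.smul_def, Ideal.Quotient.algebraMap_eq,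
      ← map_mul, Ideal.Quotient.eq_zero_iff_mem]
  have hle : Module.annihilator A N ≤ P := fun s hs => by
    by_contra hsP
    exact hcon s hsP ((key s).1 hs)
  obtain ⟨Q, hQ, hQP⟩ := Ideal.exists_minimalPrimes_le hle
  have hQ' := Module.associatedPrimes.minimalPrimes_annihilator_subset_associatedPrimes A N hQ
  have hQ'' := associatedPrimes.subset_of_injective N.injective_subtype hQ'
  refine hx Q (Set.mem_biUnion hc ⟨hQ'', hQP⟩) ?_
  exact hQ.1.2 ((key x).2 hg)

/-- From `t * z * g ≡ x * g'` modulo `c`, the class of `g'` becomes the socle element after the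
exchange. This is the elementwise form of Hom(k, M/xM) ≅ Ext¹(k, M) ≅ Hom(k, M/zM) for the residue
field k and M the localization of `A ⧸ c`. -/
theorem HasSocleAt.swap {P c : Ideal A} [hP : P.IsPrime] {x z : A} (hzP : z ∈ P)
    (hx : RegModAt P c x) (hz : RegModAt P c z) (h : HasSocleAt P (Ideal.span {x} ⊔ c)) :
    HasSocleAt P (Ideal.span {z} ⊔ c) := by
  obtain ⟨g, h1, h2⟩ := h
  obtain ⟨t, htP, ht⟩ := h1 z hzP
  obtain ⟨g', hg'⟩ := mem_span_singleton_sup'.mp ht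
  refine ⟨g', fun y hy => ?_, fun s hs => ?_⟩
  · obtain ⟨s, hsP, hs⟩ := h1 y hy
    obtain ⟨k, hk⟩ := mem_span_singleton_sup'.mp hs
    obtain ⟨r, hrP, hr⟩ := hx (s * y * g' - t * z * k) (by
      have e : x * (s * y * g' - t * z * k)
        = t * z * (s * (y * g) - x * k) - s * y * (t * (z * g) - x * g') := by ring
      rw [e]
      exact sub_mem (c.mul_mem_left _ hk) (c.mul_mem_left _ hg'))
    refine ⟨r * s, fun hmem => (hP.mem_or_mem hmem).elim hrP hsP, ?_⟩
    rw [mem_span_singleton_sup']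
    exact ⟨r * t * k, by convert hr using 1; ring⟩
  · obtain ⟨k, hk⟩ := mem_span_singleton_sup'.mp hs
    obtain ⟨r, hrP, hr⟩ := hz (s * t * g - x * k) (by
      have e : z * (s * t * g - x * k)
        = s * (t * (z * g) - x * g') + x * (s * g' - z * k) := by ring
      rw [e]
      exact add_mem (c.mul_mem_left _ hg') (c.mul_mem_left _ hk))
    have := h2 (r * s * t) (by
      rw [mem_span_singleton_sup']
      exact ⟨r * k, by convert hr using 1; ring⟩)
    rcases hP.mem_or_mem this with h | h
    · exact (hP.mem_or_mem h).resolve_left hrP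
    · exact absurd h htP

theorem HasSocleAt.not_regModAt {P c : Ideal A} [hP : P.IsPrime] (h : HasSocleAt P c) {y : A}
    (hy : y ∈ P) : ¬ RegModAt P c y := by
  intro hreg
  obtain ⟨g, h1, h2⟩ := h
  obtain ⟨s, hs, hsg⟩ := h1 y hy
  obtain ⟨r, hr, hrg⟩ := hreg (s * g) (by convert hsg using 1; ring)
  have := h2 (r * s) (by convert hrg using 1; ring)
  exact (hP.mem_or_mem this).elim hr hs

/-- The exchange of two consecutive elements of a regular sequence. -/
theorem RegModAt.exchange {P c : Ideal A} {x w : A} (hx : RegModAt P c x)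
    (hP : P.IsPrime) (hwx : RegModAt P (Ideal.span {x} ⊔ c) w) :
    RegModAt P (Ideal.span {w} ⊔ c) x := by
  intro g hg
  obtain ⟨k, hk⟩ := mem_span_singleton_sup'.mp hg
  obtain ⟨s, hs, hsk⟩ := hwx k (by
    rw [mem_span_singleton_sup']
    exact ⟨g, by convert c.neg_mem hk using 1; ring⟩)
  obtain ⟨k', hk'⟩ := mem_span_singleton_sup'.mp hsk
  obtain ⟨t, ht, htg⟩ := hx (s * g - w * k') (by
    have e : x * (s * g - w * k') = s * (x * g - w * k) + w * (s * k - x * k') := by ring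
    rw [e]
    exact add_mem (c.mul_mem_left _ hk) (c.mul_mem_left _ hk'))
  refine ⟨t * s, fun h => (hP.mem_or_mem h).elim ht hs, ?_⟩
  rw [mem_span_singleton_sup']
  exact ⟨t * k', by convert htg using 1; ring⟩

theorem hasSocleAt_of_le {P c : Ideal A} {Q : Ideal A} (hQP : Q ≤ P) (hPQ : P ≤ Q) (g : A)
    (h1 : ∀ y ∈ Q, y * g ∈ c) (h2 : ∀ s, s * g ∈ c → s ∈ Q) (hP : P.IsPrime) :
    HasSocleAt P c :=
  ⟨g, fun y hy => ⟨1, fun h => hP.ne_top ((Ideal.eq_top_iff_one _).2 h), by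
    simpa using h1 y (hPQ hy)⟩, fun s hs => hQP (h2 s hs)⟩

/-- A common `w`, regular modulo both `x` and `z`, links the two: divide by `w`, apply the induction
hypothesis to `z` there, and exchange `w` with `z`. -/
theorem HasDepthAt.quotient [IsNoetherianRing A] {P : Ideal A} [hP : P.IsPrime] {k : ℕ} :
    ∀ {c : Ideal A} {z : A}, HasDepthAt P (k + 1) c → z ∈ P → RegModAt P c z →
      HasDepthAt P k (Ideal.span {z} ⊔ c) := by
  induction k with
  | zero =>
    rintro c z ⟨x, -, hx, h⟩ hzP hz
    exact HasSocleAt.swap hzP hx hz h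
  | succ k ih =>
    rintro c z ⟨x, hxP, hx, h⟩ hzP hz
    -- The depth modulo `x` is positive, so `P` is not associated there. Swapping transfers this to
    -- `z`, and prime avoidance then supplies `w`.
    have hxs : ¬ HasSocleAt P (Ideal.span {x} ⊔ c) := by
      obtain ⟨y, hyP, hy, -⟩ := h
      exact fun hs => hs.not_regModAt hyP hy
    have hzs : ¬ HasSocleAt P (Ideal.span {z} ⊔ c) := fun hs => hxs (hs.swap hxP hz hx)
    classical
    obtain ⟨w, hwP, hw⟩ := exists_regModAt P P
        {Ideal.span {x} ⊔ c, Ideal.span {z} ⊔ c} (by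
      intro d hd Q hQ hQP g h1 h2 hPQ
      have hs := hasSocleAt_of_le hQP hPQ g h1 h2 hP
      simp only [Finset.mem_insert, Finset.mem_singleton] at hd
      rcases hd with rfl | rfl
      · exact hxs hs
      · exact hzs hs)
    have hwx := hw (Ideal.span {x} ⊔ c) (by simp)
    have hwz := hw (Ideal.span {z} ⊔ c) (by simp)
    have h1 := ih h hwP hwx
    rw [sup_left_comm] at h1
    have h2 : HasDepthAt P (k + 1) (Ideal.span {w} ⊔ c) :=
      ⟨x, hxP, hx.exchange hP hwx, h1⟩
    have h3 := ih h2 hzP (hz.exchange hP hwz)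
    rw [sup_left_comm] at h3
    exact ⟨w, hwP, hwz, h3⟩

theorem RegSeqAt.hasDepthAt {P : Ideal A} : ∀ {l : List A} {k : ℕ}, RegSeqAt P l →
    (∀ x ∈ l, x ∈ P) → HasDepthAt P k (Ideal.ofList l) → HasDepthAt P (k + l.length) ⊥
  | [], k, _, _, h => by simpa using h
  | x :: l, k, h, hl, hk => by
    rw [Ideal.ofList_cons] at hk
    have := RegSeqAt.hasDepthAt (k := k + 1) h.2 (fun y hy => hl y (by simp [hy]))
      ⟨x, hl x (by simp), h.1, hk⟩
    rwa [List.length_cons, add_comm l.length, ← add_assoc]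

/-- Each entry lowers the depth by exactly one, and no entry can be regular once the depth is zero.
-/
theorem RegSeqAt.length_le [IsNoetherianRing A] {P : Ideal A} [hP : P.IsPrime] {j : ℕ}
    (hj : HasDepthAt P j ⊥) : ∀ {l : List A}, RegSeqAt P l → (∀ x ∈ l, x ∈ P) →
    ∃ i, i + l.length = j ∧ HasDepthAt P i (Ideal.ofList l)
  | [], _, _ => ⟨j, rfl, by simpa using hj⟩
  | x :: l, h, hl => by
    obtain ⟨i, hi, hd⟩ := RegSeqAt.length_le hj h.2 fun y hy => hl y (by simp [hy])
    have hx : x ∈ P := hl x (by simp)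
    cases i with
    | zero => exact absurd h.1 (HasSocleAt.not_regModAt hd hx)
    | succ i =>
      refine ⟨i, by simp; omega, ?_⟩
      rw [Ideal.ofList_cons]
      exact hd.quotient hx h.1

/-- All maximal regular sequences in a prime at this prime have the same length. -/
theorem RegSeqAt.length_le_of_socle [IsNoetherianRing A] {P : Ideal A} [hP : P.IsPrime]
    {l m : List A} (hl : RegSeqAt P l) (hm : RegSeqAt P m) (hlP : ∀ x ∈ l, x ∈ P)
    (hmP : ∀ x ∈ m, x ∈ P) (hs : HasSocleAt P (Ideal.ofList l)) : m.length ≤ l.length := by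
  obtain ⟨i, hi, -⟩ := RegSeqAt.length_le (RegSeqAt.hasDepthAt (k := 0) hl hlP hs) hm hmP
  omega

/-- An ideal contains a regular sequence of length `k` at `P`. -/
def GradeGEAt (P F : Ideal A) (k : ℕ) : Prop :=
  ∃ l : List A, l.length = k ∧ (∀ x ∈ l, x ∈ F) ∧ RegSeqAt P l

/-- The grade criterion used for all lower bounds below: as long as no prime associated to the
current sequence contains `F`, prime avoidance prolongs it inside `F`. -/
theorem gradeGEAt_of_forall [IsNoetherianRing A] (P F : Ideal A) [P.IsPrime] (k : ℕ)
    (h : ∀ l : List A, l.length < k → (∀ x ∈ l, x ∈ F) → RegSeqAt P l →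
      ∀ Q : Ideal A, Q.IsPrime → Q ≤ P → ∀ g, (∀ y ∈ Q, y * g ∈ Ideal.ofList l) →
      (∀ s, s * g ∈ Ideal.ofList l → s ∈ Q) → ¬ F ≤ Q) : GradeGEAt P F k := by
  induction k with
  | zero => exact ⟨[], rfl, by simp, trivial⟩
  | succ k ih =>
    obtain ⟨l, hl, hlF, hreg⟩ := ih fun l hl => h l (by omega)
    obtain ⟨x, hxF, hx⟩ := exists_regModAt P F {Ideal.ofList l} (by
      intro c hc
      obtain rfl := Finset.mem_singleton.1 hc
      exact h l (by omega) hlF hreg)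
    exact ⟨x :: l, by simp [hl], by simpa [hxF] using hlF, hx _ (by simp), hreg⟩

/-- A prime associated to a regular sequence shorter than `k` contains no ideal of grade `k`. -/
theorem not_le_of_gradeGEAt [IsNoetherianRing A] {P Q F : Ideal A} [hQ : Q.IsPrime] (hQP : Q ≤ P)
    {k : ℕ} (hF : GradeGEAt P F k) {l : List A} (hl : RegSeqAt P l) (hlQ : ∀ x ∈ l, x ∈ Q)
    (hlk : l.length < k) (hs : HasSocleAt Q (Ideal.ofList l)) : ¬ F ≤ Q := by
  intro hle
  obtain ⟨m, hm, hmF, hmreg⟩ := hF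
  have := RegSeqAt.length_le_of_socle (hl.mono hQP) (hmreg.mono hQP) hlQ
    (fun x hx => hle (hmF x hx)) hs
  omega

end RegularAt

/-! ### Regular sequences in polynomial rings -/

section PolynomialRegular

open Polynomial

variable {A : Type u} [CommRing A]

theorem ofList_map_eq {B : Type*} [CommRing B] (f : A →+* B) (l : List A) :
    Ideal.ofList (l.map f) = (Ideal.ofList l).map f := by
  rw [Ideal.map_ofList]

/-- Finite generation allows one multiplier, the product over the generators. A single polynomial
multiplier is what excludes only finitely many specializations later. -/
theorem exists_uniform_multiplier {P c K : Ideal A} [hP : P.IsPrime] (hK : K.FG)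
    (h : ∀ g ∈ K, ∃ s, s ∉ P ∧ s * g ∈ c) : ∃ s, s ∉ P ∧ ∀ g ∈ K, s * g ∈ c := by
  classical
  obtain ⟨T, rfl⟩ := hK
  choose! s hs hsg using fun g (hg : g ∈ T) => h g (Ideal.subset_span hg)
  refine ⟨∏ g ∈ T, s g, ?_, fun g hg => ?_⟩
  · rw [hP.prod_mem_iff]
    rintro ⟨g, hg, hgP⟩
    exact hs g hg hgP
  · induction hg using Submodule.span_induction with
    | mem x hx =>
      rw [← Finset.prod_erase_mul T s hx, mul_assoc]
      exact c.mul_mem_left _ (hsg x hx)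
    | zero => simp
    | add x y _ _ hx hy => rw [mul_add]; exact add_mem hx hy
    | smul a x _ hx => rw [smul_eq_mul, mul_left_comm]; exact c.mul_mem_left _ hx

theorem exists_eq_X_mul_of_eval_zero {g : A[X]} (h : eval 0 g = 0) : ∃ g', g = X * g' :=
  X_dvd_iff.mpr (by rwa [coeff_zero_eq_eval_zero])

/-- A sequence of polynomials is regular at `(𝔫, X)` if its values at `0` are regular at `𝔫`. -/
theorem RegSeqAt.of_eval_zero [IsNoetherianRing A] {n : Ideal A} [hn : n.IsMaximal] :
    ∀ {l : List A[X]}, RegSeqAt n (l.map (evalRingHom 0)) →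
      RegSeqAt (n.comap (evalRingHom 0)) l ∧
        RegModAt (n.comap (evalRingHom 0)) (Ideal.ofList l) X
  | [], _ => by
    refine ⟨trivial, fun g hg => ⟨1, ?_, ?_⟩⟩
    · intro h
      exact hn.ne_top ((Ideal.eq_top_iff_one _).2 (by simpa using h))
    · simp only [Ideal.ofList_nil, Ideal.mem_bot, one_mul] at hg ⊢
      ext i
      have := congrArg (fun f => coeff f (i + 1)) hg
      simpa using this
  | f :: l, h => by
    obtain ⟨ih, ihX⟩ := RegSeqAt.of_eval_zero (l := l) h.2
    have hf := h.1
    rw [ofList_map_eq] at hf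
    set c := Ideal.ofList l with hc
    set M : Ideal A[X] := n.comap (evalRingHom 0) with hM
    have hsurj : Function.Surjective (evalRingHom (0 : A)) := fun a => ⟨C a, by simp⟩
    have hMmax : M.IsMaximal := Ideal.comap_isMaximal_of_surjective _ hsurj
    have hMprime := hMmax.isPrime
    have hCM : ∀ {s : A}, s ∉ n → C s ∉ M := fun hs h => hs (by simpa [hM] using h)
    -- Regularity of `f` at `X = 0`, lifted: up to a constant outside `n`, such a `w` lies in `c +
    -- (X)`.
    have key : ∀ w, eval 0 f * eval 0 w ∈ c.map (evalRingHom 0) →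
        ∃ s, s ∉ n ∧ ∃ u ∈ c, ∃ w', C s * w = u + X * w' := by
      intro w hw
      obtain ⟨s, hs, hsw⟩ := hf _ hw
      obtain ⟨u, hu, hus⟩ := (Ideal.mem_map_iff_of_surjective _ hsurj).mp hsw
      obtain ⟨w', hw'⟩ := exists_eq_X_mul_of_eval_zero (g := C s * w - u) (by
        have : eval 0 u = s * eval 0 w := hus
        simp [this])
      exact ⟨s, hs, u, hu, w', by rw [← hw']; ring⟩
    refine ⟨⟨?_, ih⟩, ?_⟩
    · let K : Ideal A[X] := Submodule.comap (LinearMap.mulLeft A[X] f) c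
      have hK : ∀ g, g ∈ K ↔ f * g ∈ c := fun g => Iff.rfl
      have hle : K ≤ c ⊔ M • K := by
        intro g hg
        obtain ⟨s, hs, u, hu, g', hg'⟩ := key g (by
          rw [← eval_mul]
          exact Ideal.mem_map_of_mem (evalRingHom 0) ((hK g).1 hg))
        obtain ⟨t, ht, htg⟩ := ihX (f * g') (by
          have e : X * (f * g') = C s * (f * g) - f * u := by
            linear_combination -f * hg'
          rw [e]
          exact sub_mem (c.mul_mem_left _ ((hK g).1 hg)) (c.mul_mem_left _ hu))
        have htK : t * g' ∈ K := (hK _).2 (by convert htg using 1; ring)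
        have hts : t * C s ∉ M := fun h => (hMprime.mem_or_mem h).elim ht (hCM hs)
        obtain ⟨r, hr⟩ := hMmax.exists_inv hts
        have e : g = r * t * u + (X * (r * (t * g')) + -((r * (t * C s) - 1) * g)) := by
          have : r * (t * C s) * g = r * t * (C s * g) := by ring
          rw [sub_mul, this, hg']; ring
        rw [e]
        refine Submodule.add_mem_sup (c.mul_mem_left _ hu) (add_mem ?_ (neg_mem ?_))
        · exact Submodule.smul_mem_smul (by simp [hM]) (K.mul_mem_left _ htK)
        · refine Submodule.smul_mem_smul ?_ hg
          obtain ⟨a, ha, hh⟩ := hr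
          have : r * (t * C s) - 1 = -a := by rw [← hh]; ring
          rw [this]
          exact neg_mem ha
      obtain ⟨r, hr, hrK⟩ := Submodule.exists_sub_one_mem_and_smul_le_of_fg_of_le_sup
        (IsNoetherian.noetherian K) le_rfl hle
      intro g hg
      refine ⟨r, fun h => hMprime.ne_top ((Ideal.eq_top_iff_one _).2 ?_),
        hrK (Submodule.smul_mem_pointwise_smul g r K ((hK g).2 hg))⟩
      have := sub_mem h hr
      simpa using this
    · intro g hg
      rw [Ideal.ofList_cons] at hg ⊢
      obtain ⟨w, hw⟩ := mem_span_singleton_sup'.mp hg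
      obtain ⟨s, hs, u, hu, w', hw'⟩ := key w (by
        have := Ideal.mem_map_of_mem (evalRingHom 0) (c.neg_mem hw)
        rw [neg_sub, map_sub, map_mul, map_mul] at this
        simpa only [coe_evalRingHom, eval_X, zero_mul, sub_zero] using this)
      obtain ⟨t, ht, htg⟩ := ihX (C s * g - f * w') (by
        have e : X * (C s * g - f * w') = C s * (X * g - f * w) + f * u := by
          have : f * (C s * w) = f * (u + X * w') := by rw [hw']
          linear_combination this
        rw [e]
        exact add_mem (c.mul_mem_left _ hw) (c.mul_mem_left _ hu))
      refine ⟨t * C s, fun h => (hMprime.mem_or_mem h).elim ht (hCM hs), ?_⟩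
      rw [mem_span_singleton_sup']
      exact ⟨t * w', by convert htg using 1; ring⟩

/-- A nonzero polynomial over the domain `A ⧸ p` has finitely many roots, and unit differences keep
the points `σ s` distinct modulo `p`. -/
theorem finite_setOf_eval_mem {p : Ideal A} [p.IsPrime] {K : Type*} (σ : K → A)
    (hσ : ∀ s t, s ≠ t → IsUnit (σ s - σ t)) {h : A[X]} (hh : h ∉ p.map (C : A →+* A[X])) :
    {s | eval (σ s) h ∈ p}.Finite := by
  have hne : h.map (Ideal.Quotient.mk p) ≠ 0 := by
    intro h0
    apply hh
    rw [Ideal.mem_map_C_iff]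
    intro i
    rw [← Ideal.Quotient.eq_zero_iff_mem, ← coeff_map, h0, coeff_zero]
  have hinj : Function.Injective fun s => Ideal.Quotient.mk p (σ s) := by
    intro s t hst
    by_contra hne
    exact (Ideal.IsPrime.ne_top ‹_›) (p.eq_top_of_isUnit_mem (Ideal.Quotient.eq.mp hst) (hσ s t hne))
  refine ((finite_setOfPred_isRoot hne).preimage hinj.injOn).subset fun s hs => ?_
  simp only [Set.mem_preimage, Set.mem_ofPred_eq, IsRoot.def]
  rw [Polynomial.eval_map, eval₂_hom]
  exact Ideal.Quotient.eq_zero_iff_mem.mpr hs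

/-- A sequence of polynomials that is regular at `𝔭[X]` specializes to a regular sequence at all
but finitely many points. -/
theorem RegSeqAt.finite_setOf_not_eval [IsNoetherianRing A] {p : Ideal A} [hp : p.IsPrime]
    {K : Type*} (σ : K → A) (hσ : ∀ s t, s ≠ t → IsUnit (σ s - σ t)) :
    ∀ {l : List A[X]}, RegSeqAt (p.map (C : A →+* A[X])) l →
      {s | ¬ RegSeqAt p (l.map (evalRingHom (σ s)))}.Finite
  | [], _ => by simp [RegSeqAt]
  | f :: l, h => by
    have ih := RegSeqAt.finite_setOf_not_eval σ hσ h.2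
    have hpC : (p.map (C : A →+* A[X])).IsPrime := inferInstance
    set c := Ideal.ofList l with hc
    let K' : Ideal A[X] := Submodule.comap (LinearMap.mulLeft A[X] f) c
    obtain ⟨r, hr, hrK⟩ := exists_uniform_multiplier (P := p.map (C : A →+* A[X])) (c := c)
      (IsNoetherian.noetherian K') h.1
    -- An associated prime contains `X - C (σ s)` for at most one `s`, because two such elements
    -- differ by a unit.
    have hfin : (⋃ Q ∈ associatedPrimes A[X] (A[X] ⧸ Ideal.ofList (f :: l)),
        {s | X - C (σ s) ∈ Q}).Finite := by
      refine (associatedPrimes.finite _ _).biUnion fun Q hQ => Set.Subsingleton.finite ?_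
      intro s hs t ht
      by_contra hne
      refine hQ.1.ne_top (Q.eq_top_of_isUnit_mem ?_ ((hσ s t hne).map C))
      have := sub_mem (Set.mem_ofPred.mp ht) (Set.mem_ofPred.mp hs)
      simpa using this
    refine ((ih.union hfin).union (finite_setOf_eval_mem σ hσ hr)).subset fun s hs => ?_
    by_contra hcon
    simp only [Set.mem_union, not_or, Set.mem_ofPred_eq, not_not] at hcon
    obtain ⟨⟨h1, h2⟩, h3⟩ := hcon
    refine hs ⟨?_, h1⟩
    have hsurj : Function.Surjective (evalRingHom (σ s)) := fun a => ⟨C a, by simp⟩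
    intro g hg
    refine ⟨eval (σ s) r, h3, ?_⟩
    rw [ofList_map_eq] at hg ⊢
    obtain ⟨u, hu, hus⟩ := (Ideal.mem_map_iff_of_surjective _ hsurj).mp hg
    -- Since `X - C (σ s)` is regular modulo `f :: l`, the quotient `v` lies in that ideal. This
    -- corrects `C g` by a multiple of `X - C (σ s)` to an element of the colon ideal, which `r`
    -- carries into `c`; evaluation at `σ s` forgets the correction.
    obtain ⟨v, hv⟩ : X - C (σ s) ∣ f * C g - u := by
      rw [dvd_iff_isRoot, IsRoot.def, eval_sub, eval_mul, eval_C]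
      have : eval (σ s) u = eval (σ s) f * g := hus
      rw [this, sub_self]
    have hvmem : v ∈ Ideal.ofList (f :: l) := by
      by_contra hvn
      refine h2 ?_
      have : X - C (σ s) ∈ ⋃ Q ∈ associatedPrimes A[X] (A[X] ⧸ Ideal.ofList (f :: l)),
          (Q : Set A[X]) := by
        rw [biUnion_associatedPrimes_eq_zero_divisors]
        refine ⟨Ideal.Quotient.mk _ v, fun h => hvn (Ideal.Quotient.eq_zero_iff_mem.mp h), ?_⟩
        change Ideal.Quotient.mk _ ((X - C (σ s)) * v) = 0
        rw [Ideal.Quotient.eq_zero_iff_mem, ← hv, Ideal.ofList_cons, mem_span_singleton_sup']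
        exact ⟨C g, by simpa using neg_mem hu⟩
      simpa using this
    rw [Ideal.ofList_cons] at hvmem
    obtain ⟨w, hw⟩ := mem_span_singleton_sup'.mp hvmem
    have hK : C g - (X - C (σ s)) * w ∈ K' := by
      change f * (C g - (X - C (σ s)) * w) ∈ c
      have e : f * (C g - (X - C (σ s)) * w) = u + (X - C (σ s)) * (v - f * w) := by
        linear_combination hv
      rw [e]
      exact add_mem hu (c.mul_mem_left _ hw)
    have := Ideal.mem_map_of_mem (evalRingHom (σ s)) (hrK _ hK)
    simpa only [map_mul, map_sub, coe_evalRingHom, eval_C, eval_X, sub_self, zero_mul,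
      sub_zero] using this

/-- Flatness of `A → A[X]`, checked on coefficients; the multipliers of the finitely many nonzero
coefficients are multiplied together. -/
theorem RegSeqAt.map_C {P : Ideal A[X]} [hP : P.IsPrime] :
    ∀ {l : List A}, RegSeqAt (P.comap (C : A →+* A[X])) l → RegSeqAt P (l.map C)
  | [], _ => trivial
  | f :: l, h => by
    refine ⟨fun g hg => ?_, RegSeqAt.map_C h.2⟩
    rw [ofList_map_eq] at hg ⊢
    rw [Ideal.mem_map_C_iff] at hg
    simp only [coeff_C_mul] at hg
    choose s hs hsg using fun i => h.1 _ (hg i)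
    refine ⟨C (∏ i ∈ g.support, s i), ?_, ?_⟩
    · rw [map_prod, hP.prod_mem_iff]
      rintro ⟨i, -, hi⟩
      exact hs i hi
    · rw [Ideal.mem_map_C_iff]
      intro i
      rw [coeff_C_mul]
      by_cases hi : i ∈ g.support
      · rw [← Finset.prod_erase_mul _ s hi, mul_assoc]
        exact Ideal.mul_mem_left _ _ (hsg i)
      · rw [notMem_support_iff.mp hi, mul_zero]
        exact zero_mem _

/-- The top coefficient of the product is `v * g.coeff N`, so the top term of `C v * g` lies in the
extension of `c` and can be removed. This lowers the degree at the cost of one factor `v`. -/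
theorem pow_mul_mem_of_linear_mul_mem {c : Ideal A} {u v : A} (N : ℕ) :
    ∀ {g : A[X]}, (∀ i, N ≤ i → g.coeff i = 0) →
      (C u + X * C v) * g ∈ c.map (C : A →+* A[X]) → C v ^ N * g ∈ c.map (C : A →+* A[X]) := by
  induction N with
  | zero =>
    intro g hg _
    have : g = 0 := by ext i; simpa using hg i (Nat.zero_le i)
    simp [this]
  | succ N ih =>
    intro g hg hmem
    have hcoeff : v * g.coeff N ∈ c := by
      have := Ideal.mem_map_C_iff.mp hmem (N + 1)
      rw [add_mul, mul_assoc, coeff_add, coeff_C_mul, coeff_X_mul, coeff_C_mul,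
        hg (N + 1) le_rfl] at this
      simpa using this
    have hmon : monomial N (v * g.coeff N) ∈ c.map (C : A →+* A[X]) := by
      rw [← C_mul_X_pow_eq_monomial]
      exact Ideal.mul_mem_right _ _ (Ideal.mem_map_of_mem _ hcoeff)
    have := ih (g := C v * g - monomial N (v * g.coeff N)) (by
      intro i hi
      rw [coeff_sub, coeff_C_mul, coeff_monomial]
      split_ifs with h
      · rw [h, sub_self]
      · rw [hg i (by omega), mul_zero, sub_zero]) (by
      have e : (C u + X * C v) * (C v * g - monomial N (v * g.coeff N)) =
        C v * ((C u + X * C v) * g) - (C u + X * C v) * monomial N (v * g.coeff N) := by ring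
      rw [e]
      exact sub_mem (Ideal.mul_mem_left _ _ hmem) (Ideal.mul_mem_left _ _ hmon))
    have e : C v ^ (N + 1) * g = C v ^ N * (C v * g - monomial N (v * g.coeff N))
        + C v ^ N * monomial N (v * g.coeff N) := by ring
    rw [e]
    exact add_mem this (Ideal.mul_mem_left _ _ hmon)

/-- A linear polynomial whose leading coefficient is invertible at `P` extends a regular
sequence of constants. -/
theorem RegSeqAt.cons_linear {P : Ideal A[X]} [hP : P.IsPrime] {l : List A}
    (h : RegSeqAt (P.comap (C : A →+* A[X])) l) (u : A) {v : A} (hv : C v ∉ P) :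
    RegSeqAt P ((C u + X * C v) :: l.map C) := by
  refine ⟨fun g hg => ?_, h.map_C⟩
  rw [ofList_map_eq] at hg ⊢
  exact ⟨C v ^ (g.natDegree + 1), fun hm => hv (hP.mem_of_pow_mem _ hm),
    pow_mul_mem_of_linear_mul_mem _ (fun i hi => coeff_eq_zero_of_natDegree_lt (by omega)) hg⟩

end PolynomialRegular

/-! ### Generic specialization of ideals of grade three -/

section Specialization

open Polynomial

variable {A : Type u} [CommRing A]

theorem GradeGEAt.mono {P Q F G : Ideal A} {k : ℕ} (h : GradeGEAt P F k) (hQ : Q ≤ P)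
    (hF : F ≤ G) : GradeGEAt Q G k :=
  let ⟨l, hl, hlF, hreg⟩ := h
  ⟨l, hl, fun x hx => hF (hlF x hx), hreg.mono hQ⟩

/-- Any entrywise lift of the sequence into `F` is regular, by `RegSeqAt.of_eval_zero`. -/
theorem GradeGEAt.of_map_eval_zero [IsNoetherianRing A] {n : Ideal A} [n.IsMaximal] {F : Ideal A[X]}
    {k : ℕ} (h : GradeGEAt n (F.map (evalRingHom 0)) k) :
    GradeGEAt (n.comap (evalRingHom 0)) F k := by
  obtain ⟨l, hl, hlF, hreg⟩ := h
  have hsurj : Function.Surjective (evalRingHom (0 : A)) := fun a => ⟨C a, by simp⟩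
  choose! φ hφF hφ using fun x (hx : x ∈ F.map (evalRingHom 0)) =>
    (Ideal.mem_map_iff_of_surjective _ hsurj).mp hx
  refine ⟨l.map φ, by simp [hl], ?_, RegSeqAt.of_eval_zero ?_ |>.1⟩
  · intro x hx
    obtain ⟨y, hy, rfl⟩ := List.mem_map.mp hx
    exact hφF y (hlF y hy)
  · have : (l.map φ).map (evalRingHom 0) = l := by
      rw [List.map_map]
      conv_rhs => rw [← List.map_id l]
      exact List.map_congr_left fun x hx => hφ x (hlF x hx)
    rwa [this]

theorem GradeGEAt.exists_eval [IsNoetherianRing A] {p : Ideal A} [p.IsPrime] {K : Type*}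
    [Infinite K] (σ : K → A) (hσ : ∀ s t, s ≠ t → IsUnit (σ s - σ t)) {F : Ideal A[X]} {k : ℕ}
    (h : GradeGEAt (p.map (C : A →+* A[X])) F k) :
    ∃ s, GradeGEAt p (F.map (evalRingHom (σ s))) k := by
  obtain ⟨l, hl, hlF, hreg⟩ := h
  obtain ⟨s, hs⟩ := (RegSeqAt.finite_setOf_not_eval σ hσ hreg).infinite_compl.nonempty
  refine ⟨s, l.map (evalRingHom (σ s)), by simp [hl], ?_, not_not.mp hs⟩
  intro x hx
  obtain ⟨y, hy, rfl⟩ := List.mem_map.mp hx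
  exact Ideal.mem_map_of_mem _ (hlF y hy)

/-- Representatives of distinct residue classes differ by units. An infinite residue field thus
supplies infinitely many specialization points. -/
theorem exists_infinite_isUnit_sub (R : Type u) [CommRing R] [IsLocalRing R] :
    ∃ σ : IsLocalRing.ResidueField R → R, ∀ s t, s ≠ t → IsUnit (σ s - σ t) := by
  refine ⟨Function.surjInv IsLocalRing.residue_surjective, fun s t hst => ?_⟩
  have h := Function.surjInv_eq (IsLocalRing.residue_surjective (R := R))
  rw [← isUnit_map_iff (IsLocalRing.residue R), map_sub, h, h]
  exact (sub_ne_zero.mpr hst).isUnit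

/-- Let `a, b, c, d` be families in a local ring with infinite residue field. If `a` together with
`v` generates an ideal of grade at least `3`, and `a + x b + y c + z d` has entries
`a₁ + x v`, `a₂ + y v`, `a₃ + z v` up to divisors, then this family generates an ideal of grade at
least `3` for suitable `x, y, z`. -/
theorem exists_gradeGEAt_linear_family {R : Type u} [CommRing R] [IsNoetherianRing R]
    [IsLocalRing R] [Infinite (IsLocalRing.ResidueField R)] {ι : Type*} (a b c d : ι → R) (v : R)
    (i₁ i₂ i₃ : ι) (hb₁ : b i₁ ∣ v) (hc₁ : c i₁ = 0) (hd₁ : d i₁ = 0) (hc₂ : c i₂ ∣ v)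
    (hd₂ : d i₂ = 0) (hd₃ : d i₃ ∣ v)
    (h : GradeGEAt (IsLocalRing.maximalIdeal R) (Ideal.span (Set.range a) ⊔ Ideal.span {v}) 3) :
    ∃ x y z : R, GradeGEAt (IsLocalRing.maximalIdeal R)
      (Ideal.span (Set.range fun i => a i + x * b i + y * c i + z * d i)) 3 := by
  obtain ⟨σ, hσ⟩ := exists_infinite_isUnit_sub R
  -- One indeterminate for each of the parameters `x`, `y`, `z`. The primes `p₁`, `p₂`, `p₃` are the
  -- extensions of the maximal ideal, and `n₁`, `n₂`, `n₃` also contain the indeterminates.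
  let f₁ : ι → R[X] := fun i => C (a i) + X * C (b i)
  let f₂ : ι → R[X][X] := fun i => C (f₁ i) + X * C (C (c i))
  let f₃ : ι → R[X][X][X] := fun i => C (f₂ i) + X * C (C (C (d i)))
  set m := IsLocalRing.maximalIdeal R
  let p₁ : Ideal R[X] := m.map C
  let p₂ : Ideal R[X][X] := p₁.map C
  let p₃ : Ideal R[X][X][X] := p₂.map C
  let n₁ : Ideal R[X] := m.comap (evalRingHom 0)
  let n₂ : Ideal R[X][X] := n₁.comap (evalRingHom 0)
  let n₃ : Ideal R[X][X][X] := n₂.comap (evalRingHom 0)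
  have hn₁ : n₁.IsMaximal := Ideal.comap_isMaximal_of_surjective _ fun a => ⟨C a, by simp⟩
  have hn₂ : n₂.IsMaximal := Ideal.comap_isMaximal_of_surjective _ fun a => ⟨C a, by simp⟩
  have hpn₁ : p₁ ≤ n₁ := Ideal.map_le_iff_le_comap.mpr fun r hr => by simpa [n₁] using hr
  have hpn₂ : p₂ ≤ n₂ := Ideal.map_le_iff_le_comap.mpr fun r hr => by simpa [n₂] using hpn₁ hr
  have hpn₃ : p₃ ≤ n₃ := Ideal.map_le_iff_le_comap.mpr fun r hr => by simpa [n₃] using hpn₂ hr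
  have hp₁ : p₁.IsPrime := inferInstanceAs (m.map C).IsPrime
  have hp₂ : p₂.IsPrime := inferInstanceAs (p₁.map C).IsPrime
  have hp₃ : p₃.IsPrime := inferInstanceAs (p₂.map C).IsPrime
  have hmap : ∀ {B : Type u} [CommRing B] (a : ι → B) (F : Ideal B[X]) (f : ι → B[X]) (w : B),
      (∀ i, evalRingHom 0 (f i) = a i) →
      F = Ideal.span (Set.range f) ⊔ Ideal.span {C w} →
      Ideal.span (Set.range a) ⊔ Ideal.span {w} ≤ F.map (evalRingHom 0) := by
    intro B _ a F f w hf hF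
    rw [hF, sup_le_iff, Ideal.span_le, Ideal.span_singleton_le_iff_mem]
    constructor
    · rintro _ ⟨i, rfl⟩
      rw [SetLike.mem_coe, ← hf i]
      exact Ideal.mem_map_of_mem _ (Ideal.mem_sup_left (Ideal.subset_span ⟨i, rfl⟩))
    · have := Ideal.mem_map_of_mem (evalRingHom (0 : B))
        (Ideal.mem_sup_right (S := Ideal.span (Set.range f)) (Ideal.mem_span_singleton_self (C w)))
      simpa using this
  -- At the origin each family specializes to the previous one, so the grade of `a` together with
  -- `v` lifts step by step.
  have g₁ : GradeGEAt n₁ (Ideal.span (Set.range f₁) ⊔ Ideal.span {C v}) 3 :=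
    (h.mono le_rfl (hmap a _ f₁ v (by simp [f₁]) rfl)).of_map_eval_zero
  have g₂ : GradeGEAt n₂ (Ideal.span (Set.range f₂) ⊔ Ideal.span {C (C v)}) 3 :=
    (g₁.mono le_rfl (hmap f₁ _ f₂ (C v) (by simp [f₂]) rfl)).of_map_eval_zero
  have g₃ : GradeGEAt n₃ (Ideal.span (Set.range f₃) ⊔ Ideal.span {C (C (C v))}) 3 :=
    (g₂.mono le_rfl (hmap f₂ _ f₃ (C (C v)) (by simp [f₃]) rfl)).of_map_eval_zero
  -- Let `Q` be associated to a shorter sequence and contain the family. If `v` is in `Q`, this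
  -- contradicts `g₃`. Otherwise the divisors of `v` at `i₁`, `i₂`, `i₃` are units at `Q`, and the
  -- three linear polynomials form a regular sequence in `Q` that is too long.
  have key : GradeGEAt p₃ (Ideal.span (Set.range f₃)) 3 := by
    refine gradeGEAt_of_forall _ _ _ fun l hl hlF hreg Q hQ hQP g hg1 hg2 hle => ?_
    have hs : HasSocleAt Q (Ideal.ofList l) := hasSocleAt_of_le le_rfl le_rfl g hg1 hg2 hQ
    have hlQ : ∀ x ∈ l, x ∈ Q := fun x hx => hle (hlF x hx)
    by_cases hv : C (C (C v)) ∈ Q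
    · exact not_le_of_gradeGEAt hQP (g₃.mono hpn₃ le_rfl) hreg hlQ hl hs
        (sup_le hle ((Ideal.span_singleton_le_iff_mem _).mpr hv))
    · have hdvd : ∀ {r : R}, r ∣ v → C (C (C r)) ∉ Q := fun hr hrQ =>
        hv (Q.mem_of_dvd (map_dvd C (map_dvd C (map_dvd C hr))) hrQ)
      have hmem : ∀ i, f₃ i ∈ Q := fun i => hle (Ideal.subset_span ⟨i, rfl⟩)
      have r₁ : RegSeqAt ((Q.comap C).comap C) [f₁ i₁] :=
        RegSeqAt.cons_linear (l := []) trivial (a i₁) (hdvd hb₁)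
      have r₂ : RegSeqAt (Q.comap C) [f₂ i₂, C (f₁ i₁)] := r₁.cons_linear (f₁ i₂) (hdvd hc₂)
      have r₃ : RegSeqAt Q [f₃ i₃, C (f₂ i₂), C (C (f₁ i₁))] :=
        r₂.cons_linear (f₂ i₃) (hdvd hd₃)
      have := RegSeqAt.length_le_of_socle (hreg.mono hQP) r₃ hlQ (by
        intro x hx
        simp only [List.mem_cons, List.not_mem_nil, or_false] at hx
        rcases hx with rfl | rfl | rfl
        · exact hmem i₃
        · simpa [f₃, hd₂] using hmem i₂
        · simpa [f₃, f₂, hd₁, hc₁] using hmem i₁) hs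
      simp at this
      omega
  -- Specialization removes the outermost indeterminate first. Residue representatives remain
  -- separated by units as constants.
  obtain ⟨z, hz⟩ := key.exists_eval (fun s => C (C (σ s))) fun s t hst => by
    simpa using ((hσ s t hst).map C).map (C : R[X] →+* R[X][X])
  obtain ⟨y, hy⟩ := hz.exists_eval (fun s => C (σ s)) fun s t hst => by
    simpa using (hσ s t hst).map (C : R →+* R[X])
  obtain ⟨x, hx⟩ := hy.exists_eval σ hσ
  refine ⟨σ x, σ y, σ z, hx.mono le_rfl ?_⟩
  rw [Ideal.map_map, Ideal.map_map, Ideal.map_span, Ideal.span_le]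
  rintro _ ⟨_, ⟨i, rfl⟩, rfl⟩
  refine Ideal.subset_span ⟨i, ?_⟩
  simp [f₃, f₂, f₁]
  ring

end Specialization

/-! ### The spinor module in coordinates -/

/-- The free module on the subsets of `Fin n`, a model of the exterior algebra. -/
abbrev Spinor (R : Type u) (n : ℕ) : Type u := Finset (Fin n) → R

namespace Spinor

variable {R : Type u} [CommRing R] {n : ℕ}

/-- The sign of moving `i` into its place in `K`. -/
def sgn (R : Type u) [CommRing R] {n : ℕ} (i : Fin n) (K : Finset (Fin n)) : R :=
  (-1) ^ (K.filter (· < i)).card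

theorem sgn_mul_self (i : Fin n) (K : Finset (Fin n)) : sgn R i K * sgn R i K = 1 := by
  rw [sgn, ← pow_add, ← two_mul, pow_mul]
  simp

theorem sgn_insert {i j : Fin n} {K : Finset (Fin n)} (hj : j ∉ K) :
    sgn R i (insert j K) = if j < i then - sgn R i K else sgn R i K := by
  rw [sgn, Finset.filter_insert]
  split_ifs
  · rw [Finset.card_insert_of_notMem (by simp [hj]), pow_succ, sgn]; ring
  · rfl

theorem sgn_erase {i j : Fin n} {K : Finset (Fin n)} (hj : j ∈ K) :
    sgn R i (K.erase j) = if j < i then - sgn R i K else sgn R i K := by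
  conv_rhs => rw [← Finset.insert_erase hj]
  rw [sgn_insert (Finset.notMem_erase j K)]
  split_ifs <;> simp

/-- Exterior multiplication by the `i`-th basis vector. -/
def create (i : Fin n) : Module.End R (Spinor R n) where
  toFun s K := if i ∈ K then sgn R i K * s (K.erase i) else 0
  map_add' s t := by ext K; simp only [Pi.add_apply]; split_ifs <;> ring
  map_smul' r s := by
    ext K; simp only [Pi.smul_apply, smul_eq_mul, RingHom.id_apply]; split_ifs <;> ring

/-- Contraction with the `i`-th dual basis vector. -/
def annih (i : Fin n) : Module.End R (Spinor R n) where
  toFun s K := if i ∈ K then 0 else sgn R i K * s (insert i K)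
  map_add' s t := by ext K; simp only [Pi.add_apply]; split_ifs <;> ring
  map_smul' r s := by
    ext K; simp only [Pi.smul_apply, smul_eq_mul, RingHom.id_apply]; split_ifs <;> ring

theorem create_apply (i : Fin n) (s : Spinor R n) (K : Finset (Fin n)) :
    create i s K = if i ∈ K then sgn R i K * s (K.erase i) else 0 := rfl

theorem annih_apply (i : Fin n) (s : Spinor R n) (K : Finset (Fin n)) :
    annih i s K = if i ∈ K then 0 else sgn R i K * s (insert i K) := rfl

theorem create_mul_create (i j : Fin n) :
    create (R := R) i * create j + create j * create i = 0 := by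
  refine LinearMap.ext fun s => funext fun K => ?_
  simp only [LinearMap.add_apply, Module.End.mul_apply, create_apply, Pi.add_apply,
    LinearMap.zero_apply, Pi.zero_apply, Finset.mem_erase]
  rcases eq_or_ne i j with rfl | hij
  · simp
  by_cases hi : i ∈ K <;> by_cases hj : j ∈ K <;> simp only [hi, hj, hij, hij.symm, ne_eq,
    not_false_eq_true, and_self, if_true, if_false, and_false, mul_zero, add_zero]
  rw [sgn_erase hi, sgn_erase hj, Finset.erase_right_comm]
  rcases lt_or_gt_of_ne hij with h | h
  · simp only [h, h.not_gt, if_true, if_false]; ring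
  · simp only [h, h.not_gt, if_true, if_false]; ring

theorem annih_mul_annih (i j : Fin n) :
    annih (R := R) i * annih j + annih j * annih i = 0 := by
  refine LinearMap.ext fun s => funext fun K => ?_
  simp only [LinearMap.add_apply, Module.End.mul_apply, annih_apply, Pi.add_apply,
    LinearMap.zero_apply, Pi.zero_apply, Finset.mem_insert]
  rcases eq_or_ne i j with rfl | hij
  · simp
  by_cases hi : i ∈ K <;> by_cases hj : j ∈ K <;> simp only [hi, hj, hij, hij.symm, or_self,
    if_true, if_false, or_true, mul_zero, add_zero]
  rw [sgn_insert hi, sgn_insert hj, Finset.insert_comm]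
  rcases lt_or_gt_of_ne hij with h | h
  · simp only [h, h.not_gt, if_true, if_false]; ring
  · simp only [h, h.not_gt, if_true, if_false]; ring

theorem create_mul_annih (i j : Fin n) :
    create (R := R) i * annih j + annih j * create i = if i = j then 1 else 0 := by
  refine LinearMap.ext fun s => funext fun K => ?_
  simp only [LinearMap.add_apply, Module.End.mul_apply, annih_apply, create_apply, Pi.add_apply,
    Finset.mem_insert, Finset.mem_erase]
  rcases eq_or_ne i j with rfl | hij
  · by_cases hi : i ∈ K
    · simp only [hi, if_true, ne_eq, not_true_eq_false, false_and, if_false, add_zero,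
        Module.End.one_apply]
      rw [sgn_erase hi, Finset.insert_erase hi]
      simp only [lt_irrefl, if_false]
      rw [← mul_assoc, sgn_mul_self, one_mul]
    · simp only [hi, if_false, true_or, if_true, zero_add, Module.End.one_apply]
      rw [sgn_insert hi, Finset.erase_insert hi]
      simp only [lt_irrefl, if_false]
      rw [← mul_assoc, sgn_mul_self, one_mul]
  · by_cases hi : i ∈ K <;> by_cases hj : j ∈ K <;> simp only [hi, hj, hij, hij.symm, ne_eq,
      not_false_eq_true, and_self, if_true, if_false, and_false, or_true, or_self,
      mul_zero, add_zero, LinearMap.zero_apply, Pi.zero_apply]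
    rw [sgn_insert hj, sgn_erase hi, Finset.erase_insert_of_ne hij.symm]
    rcases lt_or_gt_of_ne hij with h | h
    · simp only [h, h.not_gt, if_true, if_false]; ring
    · simp only [h, h.not_gt, if_true, if_false]; ring

/-- The Clifford action of a vector with coordinates `(α, β)`. -/
def act : ((Fin n → R) × (Fin n → R)) →ₗ[R] Module.End R (Spinor R n) :=
  ∑ i, ((LinearMap.proj i ∘ₗ LinearMap.fst R (Fin n → R) (Fin n → R)).smulRight (create i)
    + (LinearMap.proj i ∘ₗ LinearMap.snd R (Fin n → R) (Fin n → R)).smulRight (annih i))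

theorem act_eq (x : (Fin n → R) × (Fin n → R)) :
    act x = ∑ i, (x.1 i • create i + x.2 i • annih i) := by
  simp [act, LinearMap.sum_apply]

/-- The hyperbolic form on `Rⁿ × Rⁿ`. -/
def hyp (x y : (Fin n → R) × (Fin n → R)) : R := ∑ i, (x.1 i * y.2 i + x.2 i * y.1 i)

/-- The polarized Clifford relation. On the diagonal it only gives twice the square of `act x`,
hence the later role of the invertibility of 2. -/
theorem act_mul_act (x y : (Fin n → R) × (Fin n → R)) :
    act x * act y + act y * act x = hyp x y • (1 : Module.End R (Spinor R n)) := by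
  have key : ∀ i j : Fin n, (x.1 i • create (R := R) i + x.2 i • annih i) *
      (y.1 j • create j + y.2 j • annih j) + (y.1 j • create j + y.2 j • annih j) *
      (x.1 i • create i + x.2 i • annih i) =
      if i = j then (x.1 i * y.2 i + x.2 i * y.1 i) • (1 : Module.End R (Spinor R n)) else 0 := by
    intro i j
    have h1 := create_mul_create (R := R) i j
    have h2 := annih_mul_annih (R := R) i j
    have h3 := create_mul_annih (R := R) i j
    have h4 := create_mul_annih (R := R) j i
    have e : (x.1 i • create (R := R) i + x.2 i • annih i) *
      (y.1 j • create j + y.2 j • annih j) + (y.1 j • create j + y.2 j • annih j) *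
      (x.1 i • create i + x.2 i • annih i) =
      (x.1 i * y.1 j) • (create i * create j + create j * create i) +
      (x.2 i * y.2 j) • (annih i * annih j + annih j * annih i) +
      (x.1 i * y.2 j) • (create i * annih j + annih j * create i) +
      (x.2 i * y.1 j) • (create j * annih i + annih i * create j) := by
      simp only [add_mul, mul_add, smul_mul_smul_comm, smul_add, mul_comm (y.1 j),
        mul_comm (y.2 j)]
      abel
    rw [e, h1, h2, h3, h4]
    rcases eq_or_ne i j with rfl | hij
    · simp [add_smul]
    · simp [hij, hij.symm]
  rw [act_eq, act_eq, Finset.sum_mul_sum, Finset.sum_mul_sum]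
  rw [Finset.sum_comm (s := Finset.univ) (t := Finset.univ)
    (f := fun i j => (y.1 i • create (R := R) i + y.2 i • annih i) * (x.1 j • create j + x.2 j • annih j))]
  rw [← Finset.sum_add_distrib]
  simp_rw [← Finset.sum_add_distrib, key]
  simp [hyp, Finset.sum_smul]

theorem act_act (x y : (Fin n → R) × (Fin n → R)) (s : Spinor R n) :
    act x (act y s) + act y (act x s) = hyp x y • s := by
  have := LinearMap.congr_fun (act_mul_act x y) s
  simpa using this

theorem annih_annih_comm (i j : Fin n) (s : Spinor R n) :
    annih i (annih j s) = - annih j (annih i s) := by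
  have := LinearMap.congr_fun (annih_mul_annih (R := R) i j) s
  exact eq_neg_of_add_eq_zero_left (by simpa using this)

theorem annih_annih_self (i : Fin n) (s : Spinor R n) : annih i (annih i s) = 0 := by
  ext K
  simp [annih_apply]

end Spinor

/-! ### Commutation rules and shears of the hyperbolic space -/

namespace Spinor

variable {R : Type u} [CommRing R] {n : ℕ}

theorem act_zero_single (j : Fin n) (r : R) :
    act ((0 : Fin n → R), Pi.single j r) = r • annih j := by
  rw [act_eq, Finset.sum_eq_single j]
  · simp
  · intro i _ hij
    simp [hij]
  · simp

theorem act_single_zero (j : Fin n) (r : R) :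
    act (Pi.single j r, (0 : Fin n → R)) = r • create j := by
  rw [act_eq, Finset.sum_eq_single j]
  · simp
  · intro i _ hij
    simp [hij]
  · simp

theorem annih_act (j : Fin n) (y : (Fin n → R) × (Fin n → R)) (s : Spinor R n) :
    annih j (act y s) = y.1 j • s - act y (annih j s) := by
  have h := act_act ((0 : Fin n → R), Pi.single j (1 : R)) y s
  have h' : hyp ((0 : Fin n → R), Pi.single j (1 : R)) y = y.1 j := by
    simp [hyp, Pi.single_apply]
  rw [h', act_zero_single, one_smul] at h
  rw [← h]
  abel

theorem create_act (j : Fin n) (y : (Fin n → R) × (Fin n → R)) (s : Spinor R n) :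
    create j (act y s) = y.2 j • s - act y (create j s) := by
  have h := act_act (Pi.single j (1 : R), (0 : Fin n → R)) y s
  have h' : hyp (Pi.single j (1 : R), (0 : Fin n → R)) y = y.2 j := by
    simp [hyp, Pi.single_apply]
  rw [h', act_single_zero, one_smul] at h
  rw [← h]
  abel

theorem hyp_comm (x y : (Fin n → R) × (Fin n → R)) : hyp x y = hyp y x :=
  Finset.sum_congr rfl fun i _ => by ring

theorem hyp_add_left (x x' y : (Fin n → R) × (Fin n → R)) :
    hyp (x + x') y = hyp x y + hyp x' y := by
  rw [hyp, hyp, hyp, ← Finset.sum_add_distrib]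
  exact Finset.sum_congr rfl fun i _ => by simp; ring

theorem hyp_add_right (x y y' : (Fin n → R) × (Fin n → R)) :
    hyp x (y + y') = hyp x y + hyp x y' := by
  rw [hyp_comm, hyp_add_left, hyp_comm y, hyp_comm y']

theorem hyp_zero_single (j : Fin n) (r : R) (y : (Fin n → R) × (Fin n → R)) :
    hyp ((0 : Fin n → R), Pi.single j r) y = r * y.1 j := by
  simp [hyp, Pi.single_apply]

theorem hyp_single_zero (j : Fin n) (r : R) (y : (Fin n → R) × (Fin n → R)) :
    hyp (Pi.single j r, (0 : Fin n → R)) y = r * y.2 j := by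
  simp [hyp, Pi.single_apply]

/-- The linear map underlying `shear`. -/
def shearMap (j k : Fin n) (x : R) :
    ((Fin n → R) × (Fin n → R)) →ₗ[R] (Fin n → R) × (Fin n → R) :=
  LinearMap.inr R (Fin n → R) (Fin n → R) ∘ₗ
    ((LinearMap.proj k ∘ₗ LinearMap.fst R (Fin n → R) (Fin n → R)).smulRight (Pi.single j x)
      - (LinearMap.proj j ∘ₗ LinearMap.fst R (Fin n → R) (Fin n → R)).smulRight (Pi.single k x))

theorem shearMap_apply (j k : Fin n) (x : R) (y : (Fin n → R) × (Fin n → R)) :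
    shearMap j k x y = (0, y.1 k • Pi.single j x - y.1 j • Pi.single k x) := by
  simp [shearMap]

/-- The isometry of the hyperbolic form which fixes the second summand and moves the `j`-th and
the `k`-th basis vector of the first. -/
def shear (j k : Fin n) (x : R) :
    ((Fin n → R) × (Fin n → R)) ≃ₗ[R] (Fin n → R) × (Fin n → R) :=
  LinearEquiv.ofLinearMap (LinearMap.id + shearMap j k x) (LinearMap.id - shearMap j k x)
    (by ext1 <;> (refine LinearMap.ext fun y => ?_) <;> simp [shearMap_apply])
    (by ext1 <;> (refine LinearMap.ext fun y => ?_) <;> simp [shearMap_apply])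

theorem shear_apply (j k : Fin n) (x : R) (y : (Fin n → R) × (Fin n → R)) :
    shear j k x y = y + shearMap j k x y := rfl

theorem hyp_shear (j k : Fin n) (x : R) (y z : (Fin n → R) × (Fin n → R)) :
    hyp (shear j k x y) (shear j k x z) = hyp y z := by
  have key : ∀ y z : (Fin n → R) × (Fin n → R), hyp (shearMap j k x y) z =
      x * (y.1 k * z.1 j - y.1 j * z.1 k) := by
    intro y z
    have e : shearMap j k x y = ((0 : Fin n → R), Pi.single j (y.1 k * x)) +
        ((0 : Fin n → R), Pi.single k (- y.1 j * x)) := by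
      rw [shearMap_apply]
      ext i <;> simp [Pi.single_apply]
      split_ifs <;> ring
    rw [e, hyp_add_left, hyp_zero_single, hyp_zero_single]
    ring
  rw [shear_apply, shear_apply, hyp_add_left, hyp_add_right, key, hyp_comm y (shearMap j k x z), key]
  rw [Prod.fst_add, shearMap_apply j k x z]
  simp
  ring

theorem act_shearMap (j k : Fin n) (x : R) (y : (Fin n → R) × (Fin n → R)) :
    act (shearMap j k x y) = (y.1 k * x) • annih j - (y.1 j * x) • annih k := by
  have e : shearMap j k x y = ((0 : Fin n → R), Pi.single j (y.1 k * x)) -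
      ((0 : Fin n → R), Pi.single k (y.1 j * x)) := by
    rw [shearMap_apply]
    ext i <;> simp [Pi.single_apply]
  rw [e, map_sub, act_zero_single, act_zero_single]

/-- The action of `shear j k x` on spinors. -/
def shearSpinor (j k : Fin n) (x : R) : Module.End R (Spinor R n) := 1 + x • (annih j * annih k)

theorem shearSpinor_apply (j k : Fin n) (x : R) (s : Spinor R n) :
    shearSpinor j k x s = s + x • annih j (annih k s) := rfl

theorem annih_annih_annih (j k : Fin n) (s : Spinor R n) :
    annih k (annih j (annih k s)) = 0 := by
  rw [annih_annih_comm j k, map_neg, annih_annih_self, neg_zero]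

/-- `shearSpinor` is the exponential of `x • (annih j * annih k)`, which squares to zero; it is the
spin lift of the shear. -/
theorem act_shear (j k : Fin n) (x : R) (y : (Fin n → R) × (Fin n → R)) (s : Spinor R n) :
    act (shear j k x y) (shearSpinor j k x s) = shearSpinor j k x (act y s) := by
  rw [shear_apply, map_add, act_shearMap, shearSpinor_apply, shearSpinor_apply, annih_act]
  rw [map_sub, annih_act]
  simp only [LinearMap.add_apply, LinearMap.sub_apply, LinearMap.smul_apply, map_add, map_smul,
    annih_annih_self, annih_annih_annih, smul_zero, smul_sub, smul_smul]
  module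

theorem shearSpinor_neg (j k : Fin n) (x : R) (s : Spinor R n) :
    shearSpinor j k (-x) (shearSpinor j k x s) = s := by
  rw [shearSpinor_apply, shearSpinor_apply]
  simp [annih_annih_annih]

theorem annih_annih_mem {P : Ideal R} {s : Spinor R n} (h : ∀ K, s K ∈ P) (j k : Fin n)
    (K : Finset (Fin n)) : annih j (annih k s) K ∈ P := by
  have : ∀ s : Spinor R n, (∀ K, s K ∈ P) → ∀ (j : Fin n) (K), annih j s K ∈ P := by
    intro s h j K
    rw [annih_apply]
    split_ifs
    · exact zero_mem _
    · exact P.mul_mem_left _ (h _)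
  exact this _ (fun K => this _ h _ K) _ K

/-- Spinors supported in odd degrees. -/
def IsOdd (s : Spinor R n) : Prop := ∀ K, Even K.card → s K = 0

theorem IsOdd.annih_annih {s : Spinor R n} (h : IsOdd s) (j k : Fin n) :
    IsOdd (annih j (annih k s)) := by
  intro K hK
  rw [annih_apply, annih_apply]
  split_ifs with h1 h2
  · rfl
  · simp
  · rw [h, mul_zero, mul_zero]
    rw [Finset.card_insert_of_notMem h2, Finset.card_insert_of_notMem h1]
    exact (hK.add_one).add_one

variable {E : Type v} [AddCommGroup E] [Module R E]

/-- Spinor coordinates of a submodule `L` with respect to hyperbolic coordinates `ε`, which do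
not vanish on a set of primes. -/
structure IsSpinorOf (form : LinearMap.BilinForm R E) (L : Submodule R E)
    (U : Set (PrimeSpectrum R)) (ε : E ≃ₗ[R] (Fin n → R) × (Fin n → R)) (s : Spinor R n) :
    Prop where
  isometry : ∀ x y, form x y = hyp (ε x) (ε y)
  isOdd : IsOdd s
  annihilated : ∀ x ∈ L, act (ε x) s = 0
  nonvanishing : ∀ P ∈ U, ∃ K, s K ∉ P.asIdeal

variable {form : LinearMap.BilinForm R E} {L : Submodule R E} {U : Set (PrimeSpectrum R)}
  {ε : E ≃ₗ[R] (Fin n → R) × (Fin n → R)} {s : Spinor R n}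

theorem IsSpinorOf.shear (h : IsSpinorOf form L U ε s) (j k : Fin n) (x : R) :
    IsSpinorOf form L U (ε.trans (shear j k x)) (shearSpinor j k x s) where
  isometry y z := by
    rw [LinearEquiv.trans_apply, LinearEquiv.trans_apply, hyp_shear, h.isometry]
  isOdd K hK := by
    rw [shearSpinor_apply]
    simp [h.isOdd K hK, (h.isOdd.annih_annih j k) K hK]
  annihilated y hy := by
    rw [LinearEquiv.trans_apply, act_shear, h.annihilated y hy, map_zero]
  nonvanishing P hP := by
    by_contra! hcon
    obtain ⟨K, hK⟩ := h.nonvanishing P hP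
    apply hK
    rw [← shearSpinor_neg j k x s, shearSpinor_apply]
    exact add_mem (hcon K) (Ideal.mul_mem_left _ _ (annih_annih_mem hcon j k K))

/-- The coordinate at `T` reappears up to sign at `T` without `j` and `k`: this is how a shear feeds
a top coordinate into lower ones. -/
theorem annih_annih_dvd {T : Finset (Fin n)} {j k : Fin n} (hjk : j ≠ k) (hj : j ∈ T) (hk : k ∈ T)
    (s : Spinor R n) : annih j (annih k s) ((T.erase j).erase k) ∣ s T := by
  have h1 : j ∉ (T.erase j).erase k := by simp
  have h2 : k ∉ T.erase k := by simp
  have e : insert j ((T.erase j).erase k) = T.erase k := by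
    rw [Finset.erase_right_comm, Finset.insert_erase (by simp [hjk, hj])]
  rw [annih_apply, if_neg h1, e, annih_apply, if_neg h2, Finset.insert_erase hk, ← mul_assoc]
  refine ⟨sgn R j ((T.erase j).erase k) * sgn R k (T.erase k), ?_⟩
  have h3 := sgn_mul_self (R := R) j ((T.erase j).erase k)
  have h4 := sgn_mul_self (R := R) k (T.erase k)
  linear_combination (-s T * sgn R k (T.erase k) * sgn R k (T.erase k)) * h3 - s T * h4

theorem annih_annih_eq_zero {K : Finset (Fin n)} {j k : Fin n} (h : j ∈ K ∨ k ∈ K)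
    (s : Spinor R n) : annih j (annih k s) K = 0 := by
  rw [annih_apply, annih_apply]
  rcases h with h | h
  · simp [h]
  · simp [h]

/-- Generic coordinates: if the coordinates of a spinor in a set `𝒯` of degrees generate an ideal
of grade at least three, then so do the coordinates of degree one, after a change of the
hyperbolic coordinates. -/
theorem IsSpinorOf.exists_generic [IsNoetherianRing R] [IsLocalRing R]
    [Infinite (IsLocalRing.ResidueField R)] (N : ℕ) :
    ∀ {ε : E ≃ₗ[R] (Fin n → R) × (Fin n → R)} {s : Spinor R n} (_ : IsSpinorOf form L U ε s)
      (𝒯 : Finset (Finset (Fin n))), 𝒯.card = N → (∀ K ∈ 𝒯, Odd K.card) →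
      (∀ K ∈ 𝒯, ∀ K' : Finset (Fin n), Odd K'.card → K'.card < K.card → K' ∈ 𝒯) →
      GradeGEAt (IsLocalRing.maximalIdeal R) (Ideal.span (s '' (𝒯 : Set (Finset (Fin n))))) 3 →
      ∃ (ε' : E ≃ₗ[R] (Fin n → R) × (Fin n → R)) (s' : Spinor R n), IsSpinorOf form L U ε' s' ∧
        GradeGEAt (IsLocalRing.maximalIdeal R)
          (Ideal.span (Set.range fun i : Fin n => s' {i})) 3 := by
  induction N with
  | zero =>
    intro ε s h 𝒯 hN _ _ hg
    obtain rfl := Finset.card_eq_zero.mp hN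
    exact ⟨ε, s, h, hg.mono le_rfl (by simp)⟩
  | succ N ih =>
    intro ε s h 𝒯 hN hodd hlow hg
    by_cases h1 : ∀ K ∈ 𝒯, K.card ≤ 1
    · refine ⟨ε, s, h, hg.mono le_rfl (Ideal.span_le.mpr ?_)⟩
      rintro _ ⟨K, hK, rfl⟩
      have hK1 : K.card = 1 := by
        have := h1 K hK
        have := (hodd K hK).pos
        omega
      obtain ⟨i, rfl⟩ := Finset.card_eq_one.mp hK1
      exact Ideal.subset_span ⟨i, rfl⟩
    push Not at h1
    -- The largest degree is the one to be removed. It has at least three indices, since degrees in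
    -- `𝒯` are odd and some exceed one.
    obtain ⟨T, hT, hTmax⟩ := Finset.exists_max_image 𝒯 Finset.card
      (Finset.card_pos.mp (by omega))
    have hT3 : 2 < T.card := by
      obtain ⟨K, hK, hK1⟩ := h1
      have h2 := hTmax K hK
      have h3 := hodd T hT
      rcases h3 with ⟨m, hm⟩
      omega
    obtain ⟨i, j, k, hi, hj, hk, hij, hik, hjk⟩ := Finset.two_lt_card_iff.mp hT3
    have herase : ∀ p q : Fin n, p ∈ T → q ∈ T → p ≠ q → (T.erase p).erase q ∈ 𝒯.erase T := by
      intro p q hp hq hpq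
      have hc : ((T.erase p).erase q).card + 2 = T.card := by
        rw [Finset.card_erase_of_mem (by simp [hq, hpq.symm]), Finset.card_erase_of_mem hp]
        omega
      refine Finset.mem_erase.mpr ⟨fun h => by rw [h] at hc; omega, hlow T hT _ ?_ (by omega)⟩
      have := hodd T hT
      rw [← hc] at this
      simpa [Nat.odd_add] using this
    let ι := {K // K ∈ 𝒯.erase T}
    -- The three shears use the pairs from `{i, j, k}`. At `T` without a pair, the contraction with
    -- that pair gives `± s T`, while the other two contractions vanish because one of their indices
    -- is still present.
    obtain ⟨x, y, z, hxyz⟩ := exists_gradeGEAt_linear_family (ι := ι) (fun K => s K.1)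
      (fun K => annih j (annih k s) K.1) (fun K => annih i (annih k s) K.1)
      (fun K => annih i (annih j s) K.1) (s T) ⟨_, herase j k hj hk hjk⟩ ⟨_, herase i k hi hk hik⟩
      ⟨_, herase i j hi hj hij⟩ (annih_annih_dvd hjk hj hk s)
      (annih_annih_eq_zero (Or.inl (by simp [hi, hij, hik])) s)
      (annih_annih_eq_zero (Or.inl (by simp [hi, hij, hik])) s)
      (annih_annih_dvd hik hi hk s)
      (annih_annih_eq_zero (Or.inr (by simp [hj, hjk, hij.symm])) s)
      (annih_annih_dvd hij hi hj s)
      (hg.mono le_rfl (by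
        rw [Ideal.span_le]
        rintro _ ⟨K, hK, rfl⟩
        by_cases hKT : K = T
        · subst hKT
          exact Ideal.mem_sup_right (Ideal.mem_span_singleton_self _)
        · exact Ideal.mem_sup_left (Ideal.subset_span
            ⟨⟨K, Finset.mem_erase.mpr ⟨hKT, hK⟩⟩, rfl⟩)))
    refine ih (((h.shear j k x).shear i k y).shear i j z) (𝒯.erase T)
      (by rw [Finset.card_erase_of_mem hT]; omega) (fun K hK => hodd K (Finset.mem_of_mem_erase hK))
      ?_ (hxyz.mono le_rfl ?_)
    · intro K hK K' hK' hlt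
      have hK2 := Finset.mem_of_mem_erase hK
      refine Finset.mem_erase.mpr ⟨?_, hlow K hK2 K' hK' hlt⟩
      rintro rfl
      have := hTmax K hK2
      omega
    · rw [Ideal.span_le]
      rintro _ ⟨⟨K, hK⟩, rfl⟩
      refine Ideal.subset_span ⟨K, hK, ?_⟩
      -- Mixed terms vanish, since any two of the three pairs share an index.
      have e : shearSpinor i j z (shearSpinor i k y (shearSpinor j k x s)) =
          s + x • annih j (annih k s) + y • annih i (annih k s) + z • annih i (annih j s) := by
        simp only [shearSpinor_apply, map_add, map_smul, annih_annih_self, annih_annih_annih,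
          smul_zero, map_zero, add_zero, map_neg, neg_zero, annih_annih_comm j i (annih k _)]
        abel
      rw [e]
      simp

end Spinor

/-! ### The vacuum spinor and parity -/

namespace Spinor

variable {R : Type u} [CommRing R] {n : ℕ}

/-- Terms cancel in pairs by anticommutation, without division by 2; this is the relation needed for
the universal property of the exterior algebra. -/
theorem act_left_mul_self (α : Fin n → R) :
    act (α, (0 : Fin n → R)) * act (α, (0 : Fin n → R)) = 0 := by
  rw [act_eq, Finset.sum_mul_sum, ← Finset.sum_product']
  have anti : ∀ i j : Fin n, create (R := R) i * create j = - (create j * create i) := fun i j =>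
    eq_neg_of_add_eq_zero_left (create_mul_create i j)
  have sq : ∀ i : Fin n, create (R := R) i * create i = 0 := fun i =>
    LinearMap.ext fun s => funext fun K => by simp [create_apply]
  refine Finset.sum_involution (fun x _ => x.swap) ?_ ?_ ?_ ?_
  · rintro ⟨i, j⟩ -
    simp only [Prod.swap, Pi.zero_apply, zero_smul, add_zero, smul_mul_smul_comm, anti i j,
      smul_neg, mul_comm (α j)]
    simp
  · rintro ⟨i, j⟩ - h heq
    simp only [Prod.swap, Prod.mk.injEq] at heq
    obtain ⟨rfl, -⟩ := heq
    exact h (by simp [sq])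
  · simp
  · simp

/-- The spinor spanning the scalars of the exterior algebra. -/
def vac : Spinor R n := Pi.single ∅ 1

theorem annih_vac (i : Fin n) : annih i (vac : Spinor R n) = 0 := by
  ext K
  simp [annih_apply, vac]

theorem create_single (i : Fin n) {K : Finset (Fin n)} (hi : i ∉ K) :
    sgn R i K • create i (Pi.single K (1 : R)) = Pi.single (insert i K) (1 : R) := by
  ext K'
  simp only [Pi.smul_apply, create_apply, Pi.single_apply, smul_eq_mul]
  by_cases h : K' = insert i K
  · subst h
    rw [if_pos rfl, if_pos (by simp), Finset.erase_insert hi, if_pos rfl, mul_one, sgn_insert hi]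
    simp [sgn_mul_self]
  · rw [if_neg h]
    split_ifs with h1 h2
    · exact absurd (by rw [← h2, Finset.insert_erase h1]) h
    · simp
    · simp

/-- Spinors supported in even degrees. -/
def IsEven (s : Spinor R n) : Prop := ∀ K, Odd K.card → s K = 0

theorem IsOdd.create {s : Spinor R n} (h : IsOdd s) (i : Fin n) : IsEven (create i s) := by
  intro K hK
  rw [create_apply]
  split_ifs with hi
  · rw [h, mul_zero]
    rw [Finset.card_erase_of_mem hi]
    exact hK.tsub_odd odd_one
  · rfl

theorem IsEven.create {s : Spinor R n} (h : IsEven s) (i : Fin n) : IsOdd (create i s) := by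
  intro K hK
  rw [create_apply]
  split_ifs with hi
  · rw [h, mul_zero]
    rw [Finset.card_erase_of_mem hi]
    have := Finset.card_pos.mpr ⟨i, hi⟩
    exact Nat.Even.sub_odd this hK odd_one
  · rfl

theorem IsOdd.annih {s : Spinor R n} (h : IsOdd s) (i : Fin n) : IsEven (annih i s) := by
  intro K hK
  rw [annih_apply]
  split_ifs with hi
  · rfl
  · rw [h _ (by rw [Finset.card_insert_of_notMem hi]; exact hK.add_one), mul_zero]

theorem IsEven.annih {s : Spinor R n} (h : IsEven s) (i : Fin n) : IsOdd (annih i s) := by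
  intro K hK
  rw [annih_apply]
  split_ifs with hi
  · rfl
  · rw [h _ (by rw [Finset.card_insert_of_notMem hi]; exact hK.add_one), mul_zero]

theorem act_apply (x : (Fin n → R) × (Fin n → R)) (s : Spinor R n) (K : Finset (Fin n)) :
    act x s K = ∑ i, (x.1 i * create i s K + x.2 i * annih i s K) := by
  rw [act_eq, LinearMap.sum_apply, Finset.sum_apply]
  rfl

theorem IsOdd.act {s : Spinor R n} (h : IsOdd s) (x : (Fin n → R) × (Fin n → R)) :
    IsEven (act x s) := by
  intro K hK
  rw [act_apply]
  exact Finset.sum_eq_zero fun i _ => by rw [h.create i K hK, h.annih i K hK]; simp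

theorem IsEven.act {s : Spinor R n} (h : IsEven s) (x : (Fin n → R) × (Fin n → R)) :
    IsOdd (act x s) := by
  intro K hK
  rw [act_apply]
  exact Finset.sum_eq_zero fun i _ => by rw [h.create i K hK, h.annih i K hK]; simp

end Spinor

/-! ### Comparison of the exterior algebra with the coordinate model -/

namespace IsotropicDecomposition

open Spinor

variable {R : Type u} [CommRing R] {E : Type v} [AddCommGroup E] [Module R E]
  {form : LinearMap.BilinForm R E} (D : IsotropicDecomposition form) {n : ℕ}

/-- Hyperbolic coordinates whose coordinate subspaces are the summands of a decomposition. -/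
structure IsAdapted (ε : E ≃ₗ[R] (Fin n → R) × (Fin n → R)) : Prop where
  isometry : ∀ x y, form x y = hyp (ε x) (ε y)
  mem_H : ∀ x, x ∈ D.H ↔ (ε x).2 = 0
  mem_H' : ∀ x, x ∈ D.H' ↔ (ε x).1 = 0

variable {D} {ε : E ≃ₗ[R] (Fin n → R) × (Fin n → R)}

theorem IsAdapted.apply_coe (hε : D.IsAdapted ε) (h : D.H) : ε h = ((ε h).1, 0) :=
  Prod.ext rfl ((hε.mem_H _).1 h.2)

theorem IsAdapted.apply_projectionOnto (hε : D.IsAdapted ε) (x : E) :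
    ε (D.H.projectionOnto D.H' D.isCompl x) = ((ε x).1, 0) := by
  have h2 : x - D.H.projectionOnto D.H' D.isCompl x ∈ D.H' := by
    rw [← Submodule.projectionOnto_apply_eq_zero_iff D.isCompl, map_sub,
      Submodule.projectionOnto_apply_left, sub_self]
  rw [hε.mem_H', map_sub] at h2
  rw [hε.apply_coe]
  have : (ε x).1 - (ε (D.H.projectionOnto D.H' D.isCompl x)).1 = 0 := h2
  rw [sub_eq_zero.mp this]

/-- The first summand is free on the coordinates. -/
noncomputable def IsAdapted.equivH (hε : D.IsAdapted ε) : D.H ≃ₗ[R] (Fin n → R) where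
  toFun h := (ε h).1
  invFun α := ⟨ε.symm (α, 0), by rw [hε.mem_H]; simp⟩
  map_add' x y := by simp
  map_smul' r x := by simp
  left_inv h := by
    apply Subtype.ext
    change ε.symm ((ε h).1, 0) = h
    rw [← hε.apply_coe, LinearEquiv.symm_apply_apply]
  right_inv α := by simp

theorem IsAdapted.equivH_apply (hε : D.IsAdapted ε) (h : D.H) : hε.equivH h = (ε h).1 := rfl

/-- The basis of the first summand. -/
noncomputable def IsAdapted.basisH (hε : D.IsAdapted ε) : Basis (Fin n) R D.H :=
  Basis.ofEquivFun hε.equivH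

theorem IsAdapted.apply_basisH (hε : D.IsAdapted ε) (i : Fin n) :
    ε (hε.basisH i) = (Pi.single i 1, 0) := by
  rw [hε.apply_coe, ← hε.equivH_apply, IsAdapted.basisH, Basis.coe_ofEquivFun,
    LinearEquiv.apply_symm_apply]

theorem IsAdapted.dual_apply (hε : D.IsAdapted ε) (d : Dual R D.H) (h : D.H) :
    d h = ∑ i, d (hε.basisH i) * (ε h).1 i := by
  conv_lhs => rw [← hε.basisH.sum_repr h]
  rw [map_sum]
  refine Finset.sum_congr rfl fun i _ => ?_
  rw [map_smul, smul_eq_mul, mul_comm]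
  rfl

/-- The comparison of the exterior algebra with the coordinate model. -/
noncomputable def IsAdapted.toSpinor (hε : D.IsAdapted ε) :
    ExteriorAlgebra R D.H →ₗ[R] Spinor R n :=
  (LinearMap.applyₗ (vac : Spinor R n)) ∘ₗ
    (ExteriorAlgebra.lift R ⟨act ∘ₗ ε.toLinearMap ∘ₗ D.H.subtype, fun h => by
      change act (ε h) * act (ε h) = 0
      rw [hε.apply_coe, act_left_mul_self]⟩).toLinearMap

theorem IsAdapted.toSpinor_algebraMap (hε : D.IsAdapted ε) (r : R) :
    hε.toSpinor (algebraMap R _ r) = r • vac := by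
  simp [IsAdapted.toSpinor]

theorem IsAdapted.toSpinor_ι_mul (hε : D.IsAdapted ε) (h : D.H) (s : ExteriorAlgebra R D.H) :
    hε.toSpinor (ExteriorAlgebra.ι R h * s) = act (ε h) (hε.toSpinor s) := by
  simp [IsAdapted.toSpinor]

/-- Both sides vanish on scalars and obey the same antiderivation rule; for the right side this rule
is the Clifford relation. -/
theorem IsAdapted.toSpinor_contractLeft (hε : D.IsAdapted ε) (d : Dual R D.H)
    (s : ExteriorAlgebra R D.H) :
    hε.toSpinor (CliffordAlgebra.contractLeft (Q := (0 : QuadraticForm R D.H)) d s) =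
      act (0, fun i => d (hε.basisH i)) (hε.toSpinor s) := by
  induction s using CliffordAlgebra.left_induction with
  | algebraMap r =>
    rw [CliffordAlgebra.contractLeft_algebraMap, map_zero]
    rw [show hε.toSpinor (algebraMap R _ r) = r • vac from hε.toSpinor_algebraMap r]
    rw [act_eq]
    simp [annih_vac]
  | add x y hx hy => simp only [map_add, hx, hy]
  | ι_mul x m hx =>
    rw [CliffordAlgebra.contractLeft_ι_mul, map_sub, map_smul]
    rw [show hε.toSpinor (CliffordAlgebra.ι 0 m * x) = _ from hε.toSpinor_ι_mul m x]
    rw [show hε.toSpinor (CliffordAlgebra.ι 0 m * _) = _ from hε.toSpinor_ι_mul m _, hx]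
    have := act_act (0, fun i => d (hε.basisH i)) (ε m) (hε.toSpinor x)
    rw [eq_comm, eq_sub_iff_add_eq, this, hε.dual_apply d m]
    simp [hyp]

theorem IsAdapted.toSpinor_cliffordAction (hε : D.IsAdapted ε) (x : E)
    (s : ExteriorAlgebra R D.H) :
    hε.toSpinor (D.cliffordAction x s) = act (ε x) (hε.toSpinor s) := by
  have e : D.cliffordAction x s = ExteriorAlgebra.ι R (D.H.projectionOnto D.H' D.isCompl x) * s +
      CliffordAlgebra.contractLeft (Q := (0 : QuadraticForm R D.H))
        (D.H.subtype.dualMap (form x)) s := rfl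
  rw [e, map_add, hε.toSpinor_ι_mul, hε.toSpinor_contractLeft, hε.apply_projectionOnto,
    ← LinearMap.add_apply, ← map_add]
  congr 2
  refine Prod.ext (by simp) ?_
  ext i
  simp only [Prod.mk_add_mk, zero_add, LinearMap.dualMap_apply, Submodule.subtype_apply]
  rw [hε.isometry, hε.apply_basisH, hyp_comm, hyp_single_zero, one_mul]

theorem IsAdapted.toSpinor_surjective (hε : D.IsAdapted ε) :
    Function.Surjective hε.toSpinor := by
  rw [← LinearMap.range_eq_top, eq_top_iff]
  have hsingle : ∀ K : Finset (Fin n), Pi.single K (1 : R) ∈ LinearMap.range hε.toSpinor := by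
    intro K
    induction K using Finset.induction_on with
    | empty => exact ⟨algebraMap R _ 1, by rw [hε.toSpinor_algebraMap, one_smul]; rfl⟩
    | insert i K hi ih =>
      obtain ⟨s, hs⟩ := ih
      refine ⟨sgn R i K • (ExteriorAlgebra.ι R (hε.basisH i) * s), ?_⟩
      rw [map_smul, hε.toSpinor_ι_mul, hε.apply_basisH, act_single_zero, one_smul, hs,
        create_single i hi]
  intro s _
  rw [← Finset.univ_sum_single s]
  refine sum_mem fun K _ => ?_
  have := Submodule.smul_mem _ (s K) (hsingle K)
  rwa [← Pi.single_smul, smul_eq_mul, mul_one] at this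

/-- The exterior algebra has a basis indexed by subsets, so the map becomes a surjective
endomorphism of a finitely generated module, and such a map is injective. -/
theorem IsAdapted.toSpinor_injective (hε : D.IsAdapted ε) :
    Function.Injective hε.toSpinor := by
  let e := hε.basisH.ExteriorAlgebra.equivFun
  have := OrzechProperty.injective_of_surjective_endomorphism (hε.toSpinor ∘ₗ e.symm.toLinearMap)
    (hε.toSpinor_surjective.comp e.symm.surjective)
  intro x y hxy
  have h := @this (e x) (e y) (by simpa using hxy)
  exact e.injective h

theorem IsAdapted.isOdd_toSpinor (hε : D.IsAdapted ε) {s : ExteriorAlgebra R D.H}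
    (hs : s ∈ D.VOdd) : IsOdd (hε.toSpinor s) := by
  induction s, hs using CliffordAlgebra.odd_induction with
  | ι v =>
    have : hε.toSpinor (ExteriorAlgebra.ι R v * algebraMap R _ 1) = act (ε v) vac := by
      rw [hε.toSpinor_ι_mul, hε.toSpinor_algebraMap, one_smul]
    rw [map_one, mul_one] at this
    change IsOdd (hε.toSpinor (ExteriorAlgebra.ι R v))
    rw [this]
    refine IsEven.act (fun K hK => ?_) _
    rw [vac, Pi.single_apply, if_neg]
    rintro rfl
    simp at hK
  | add x y hx hy ihx ihy =>
    intro K hK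
    simp [ihx K hK, ihy K hK]
  | ι_mul_ι_mul m₁ m₂ x hx ih =>
    rw [mul_assoc]
    have : hε.toSpinor (ExteriorAlgebra.ι R m₁ * (ExteriorAlgebra.ι R m₂ * x)) =
        act (ε m₁) (act (ε m₂) (hε.toSpinor x)) := by
      rw [hε.toSpinor_ι_mul, hε.toSpinor_ι_mul]
    exact this ▸ (ih.act _).act _

theorem IsAdapted.isEven_toSpinor (hε : D.IsAdapted ε) {s : ExteriorAlgebra R D.H}
    (hs : s ∈ D.VEven) : IsEven (hε.toSpinor s) := by
  induction s, hs using CliffordAlgebra.even_induction with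
  | algebraMap r =>
    intro K hK
    rw [show hε.toSpinor (algebraMap R _ r) = r • vac from hε.toSpinor_algebraMap r]
    rw [Pi.smul_apply, vac, Pi.single_apply, if_neg, smul_zero]
    rintro rfl
    simp at hK
  | add x y hx hy ihx ihy =>
    intro K hK
    simp [ihx K hK, ihy K hK]
  | ι_mul_ι_mul m₁ m₂ x hx ih =>
    rw [mul_assoc]
    have : hε.toSpinor (ExteriorAlgebra.ι R m₁ * (ExteriorAlgebra.ι R m₂ * x)) =
        act (ε m₁) (act (ε m₂) (hε.toSpinor x)) := by
      rw [hε.toSpinor_ι_mul, hε.toSpinor_ι_mul]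
    exact this ▸ (ih.act _).act _

theorem IsAdapted.exists_VOdd (hε : D.IsAdapted ε) {s : Spinor R n} (hs : IsOdd s) :
    ∃ a : D.VOdd, hε.toSpinor a = s := by
  obtain ⟨t, rfl⟩ := hε.toSpinor_surjective s
  have hc := CliffordAlgebra.evenOdd_isCompl (0 : QuadraticForm R D.H)
  obtain ⟨t₀, h₀, t₁, h₁, rfl⟩ := Submodule.mem_sup.mp
    (show t ∈ D.VEven ⊔ D.VOdd from hc.sup_eq_top ▸ Submodule.mem_top)
  refine ⟨⟨t₁, h₁⟩, ?_⟩
  have e₀ := hε.isEven_toSpinor h₀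
  have e₁ := hε.isOdd_toSpinor h₁
  ext K
  rw [map_add, Pi.add_apply]
  rcases Nat.even_or_odd K.card with hK | hK
  · have := hs K hK
    rw [map_add, Pi.add_apply] at this
    rw [this, e₁ K hK]
  · rw [e₀ K hK, zero_add]

theorem IsAdapted.algebraMapInv_eq (hε : D.IsAdapted ε) (s : ExteriorAlgebra R D.H) :
    ExteriorAlgebra.algebraMapInv s = hε.toSpinor s ∅ := by
  induction s using CliffordAlgebra.left_induction with
  | algebraMap r =>
    rw [show hε.toSpinor (algebraMap R _ r) = r • vac from hε.toSpinor_algebraMap r]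
    rw [show ExteriorAlgebra.algebraMapInv (algebraMap R (ExteriorAlgebra R D.H) r) = r from
      ExteriorAlgebra.algebraMap_leftInverse _ r]
    simp [vac]
  | add x y hx hy => simp only [map_add, hx, hy, Pi.add_apply]
  | ι_mul x m hx =>
    rw [show hε.toSpinor (CliffordAlgebra.ι 0 m * x) = _ from hε.toSpinor_ι_mul m x]
    rw [map_mul, show ExteriorAlgebra.algebraMapInv (CliffordAlgebra.ι 0 m) = (0 : R) from by
      simp [ExteriorAlgebra.algebraMapInv, ← ExteriorAlgebra.ι.eq_1], zero_mul, hε.apply_coe, act_apply]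
    simp [create_apply]

theorem ιInv_algebraMap (r : R) :
    ExteriorAlgebra.ιInv (algebraMap R (ExteriorAlgebra R D.H) r) = 0 := by
  -- `ιInv` factors through the trivial square-zero extension, which requires this opposite module
  -- structure.
  let _ : Module Rᵐᵒᵖ D.H := Module.compHom _ ((RingHom.id R).fromOpposite mul_comm)
  have : IsCentralScalar R D.H := ⟨fun r m => rfl⟩
  change TrivSqZeroExt.snd (ExteriorAlgebra.toTrivSqZeroExt (algebraMap R _ r)) = 0
  rw [AlgHom.commutes]
  rfl

theorem ιInv_ι_mul (h : D.H) (s : ExteriorAlgebra R D.H) :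
    ExteriorAlgebra.ιInv (ExteriorAlgebra.ι R h * s) = ExteriorAlgebra.algebraMapInv s • h := by
  let _ : Module Rᵐᵒᵖ D.H := Module.compHom _ ((RingHom.id R).fromOpposite mul_comm)
  have : IsCentralScalar R D.H := ⟨fun r m => rfl⟩
  have hfst : ∀ s : ExteriorAlgebra R D.H, TrivSqZeroExt.fst
      (ExteriorAlgebra.toTrivSqZeroExt (R := R) (M := D.H) s) =
        ExteriorAlgebra.algebraMapInv s := by
    intro s
    have : (TrivSqZeroExt.fstHom R R D.H).comp ExteriorAlgebra.toTrivSqZeroExt =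
        ExteriorAlgebra.algebraMapInv := by
      apply ExteriorAlgebra.hom_ext
      ext m
      simp [ExteriorAlgebra.algebraMapInv]
    exact DFunLike.congr_fun this s
  change TrivSqZeroExt.snd (ExteriorAlgebra.toTrivSqZeroExt (ExteriorAlgebra.ι R h * s)) = _
  rw [map_mul, ExteriorAlgebra.toTrivSqZeroExt_ι, TrivSqZeroExt.snd_mul, hfst]
  simp

theorem IsAdapted.ιInv_eq (hε : D.IsAdapted ε) (s : ExteriorAlgebra R D.H) (i : Fin n) :
    (ε (ExteriorAlgebra.ιInv s : D.H)).1 i = hε.toSpinor s {i} := by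
  induction s using CliffordAlgebra.left_induction with
  | algebraMap r =>
    rw [show hε.toSpinor (algebraMap R _ r) = r • vac from hε.toSpinor_algebraMap r]
    rw [show ExteriorAlgebra.ιInv (algebraMap R (ExteriorAlgebra R D.H) r) = 0 from
      ιInv_algebraMap r]
    simp [vac]
  | add x y hx hy =>
    simp only [map_add, Submodule.coe_add, Prod.fst_add, Pi.add_apply, hx, hy]
  | ι_mul x m hx =>
    rw [show hε.toSpinor (CliffordAlgebra.ι 0 m * x) = _ from hε.toSpinor_ι_mul m x]
    rw [show ExteriorAlgebra.ιInv (CliffordAlgebra.ι 0 m * x) = _ from ιInv_ι_mul m x]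
    rw [hε.apply_coe m, act_apply, hε.algebraMapInv_eq, Finset.sum_eq_single i]
    · simp [create_apply, sgn, mul_comm]
      rw [show (Finset.filter (fun x => x < i) {i} : Finset (Fin n)) = ∅ by simp]
      simp
    · intro j _ hj
      simp [create_apply, hj]
    · simp

end IsotropicDecomposition

/-! ### Existence of hyperbolic coordinates adapted to a decomposition -/

namespace IsotropicDecomposition

open Spinor

variable {R : Type u} [CommRing R] {E : Type v} [AddCommGroup E] [Module R E]
  {form : LinearMap.BilinForm R E} {n : ℕ}

/-- The decomposition given by hyperbolic coordinates. -/
def ofCoordinates (ε : E ≃ₗ[R] (Fin n → R) × (Fin n → R))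
    (h : ∀ x y, form x y = hyp (ε x) (ε y)) : IsotropicDecomposition form where
  H := LinearMap.ker (LinearMap.snd R (Fin n → R) (Fin n → R) ∘ₗ ε.toLinearMap)
  H' := LinearMap.ker (LinearMap.fst R (Fin n → R) (Fin n → R) ∘ₗ ε.toLinearMap)
  isCompl := by
    constructor
    · rw [Submodule.disjoint_def]
      intro x hx hx'
      exact ε.map_eq_zero_iff.mp (Prod.ext hx' hx)
    · rw [codisjoint_iff, eq_top_iff]
      intro x _
      refine Submodule.mem_sup.mpr ⟨ε.symm ((ε x).1, 0), by simp, ε.symm (0, (ε x).2), by simp, ?_⟩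
      rw [← map_add, LinearEquiv.symm_apply_eq]
      simp
  isotropic x hx y hy := by
    have hx : (ε x).2 = 0 := hx
    have hy : (ε y).2 = 0 := hy
    simp [h, hyp, hx, hy]
  isotropic' x hx y hy := by
    have hx : (ε x).1 = 0 := hx
    have hy : (ε y).1 = 0 := hy
    simp [h, hyp, hx, hy]

theorem isAdapted_ofCoordinates (ε : E ≃ₗ[R] (Fin n → R) × (Fin n → R))
    (h : ∀ x y, form x y = hyp (ε x) (ε y)) : (ofCoordinates ε h).IsAdapted ε :=
  ⟨h, fun _ => Iff.rfl, fun _ => Iff.rfl⟩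

/-- A basis of the first summand extends to hyperbolic coordinates. -/
theorem exists_isAdapted_of_basis (D : IsotropicDecomposition form)
    (hsymm : ∀ x y, form x y = form y x) (hbij : Function.Bijective form) {r : ℕ}
    (b : Basis (Fin r) R D.H) :
    ∃ ε : E ≃ₗ[R] (Fin r → R) × (Fin r → R), D.IsAdapted ε := by
  let π := D.H.projectionOnto D.H' D.isCompl
  have hπ : ∀ x, x - π x ∈ D.H' := fun x => by
    rw [← Submodule.projectionOnto_apply_eq_zero_iff D.isCompl, map_sub,
      Submodule.projectionOnto_apply_left, sub_self]
  -- The second component pairs with the basis of `H`. As `H` is isotropic, it sees only the `H'`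
  -- part and reads it in the dual basis.
  let f : E →ₗ[R] (Fin r → R) × (Fin r → R) :=
    (b.equivFun.toLinearMap ∘ₗ π).prod (LinearMap.pi fun i => form.flip (b i))
  have hf : ∀ x, f x = (b.equivFun (π x), fun i => form x (b i)) := fun x => rfl
  have hform : ∀ x (h : D.H), form x h = ∑ i, b.equivFun h i * form x (b i) := by
    intro x h
    conv_lhs => rw [← b.sum_equivFun h]
    rw [Submodule.coe_sum, map_sum]
    exact Finset.sum_congr rfl fun i _ => by rw [Submodule.coe_smul, map_smul, smul_eq_mul]
  have hinj : Function.Injective f := by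
    rw [← LinearMap.ker_eq_bot, LinearMap.ker_eq_bot']
    intro x hx
    rw [hf, Prod.mk_eq_zero, LinearEquiv.map_eq_zero_iff] at hx
    apply hbij.1
    rw [map_zero]
    ext y
    have hy : y = π y + (y - π y) := by abel
    have hx' : x ∈ D.H' := (Submodule.projectionOnto_apply_eq_zero_iff D.isCompl).mp hx.1
    rw [hy, map_add, D.isotropic' x hx' _ (hπ y), hform]
    simp [fun i => congrFun hx.2 i]
  have hsurj : Function.Surjective f := by
    rintro ⟨α, β⟩
    obtain ⟨x, hx⟩ := hbij.2 (b.constr R β ∘ₗ π)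
    refine ⟨(b.equivFun.symm α : D.H) + (x - π x), ?_⟩
    rw [hf, map_add, Submodule.projectionOnto_apply_left,
      (Submodule.projectionOnto_apply_eq_zero_iff D.isCompl).mpr (hπ x)]
    refine Prod.ext (by simp only [add_zero, LinearEquiv.apply_symm_apply])
      (funext fun i => ?_)
    change form _ _ = β i
    rw [map_add, map_sub, LinearMap.add_apply, LinearMap.sub_apply,
      D.isotropic _ (Subtype.mem _) _ (Subtype.mem _), D.isotropic _ (Subtype.mem _) _ (Subtype.mem _),
      hx]
    simp [π]
  have hfbij : Function.Bijective f := ⟨hinj, hsurj⟩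
  refine ⟨LinearEquiv.ofBijective f hfbij, ⟨fun x y => ?_, fun x => ?_, fun x => ?_⟩⟩
  · rw [LinearEquiv.ofBijective_apply, LinearEquiv.ofBijective_apply, hf, hf]
    have hx : form x y = form x (π y) + form y (π x) := by
      have e : form x y = form (π x + (x - π x)) (π y + (y - π y)) := by congr 2 <;> abel
      have e1 : form x (π y) = form (π x + (x - π x)) (π y) := by congr 2; abel
      have e2 : form y (π x) = form (π y + (y - π y)) (π x) := by congr 2; abel
      rw [e, e1, e2]
      simp only [map_add, LinearMap.add_apply]
      rw [D.isotropic' _ (hπ x) _ (hπ y), D.isotropic _ (π y).2 _ (π x).2,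
        hsymm (π x) (y - π y)]
      ring
    rw [hx, hform, hform y, hyp, ← Finset.sum_add_distrib]
    refine Finset.sum_congr rfl fun i _ => ?_
    simp only
    ring
  · rw [LinearEquiv.ofBijective_apply, hf]
    constructor
    · intro hx
      funext i
      exact D.isotropic x hx _ (b i).2
    · intro hx
      have : x - π x = 0 := by
        apply hinj
        rw [map_zero, hf, (Submodule.projectionOnto_apply_eq_zero_iff D.isCompl).mpr (hπ x)]
        refine Prod.ext (by simp) (funext fun i => ?_)
        change form (x - π x) (b i) = 0
        rw [map_sub, LinearMap.sub_apply, D.isotropic _ (π x).2 _ (b i).2, sub_zero]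
        exact congrFun hx i
      rw [sub_eq_zero.mp this]
      exact (π x).2
  · rw [LinearEquiv.ofBijective_apply, hf, LinearEquiv.map_eq_zero_iff]
    exact (Submodule.projectionOnto_apply_eq_zero_iff D.isCompl).symm

/-- `H` is a direct summand of a free module, hence free over the local ring. Its rank is `n`
because the total rank is twice that of `H`. -/
theorem exists_isAdapted [IsLocalRing R] (D : IsotropicDecomposition form)
    (hsymm : ∀ x y, form x y = form y x) (hbij : Function.Bijective form)
    (hbasis : HasHyperbolicBasis form n) :
    ∃ ε : E ≃ₗ[R] (Fin n → R) × (Fin n → R), D.IsAdapted ε := by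
  obtain ⟨e, -⟩ := hbasis
  have : Module.Free R E := Module.Free.of_basis e
  have : Module.Finite R E := Module.Finite.of_basis e
  have : Module.Finite R D.H := Module.Finite.of_surjective (D.H.projectionOnto D.H' D.isCompl)
    (Submodule.projectionOnto_surjective D.isCompl)
  have : Module.Projective R D.H := Module.Projective.of_split D.H.subtype
    (D.H.projectionOnto D.H' D.isCompl) (by
      ext x
      simp)
  have : Module.Free R D.H := Module.free_of_flat_of_isLocalRing
  obtain ⟨ε, hε⟩ := D.exists_isAdapted_of_basis hsymm hbij (Module.finBasis R D.H)
  have h := ε.finrank_eq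
  rw [Module.finrank_eq_card_basis e] at h
  simp only [Fintype.card_sum, Fintype.card_fin, Module.finrank_prod, Module.finrank_fin_fun] at h
  have : Module.finrank R D.H = n := by omega
  exact D.exists_isAdapted_of_basis hsymm hbij (Module.finBasisOfFinrankEq R D.H this)

end IsotropicDecomposition

/-- A hyperbolic basis gives hyperbolic coordinates. -/
theorem HasHyperbolicBasis.exists_coordinates {R : Type u} [CommRing R] {E : Type v}
    [AddCommGroup E] [Module R E] {form : LinearMap.BilinForm R E} {n : ℕ}
    (h : HasHyperbolicBasis form n) (hsymm : ∀ x y, form x y = form y x) :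
    ∃ ε : E ≃ₗ[R] (Fin n → R) × (Fin n → R), ∀ x y, form x y = Spinor.hyp (ε x) (ε y) := by
  obtain ⟨e, h1, h2, h3⟩ := h
  refine ⟨e.equivFun.trans (LinearEquiv.sumArrowLequivProdArrow (Fin n) (Fin n) R R),
    fun x y => ?_⟩
  have hx : ∀ x, x = ∑ i, e.equivFun x (.inl i) • e (.inl i) +
      ∑ i, e.equivFun x (.inr i) • e (.inr i) := by
    intro x
    conv_lhs => rw [← e.sum_equivFun x]
    rw [Fintype.sum_sum_type]
  have h3' : ∀ i j, form (e (.inr i)) (e (.inl j)) = if j = i then 1 else 0 := fun i j => by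
    rw [hsymm, h3]
  conv_lhs => rw [hx x, hx y]
  change _ = ∑ i, (e.equivFun x (.inl i) * e.equivFun y (.inr i) +
    e.equivFun x (.inr i) * e.equivFun y (.inl i))
  simp only [map_add, map_sum, LinearMap.add_apply, LinearMap.sum_apply, map_smul,
    LinearMap.smul_apply, h1, h2, h3, h3', smul_eq_mul, mul_zero, Finset.sum_const_zero, zero_add,
    add_zero, mul_ite, mul_one, Finset.sum_ite_eq, Finset.mem_univ, if_true, Finset.sum_add_distrib,
    Finset.sum_ite_eq']
  rw [add_comm]
  simp only [mul_comm]

/-! ### Exactness modulo a regular sequence -/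

section ExactMod

variable {R : Type u} [CommRing R]

theorem mem_smul_top_iff_forall_dual {M : Type*} [AddCommGroup M] [Module R M] [Module.Free R M]
    [Module.Finite R M] (c : Ideal R) (x : M) :
    x ∈ c • (⊤ : Submodule R M) ↔ ∀ l : Dual R M, l x ∈ c := by
  constructor
  · intro hx l
    have : l x ∈ Submodule.map l (c • ⊤) := Submodule.mem_map_of_mem hx
    rw [Submodule.map_smul''] at this
    exact Submodule.smul_le.mpr (fun r hr m _ => c.mul_mem_right _ hr) this
  · intro h
    let b := Module.Free.chooseBasis R M
    rw [← b.sum_repr x]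
    exact sum_mem fun i _ => Submodule.smul_mem_smul (h (b.coord i)) trivial

theorem mem_smul_top_dual_iff {M : Type*} [AddCommGroup M] [Module R M] [Module.Free R M]
    [Module.Finite R M] (c : Ideal R) (l : Dual R M) :
    l ∈ c • (⊤ : Submodule R (Dual R M)) ↔ ∀ x, l x ∈ c := by
  constructor
  · intro hl x
    exact (mem_smul_top_iff_forall_dual c l).mp hl (Dual.eval R M x)
  · intro h
    let b := Module.Free.chooseBasis R M
    rw [← b.sum_dual_apply_smul_coord l]
    exact sum_mem fun i _ => Submodule.smul_mem_smul (h _) trivial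

/-- Exactness of `M → N → K` at `N` modulo an ideal. -/
def ExactMod {M N K : Type*} [AddCommGroup M] [Module R M] [AddCommGroup N] [Module R N]
    [AddCommGroup K] [Module R K] (c : Ideal R) (f : M →ₗ[R] N) (g : N →ₗ[R] K) : Prop :=
  ∀ y, g y ∈ c • (⊤ : Submodule R K) → ∃ x, y - f x ∈ c • (⊤ : Submodule R N)

variable {M' M N K : Type*} [AddCommGroup M'] [Module R M'] [AddCommGroup M] [Module R M]
  [AddCommGroup N] [Module R N] [AddCommGroup K] [Module R K]

theorem Function.Exact.exactMod_bot {f : M →ₗ[R] N} {g : N →ₗ[R] K} (h : Function.Exact f g) :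
    ExactMod ⊥ f g := by
  intro y hy
  rw [Submodule.bot_smul, Submodule.mem_bot] at hy
  obtain ⟨x, hx⟩ := (h y).mp hy
  exact ⟨x, by rw [hx, sub_self]; exact zero_mem _⟩

/-- Each regular element costs one place. If `f y ≡ x • n` modulo `c`, regularity makes `n` a cycle
modulo `c`, say the image of `m`, and then `y - x • m` is a cycle modulo `c`. -/
theorem ExactMod.sup_span [Module.Free R K] [Module.Finite R K] {c : Ideal R} {x : R}
    (hx : ∀ g, x * g ∈ c → g ∈ c) {e : M' →ₗ[R] M} {f : M →ₗ[R] N} {g : N →ₗ[R] K}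
    (hef : ExactMod c e f) (hfg : ExactMod c f g) (hgf : ∀ y, g (f y) = 0) :
    ExactMod (Ideal.span {x} ⊔ c) e f := by
  intro y hy
  rw [Submodule.sup_smul, Submodule.ideal_span_singleton_smul] at hy ⊢
  obtain ⟨z, hz, w, hw, hzw⟩ := Submodule.mem_sup.mp hy
  obtain ⟨n, -, rfl⟩ := hz
  change x • n + w = f y at hzw
  have hgn : g n ∈ c • (⊤ : Submodule R K) := by
    rw [mem_smul_top_iff_forall_dual]
    intro l
    apply hx
    have h1 : x • g n + g w = 0 := by rw [← map_smul, ← map_add, hzw, hgf]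
    have h2 : g w ∈ c • (⊤ : Submodule R K) := by
      have : g w ∈ Submodule.map g (c • ⊤) := Submodule.mem_map_of_mem hw
      rw [Submodule.map_smul''] at this
      exact Submodule.smul_mono le_rfl le_top this
    have h3 : x * l (g n) = - l (g w) := by
      rw [eq_neg_iff_add_eq_zero, ← smul_eq_mul, ← map_smul, ← map_add, h1, map_zero]
    rw [h3]
    exact neg_mem ((mem_smul_top_iff_forall_dual c _).mp h2 l)
  obtain ⟨m, hm⟩ := hfg n hgn
  obtain ⟨m', hm'⟩ := hef (y - x • m) (by
    have e : f (y - x • m) = x • (n - f m) + w := by rw [map_sub, ← hzw, map_smul]; module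
    rw [e]
    exact add_mem (Submodule.smul_mem _ _ hm) hw)
  refine ⟨m', ?_⟩
  have e : y - e m' = x • m + (y - x • m - e m') := by abel
  rw [e]
  exact Submodule.add_mem_sup (Submodule.smul_mem_pointwise_smul m x _ trivial) hm'

theorem regular_of_regModAt_maximalIdeal [IsLocalRing R] {c : Ideal R} {x : R}
    (h : RegModAt (IsLocalRing.maximalIdeal R) c x) (g : R) (hg : x * g ∈ c) : g ∈ c := by
  obtain ⟨s, hs, hsg⟩ := h g hg
  have : IsUnit s := by simpa using hs
  exact (c.unit_mul_mem_iff_mem this).mp hsg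

end ExactMod

/-! ### Residue fields and the support of a cokernel -/

section Residue

variable {R : Type u} [CommRing R] (P : Ideal R) [P.IsPrime]

theorem exists_common_denominator {ι : Type*} [Finite ι] (c : ι → P.ResidueField) :
    ∃ s, s ∉ P ∧ ∃ r : ι → R, ∀ i, algebraMap R P.ResidueField (r i) =
      algebraMap R P.ResidueField s * c i := by
  obtain ⟨b, hb⟩ := IsLocalization.exist_integer_multiples_of_finite
    (nonZeroDivisors (R ⧸ P)) c
  obtain ⟨s, hs⟩ := Ideal.Quotient.mk_surjective (b : R ⧸ P)
  choose r hr using hb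
  choose r' hr' using fun i => Ideal.Quotient.mk_surjective (r i)
  refine ⟨s, fun h => nonZeroDivisors.ne_zero b.2 ?_, r', fun i => ?_⟩
  · rw [← hs]
    exact Ideal.Quotient.eq_zero_iff_mem.mpr h
  · rw [← Ideal.algebraMap_quotient_residueField_mk, hr', hr,
      ← Ideal.algebraMap_quotient_residueField_mk, hs, Algebra.smul_def]

/-- If `P` is in the support of the cokernel of a map of free modules, some functional that is
nonzero at `P` vanishes at `P` on its image. -/
theorem exists_dual_of_mem_support {M N : Type*} [AddCommGroup M] [Module R M] [Module.Free R M]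
    [Module.Finite R M] [AddCommGroup N] [Module R N] (f : N →ₗ[R] M)
    (hP : ⟨P, ‹_›⟩ ∈ Module.support R (M ⧸ LinearMap.range f)) :
    ∃ l : Dual R M, (∃ x, l x ∉ P) ∧ ∀ y, l (f y) ∈ P := by
  rw [Module.mem_support_iff_nontrivial_residueField_tensorProduct] at hP
  change Nontrivial (TensorProduct R P.ResidueField (M ⧸ LinearMap.range f)) at hP
  obtain ⟨t, ht⟩ := exists_ne (0 : TensorProduct R P.ResidueField (M ⧸ LinearMap.range f))
  -- The desired functional is `χ` on the fiber of the cokernel at `P`, pulled back to `M` after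
  -- clearing denominators on a basis.
  obtain ⟨χ, hχ⟩ : ∃ χ : Dual P.ResidueField (TensorProduct R P.ResidueField
      (M ⧸ LinearMap.range f)), χ t ≠ 0 := by
    by_contra! h
    exact ht ((forall_dual_apply_eq_zero_iff P.ResidueField t).mp h)
  let b := Module.Free.chooseBasis R M
  let v : M → P.ResidueField := fun x => χ (1 ⊗ₜ[R] Submodule.Quotient.mk x)
  have hv : ∀ x, v x = ∑ i, algebraMap R P.ResidueField (b.repr x i) * v (b i) := by
    intro x
    conv_lhs => rw [← b.sum_repr x]
    simp only [v]
    rw [← Submodule.mkQ_apply, map_sum, TensorProduct.tmul_sum, map_sum]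
    refine Finset.sum_congr rfl fun i _ => ?_
    rw [map_smul, TensorProduct.tmul_smul, ← algebraMap_smul P.ResidueField, map_smul, smul_eq_mul,
      Submodule.mkQ_apply]
  obtain ⟨s, hs, r, hr⟩ := exists_common_denominator P fun i => v (b i)
  let l : Dual R M := b.constr R r
  have hl : ∀ x, algebraMap R P.ResidueField (l x) = algebraMap R P.ResidueField s * v x := by
    intro x
    rw [hv, Finset.mul_sum, Basis.constr_apply_fintype, map_sum]
    refine Finset.sum_congr rfl fun i _ => ?_
    rw [smul_eq_mul, map_mul, hr, Basis.equivFun_apply]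
    ring
  have hs0 : algebraMap R P.ResidueField s ≠ 0 := fun h =>
    hs (Ideal.algebraMap_residueField_eq_zero.mp h)
  refine ⟨l, ?_, fun y => ?_⟩
  · by_contra! hcon
    apply hχ
    have h0 : ∀ x, v x = 0 := by
      intro x
      have := hl x
      rw [Ideal.algebraMap_residueField_eq_zero.mpr (hcon x)] at this
      exact (mul_eq_zero.mp this.symm).resolve_left hs0
    have hall : ∀ t, χ t = 0 := by
      intro t
      induction t using TensorProduct.induction_on with
      | zero => exact map_zero χ
      | tmul a m =>
        obtain ⟨x, rfl⟩ := Submodule.Quotient.mk_surjective _ m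
        have : a ⊗ₜ[R] (Submodule.Quotient.mk x : M ⧸ LinearMap.range f) =
          a • ((1 : P.ResidueField) ⊗ₜ[R] (Submodule.Quotient.mk x : M ⧸ LinearMap.range f)) := by
          rw [TensorProduct.smul_tmul', smul_eq_mul, mul_one]
        rw [this, map_smul]
        have := h0 x
        simp only [v] at this
        rw [this, smul_zero]
      | add x y hx hy => rw [map_add, hx, hy, add_zero]
    exact hall t
  · rw [← Ideal.algebraMap_residueField_eq_zero, hl]
    have : (Submodule.Quotient.mk (f y) : M ⧸ LinearMap.range f) = 0 :=
      (Submodule.Quotient.mk_eq_zero _).mpr ⟨y, rfl⟩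
    simp [v, this]

end Residue

/-! ### The self-dual complex modulo regular sequences -/

namespace SelfDualSequence

variable {R : Type u} [CommRing R] {B₀ B₁ B₂ : Type v}
  [AddCommGroup B₀] [Module R B₀] [AddCommGroup B₁] [Module R B₁]
  [AddCommGroup B₂] [Module R B₂] {B : SelfDualSequence R B₀ B₁ B₂}

theorem form_δ₃ (φ : Dual R B₁) (x : B₂) : B.form (B.δ₃ φ) x = φ (B.δ₂ x) := by
  have : B.formEquiv (B.δ₃ φ) = B.δ₂.dualMap φ := by simp [δ₃]
  exact LinearMap.congr_fun this x

variable [IsLocalRing R] [Module.Free R B₀] [Module.Finite R B₀] [Module.Free R B₁]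
  [Module.Finite R B₁] [Module.Free R B₂] [Module.Finite R B₂]

open IsLocalRing in
-- Every regular element removes exactness at one more place from the right, so injectivity of `δ₄`
-- survives three of them.
theorem IsAcyclic.exactMod_of_regSeqAt (hB : B.IsAcyclic) {l : List R} (hl : l.length < 4)
    (hreg : RegSeqAt (maximalIdeal R) l) :
    (l.length < 3 → ExactMod (Ideal.ofList l) B.δ₄ B.δ₃) ∧
    (l.length < 2 → ExactMod (Ideal.ofList l) B.δ₃ B.δ₂) ∧
    (l.length < 1 → ExactMod (Ideal.ofList l) B.δ₂ B.δ₁) ∧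
    ExactMod (Ideal.ofList l) (0 : Dual R B₀ →ₗ[R] Dual R B₀) B.δ₄ := by
  induction l with
  | nil =>
    rw [Ideal.ofList_nil]
    refine ⟨fun _ => hB.exact₃.exactMod_bot, fun _ => hB.exact₂.exactMod_bot,
      fun _ => hB.exact₁.exactMod_bot, Function.Exact.exactMod_bot fun y => ⟨fun h => ⟨0, ?_⟩, ?_⟩⟩
    · rw [LinearMap.zero_apply]
      exact (hB.injective (h.trans (map_zero _).symm)).symm
    · rintro ⟨x, rfl⟩
      exact map_zero _
  | cons x l ih =>
    rw [List.length_cons] at hl ⊢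
    obtain ⟨h1, h2, h3, h4⟩ := ih (by omega) hreg.2
    have hx := regular_of_regModAt_maximalIdeal hreg.1
    rw [Ideal.ofList_cons]
    refine ⟨fun h => (h1 (by omega)).sup_span hx (h2 (by omega)) fun y => ?_,
      fun h => (h2 (by omega)).sup_span hx (h3 (by omega)) fun y => ?_, fun h => by omega,
      h4.sup_span hx (h1 (by omega)) fun y => ?_⟩
    · exact hB.exact₂.apply_apply_eq_zero y
    · exact hB.exact₁.apply_apply_eq_zero y
    · exact hB.exact₃.apply_apply_eq_zero y

open IsLocalRing in
/-- An associated prime of a regular sequence of length at most three is not in the support of the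
cokernel of `δ₁`. -/
theorem IsAcyclic.notMem_support (hB : B.IsAcyclic) {l : List R} (hl : l.length < 4)
    (hreg : RegSeqAt (maximalIdeal R) l) {Q : Ideal R} (hQ : Q.IsPrime) {g : R}
    (hg : ∀ y ∈ Q, y * g ∈ Ideal.ofList l) (hg' : ∀ s, s * g ∈ Ideal.ofList l → s ∈ Q) :
    ⟨Q, hQ⟩ ∉ Module.support R (B₀ ⧸ LinearMap.range B.δ₁) := by
  intro hmem
  obtain ⟨ψ, ⟨x, hx⟩, hψ⟩ := exists_dual_of_mem_support Q B.δ₁ hmem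
  obtain ⟨-, -, -, h⟩ := hB.exactMod_of_regSeqAt hl hreg
  -- `ψ` maps the image of `δ₁` into `Q`, and `g` carries `Q` into the ideal of `l`, so `δ₄ (g • ψ)`
  -- is zero modulo `l`. Injectivity modulo `l` then forces every value of `ψ` into `Q`.
  obtain ⟨y, hz⟩ := h (g • ψ) (by
    rw [mem_smul_top_dual_iff]
    intro y
    have : B.δ₄ (g • ψ) y = ψ (B.δ₁ y) * g := by
      rw [map_smul, LinearMap.smul_apply, smul_eq_mul, mul_comm]
      rfl
    rw [this]
    exact hg _ (hψ y))
  rw [LinearMap.zero_apply, sub_zero, mem_smul_top_dual_iff] at hz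
  have := hz x
  rw [LinearMap.smul_apply, smul_eq_mul, mul_comm] at this
  exact hx (hg' _ this)

end SelfDualSequence

/-! ### Spinors annihilated by a Lagrangian -/

namespace Spinor

variable {R : Type u} [CommRing R] {n : ℕ} {L : Submodule R ((Fin n → R) × (Fin n → R))}
  {s : Spinor R n}

theorem hyp_eq_act (l : Dual R (Spinor R n)) (s : Spinor R n) (x : (Fin n → R) × (Fin n → R)) :
    hyp (fun i => l (annih i s), fun i => l (create i s)) x = l (act x s) := by
  rw [act_eq, LinearMap.sum_apply, map_sum, hyp]
  refine Finset.sum_congr rfl fun i _ => ?_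
  simp only [LinearMap.add_apply, LinearMap.smul_apply, map_add, map_smul, smul_eq_mul]
  ring

/-- A functional on spinors and a spinor annihilated by a Lagrangian produce an element of the
Lagrangian. -/
theorem mem_of_annihilated (hL : ∀ y, (∀ x ∈ L, hyp y x = 0) → y ∈ L)
    (hs : ∀ x ∈ L, act x s = 0) (l : Dual R (Spinor R n)) :
    ((fun i => l (annih i s), fun i => l (create i s)) : (Fin n → R) × (Fin n → R)) ∈ L :=
  hL _ fun x hx => by rw [hyp_eq_act, hs x hx, map_zero]

theorem annih_empty (i : Fin n) (s : Spinor R n) : annih i s ∅ = s {i} := by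
  simp [annih_apply, sgn]

theorem create_empty (i : Fin n) (s : Spinor R n) : create i s ∅ = 0 := by
  simp [create_apply]

theorem act_zero_empty (y : Fin n → R) (s : Spinor R n) :
    act (0, y) s ∅ = ∑ i, y i * s {i} := by
  rw [act_apply]
  exact Finset.sum_congr rfl fun i _ => by simp [annih_empty]

theorem act_empty (x : (Fin n → R) × (Fin n → R)) (s : Spinor R n) :
    act x s ∅ = ∑ i, x.2 i * s {i} := by
  rw [act_apply]
  exact Finset.sum_congr rfl fun i _ => by simp [annih_empty, create_empty]

/-- For the functional taking `t` to the scalar part of `(0, h)` acting on `annih j t`, the vector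
from `mem_of_annihilated` has second component `- s {j} • h`, because the remaining term is the
vanishing sum. This is why `s {j}` kills the homology at `H*`. -/
theorem exists_mem_of_sum_eq_zero (hL : ∀ y, (∀ x ∈ L, hyp y x = 0) → y ∈ L)
    (hs : ∀ x ∈ L, act x s = 0) {h : Fin n → R} (hh : ∑ i, h i * s {i} = 0) (j : Fin n) :
    ∃ y : Fin n → R, (y, s {j} • h) ∈ L := by
  let l : Dual R (Spinor R n) := LinearMap.proj ∅ ∘ₗ act (0, h) ∘ₗ annih j
  have hl : ∀ t, l t = act (0, h) (annih j t) ∅ := fun t => rfl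
  refine ⟨fun i => - l (annih i s), ?_⟩
  convert neg_mem (mem_of_annihilated hL hs l) using 1
  refine Prod.ext rfl (funext fun k => ?_)
  have e1 : annih j (create k s) = (Pi.single k (1 : R) : Fin n → R) j • s -
      create k (annih j s) := by
    have := annih_act j (Pi.single k (1 : R), 0) s
    rwa [act_single_zero, one_smul] at this
  have e2 : act (0, h) (create k (annih j s)) ∅ = h k * s {j} := by
    have := create_act k (0, h) (annih j s)
    have h3 := congrFun this ∅
    rw [create_empty] at h3
    simp only [Pi.sub_apply, Pi.smul_apply, smul_eq_mul, annih_empty] at h3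
    exact (sub_eq_zero.mp h3.symm).symm
  change s {j} * h k = - l (create k s)
  rw [hl, e1, map_sub, Pi.sub_apply, e2, map_smul, Pi.smul_apply, act_zero_empty, hh]
  simp [mul_comm]

/-- Two contractions of the relation `act (z, 0) s = 0`, read in degree zero. Vectors of `L` inside
the first summand are thus proportional to the degree one part of `s`, so `s {j}` kills the homology
at `B₁*`. -/
theorem mul_eq_mul_of_mem (hs : ∀ x ∈ L, act x s = 0) {z : Fin n → R} (hz : (z, 0) ∈ L)
    (i j : Fin n) : s {j} * z i = z j * s {i} := by
  have h1 : annih i (annih j (act (z, 0) s)) ∅ = 0 := by rw [hs _ hz]; simp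
  rw [annih_act, map_sub, map_smul, annih_act] at h1
  simp only [Pi.sub_apply, Pi.smul_apply, annih_empty, smul_eq_mul, act_empty] at h1
  simp only [Pi.zero_apply, zero_mul, Finset.sum_const_zero, sub_zero] at h1
  linear_combination -h1

/-- If the degree one coordinates of one spinor annihilated by a Lagrangian do not all lie in a
prime, then a spinor whose degree one coordinates lie in the prime vanishes at the prime. -/
theorem mem_of_singleton_mem (hL : ∀ y, (∀ x ∈ L, hyp y x = 0) → y ∈ L)
    (hs : ∀ x ∈ L, act x s = 0) {Q : Ideal R} [Q.IsPrime] {j : Fin n} (hj : s {j} ∉ Q)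
    {t : Spinor R n} (ht : ∀ x ∈ L, act x t = 0) (hodd : IsOdd t) (h1 : ∀ i, t {i} ∈ Q)
    (K : Finset (Fin n)) : t K ∈ Q := by
  induction hN : K.card using Nat.strong_induction_on generalizing K with
  | _ N ih =>
  subst hN
  rcases Nat.even_or_odd K.card with hK | hK
  · rw [hodd K hK]
    exact zero_mem _
  by_cases hK1 : K.card = 1
  · obtain ⟨i, rfl⟩ := Finset.card_eq_one.mp hK1
    exact h1 i
  have key : ∀ k, ∀ K' : Finset (Fin n), K'.card < K.card →
      s {j} * annih k t K' - s {k} * annih j t K' ∈ Q := by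
    intro k K' hK'
    -- This `h` is orthogonal to the degree one part of `s`, so `s {j} • h` completes to a vector of
    -- `L`, which kills `t`. The other component `y` of that vector only involves coordinates of `t`
    -- of degree below that of `K`, which lie in `Q` by induction.
    let h : Fin n → R := Pi.single k (s {j}) - Pi.single j (s {k})
    obtain ⟨y, hy⟩ := exists_mem_of_sum_eq_zero hL hs (h := h) (by
      simp [h, sub_mul, Finset.sum_sub_distrib, Pi.single_apply, mul_comm]) j
    have hact : act ((0 : Fin n → R), h) t = s {j} • annih k t - s {k} • annih j t := by
      have : ((0 : Fin n → R), h) = (0, Pi.single k (s {j})) - (0, Pi.single j (s {k})) := by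
        rw [Prod.mk_sub_mk, sub_zero]
      rw [this, map_sub, LinearMap.sub_apply, act_zero_single, act_zero_single]
      rfl
    have e : (y, s {j} • h) = (y, 0) + s {j} • ((0 : Fin n → R), h) := by
      ext <;> simp
    have h2 := congrFun (ht _ hy) K'
    rw [e, map_add, map_smul, LinearMap.add_apply, LinearMap.smul_apply, hact] at h2
    simp only [Pi.add_apply, Pi.smul_apply, Pi.sub_apply, smul_eq_mul, Pi.zero_apply] at h2
    refine (Ideal.IsPrime.mem_or_mem ‹_› (?_ : s {j} * _ ∈ Q)).resolve_left hj
    rw [← neg_eq_of_add_eq_zero_right h2, act_apply]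
    refine neg_mem (sum_mem fun i _ => ?_)
    simp only [Pi.zero_apply, zero_mul, add_zero]
    refine Ideal.mul_mem_left _ _ ?_
    rw [create_apply]
    split_ifs with hi
    · refine Ideal.mul_mem_left _ _ (ih _ ?_ _ rfl)
      exact (Finset.card_erase_lt_of_mem hi).trans hK'
    · exact zero_mem _
  have hcard : 1 < K.card := by
    obtain ⟨m, hm⟩ := hK
    omega
  have step : ∀ K' : Finset (Fin n), K'.card = K.card → ∀ k ∈ K',
      s {k} * annih j t (K'.erase k) ∈ Q → t K' ∈ Q := by
    intro K' hK' k hk hmem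
    have h3 := add_mem (key k (K'.erase k) (hK' ▸ Finset.card_erase_lt_of_mem hk)) hmem
    rw [sub_add_cancel] at h3
    have h4 := (Ideal.IsPrime.mem_or_mem ‹_› h3).resolve_left hj
    rw [annih_apply, if_neg (Finset.notMem_erase _ _), Finset.insert_erase hk] at h4
    have h5 := Q.mul_mem_left (sgn R k (K'.erase k)) h4
    rwa [← mul_assoc, sgn_mul_self, one_mul] at h5
  -- With `k ≠ j` in `K'`, the contraction by `j` vanishes at `K'` without `k`, because `j` is still
  -- present.
  have mem_case : ∀ K' : Finset (Fin n), K'.card = K.card → j ∈ K' → t K' ∈ Q := by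
    intro K' hK' hjK
    obtain ⟨k, hk, hkj⟩ := Finset.exists_mem_ne (hK' ▸ hcard) j
    refine step K' hK' k hk ?_
    rw [annih_apply, if_pos (Finset.mem_erase.mpr ⟨hkj.symm, hjK⟩), mul_zero]
    exact zero_mem _
  by_cases hjK : j ∈ K
  · exact mem_case K rfl hjK
  -- If `j` is missing, replacing `k` by `j` leads to a set of the same size that contains `j`.
  obtain ⟨k, hk⟩ := Finset.card_pos.mp (zero_lt_one.trans hcard)
  refine step K rfl k hk (Ideal.mul_mem_left _ _ ?_)
  have hj' : j ∉ K.erase k := fun h => hjK (Finset.mem_of_mem_erase h)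
  rw [annih_apply, if_neg hj']
  refine Ideal.mul_mem_left _ _ (mem_case _ ?_ (Finset.mem_insert_self _ _))
  rw [Finset.card_insert_of_notMem hj', Finset.card_erase_add_one hk]

end Spinor

/-! ### Spinor coordinates of the complex and generic decompositions -/

namespace SelfDualSequence

open Spinor IsLocalRing

variable {R : Type u} [CommRing R] {B₀ B₁ B₂ : Type v}
  [AddCommGroup B₀] [Module R B₀] [AddCommGroup B₁] [Module R B₁]
  [AddCommGroup B₂] [Module R B₂] {B : SelfDualSequence R B₀ B₁ B₂} {n : ℕ}
  {D : IsotropicDecomposition B.form} {ε : B₂ ≃ₗ[R] (Fin n → R) × (Fin n → R)}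

/-- An odd spinor is the combination, with its own coordinates, of odd lifts of basis vectors.
Testing nonvanishing on functionals and on coordinates therefore agree. -/
theorem isSpinorCoordinates_iff (hε : D.IsAdapted ε) (a : D.VOdd) :
    B.IsSpinorCoordinates D a ↔ IsSpinorOf B.form (LinearMap.range B.δ₃)
      (Module.support R (B₀ ⧸ LinearMap.range B.δ₁))ᶜ ε (hε.toSpinor a) := by
  constructor
  · rintro ⟨h1, h2⟩
    refine ⟨hε.isometry, hε.isOdd_toSpinor a.2, ?_, fun P hP => ?_⟩
    · rintro _ ⟨φ, rfl⟩
      have := congrArg (fun x : D.VEven => (x : ExteriorAlgebra R D.H)) (h1 φ)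
      have h3 : D.cliffordAction (B.δ₃ φ) a = 0 := this
      rw [← hε.toSpinor_cliffordAction, h3, map_zero]
    · obtain ⟨l, hl⟩ := h2 P hP
      by_contra! hcon
      apply hl
      have hex : ∀ K : Finset (Fin n), ∃ t : D.VOdd, hε.toSpinor t =
          if Odd K.card then Pi.single K (1 : R) else 0 := fun K => by
        refine hε.exists_VOdd fun K' hK' => ?_
        split_ifs with hK
        · rw [Pi.single_apply, if_neg]
          rintro rfl
          exact (Nat.not_odd_iff_even.mpr hK') hK
        · rfl
      choose t ht using hex
      have e : a = ∑ K, hε.toSpinor a K • t K := by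
        apply Subtype.ext
        apply hε.toSpinor_injective
        rw [Submodule.coe_sum, map_sum]
        funext K
        rw [Finset.sum_apply, Finset.sum_eq_single K]
        · rw [Submodule.coe_smul, map_smul, ht]
          by_cases hK : Odd K.card
          · simp [hK]
          · rw [hε.isOdd_toSpinor a.2 K (Nat.not_odd_iff_even.mp hK)]
            simp
        · intro K' _ hne
          rw [Submodule.coe_smul, map_smul, ht]
          split_ifs
          · simp [hne.symm]
          · simp
        · simp
      rw [e, map_sum]
      refine sum_mem fun K _ => ?_
      rw [map_smul]
      exact P.asIdeal.mul_mem_right _ (hcon K)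
  · rintro ⟨-, -, h1, h2⟩
    refine ⟨fun φ => ?_, fun P hP => ?_⟩
    · apply Subtype.ext
      apply hε.toSpinor_injective
      change hε.toSpinor (D.cliffordAction (B.δ₃ φ) a) = hε.toSpinor 0
      rw [hε.toSpinor_cliffordAction, h1 _ ⟨φ, rfl⟩, map_zero]
    · obtain ⟨K, hK⟩ := h2 P hP
      exact ⟨LinearMap.proj K ∘ₗ hε.toSpinor ∘ₗ D.VOdd.subtype, hK⟩

variable [Module.Free R B₁]

/-- By duality, orthogonality to the image of `δ₃` means that every functional vanishes on `δ₂ y`;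
exactness then applies. -/
theorem IsAcyclic.mem_range_δ₃ (hB : B.IsAcyclic) {y : B₂}
    (hy : ∀ x ∈ LinearMap.range B.δ₃, B.form y x = 0) : y ∈ LinearMap.range B.δ₃ := by
  refine (hB.exact₂ y).mp ((forall_dual_apply_eq_zero_iff R _).mp fun φ => ?_)
  rw [← form_δ₃, B.form_symm]
  exact hy _ ⟨φ, rfl⟩

theorem IsAcyclic.mem_map_range_δ₃ (hB : B.IsAcyclic)
    (hiso : ∀ x y, B.form x y = hyp (ε x) (ε y)) (y : (Fin n → R) × (Fin n → R))
    (hy : ∀ x ∈ (LinearMap.range B.δ₃).map ε.toLinearMap, hyp y x = 0) :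
    y ∈ (LinearMap.range B.δ₃).map ε.toLinearMap := by
  refine ⟨ε.symm y, hB.mem_range_δ₃ fun x hx => ?_, by simp⟩
  rw [hiso, LinearEquiv.apply_symm_apply]
  exact hy _ ⟨x, hx, rfl⟩

variable [IsNoetherianRing R] [IsLocalRing R] [Infinite (ResidueField R)]
  [Module.Free R B₀] [Module.Finite R B₀] [Module.Finite R B₁]

/-- If spinor coordinates exist, there is a decomposition such that the degree one part of any
spinor coordinates with respect to it generates an ideal of grade at least three. -/
theorem HasSpinorCoordinates.exists_generic (hB : B.IsAcyclic) (hB₂ : HasHyperbolicBasis B.form n)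
    (h : B.HasSpinorCoordinates) :
    ∃ (D : IsotropicDecomposition B.form) (ε : B₂ ≃ₗ[R] (Fin n → R) × (Fin n → R))
      (hε : D.IsAdapted ε), (∃ a : D.VOdd, B.IsSpinorCoordinates D a) ∧
      ∀ a : D.VOdd, B.IsSpinorCoordinates D a → GradeGEAt (maximalIdeal R)
        (Ideal.span (Set.range fun i => hε.toSpinor a {i})) 3 := by
  obtain ⟨D₀, a₀, ha₀⟩ := h
  obtain ⟨ε₀, hε₀⟩ := D₀.exists_isAdapted B.form_symm B.form_bijective hB₂
  have : Module.Free R B₂ := Module.Free.of_equiv ε₀.symm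
  have : Module.Finite R B₂ := Module.Finite.equiv ε₀.symm
  rw [isSpinorCoordinates_iff hε₀] at ha₀
  -- The induction starts with all odd degrees. A prime associated to a sequence shorter than three
  -- lies outside the support, where some coordinate of `a₀` is a unit.
  obtain ⟨ε, s, hs, hgrade⟩ := ha₀.exists_generic _ (Finset.univ.filter fun K => Odd K.card) rfl
    (by simp) (by simp +contextual) (by
      refine gradeGEAt_of_forall _ _ _ fun l hl _ hreg Q hQ _ g hg hg' hle => ?_
      obtain ⟨K, hK⟩ := ha₀.nonvanishing ⟨Q, hQ⟩ (hB.notMem_support (by omega) hreg hQ hg hg')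
      rcases Nat.even_or_odd K.card with hodd | hodd
      · rw [ha₀.isOdd K hodd] at hK
        exact hK (zero_mem _)
      · exact hK (hle (Ideal.subset_span ⟨K, by simpa using hodd, rfl⟩)))
  let D := IsotropicDecomposition.ofCoordinates ε hs.isometry
  have hε : D.IsAdapted ε := IsotropicDecomposition.isAdapted_ofCoordinates ε hs.isometry
  obtain ⟨a, ha⟩ := hε.exists_VOdd hs.isOdd
  refine ⟨D, ε, hε, ⟨a, ?_⟩, fun a' ha' => ?_⟩
  · rwa [isSpinorCoordinates_iff hε, ha]
  rw [isSpinorCoordinates_iff hε] at ha'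
  refine gradeGEAt_of_forall _ _ _ fun l hl hlF hreg Q hQ hQm g hg hg' hle => ?_
  have hlQ : ∀ x ∈ l, x ∈ Q := fun x hx => hg' x
    (Ideal.mul_mem_right _ _ (Ideal.subset_span hx))
  have hnot := not_le_of_gradeGEAt hQm hgrade hreg hlQ hl ⟨g, fun y hy =>
    ⟨1, (Ideal.ne_top_iff_one _).mp hQ.ne_top, by rw [one_mul]; exact hg y hy⟩, hg'⟩
  -- The grade is known for `s` only. At `Q` some `s {j}` survives, so if the degree one part of
  -- `a'` lay in `Q`, all of `a'` would vanish there, although `Q` lies outside the support.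
  obtain ⟨j, hj⟩ : ∃ j, s {j} ∉ Q := by
    by_contra! hcon
    apply hnot
    rw [Ideal.span_le]
    rintro _ ⟨i, rfl⟩
    exact hcon i
  obtain ⟨K, hK⟩ := ha'.nonvanishing ⟨Q, hQ⟩ (hB.notMem_support (by omega) hreg hQ hg hg')
  refine hK (mem_of_singleton_mem (hB.mem_map_range_δ₃ hs.isometry) ?_ hj ?_ ha'.isOdd
    (fun i => hle (Ideal.subset_span ⟨i, rfl⟩)) K)
  · rintro _ ⟨x, hx, rfl⟩
    exact hs.annihilated x hx
  · rintro _ ⟨x, hx, rfl⟩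
    exact ha'.annihilated x hx

end SelfDualSequence

/-! ### A complex of length three whose homology is annihilated by an ideal of grade three -/

section Acyclicity

variable {R : Type u} [CommRing R]

theorem mem_smul_top_of_smul_mem {M : Type*} [AddCommGroup M] [Module R M] [Module.Free R M]
    [Module.Finite R M] {c : Ideal R} {x : R} (hx : ∀ g, x * g ∈ c → g ∈ c) {m : M}
    (hm : x • m ∈ c • (⊤ : Submodule R M)) : m ∈ c • (⊤ : Submodule R M) := by
  rw [mem_smul_top_iff_forall_dual] at hm ⊢
  intro l
  have := hm l
  rw [map_smul] at this
  exact hx _ this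

/-- The elements `x₁, x₂, x₃` form a regular sequence up to the condition on the quotient. -/
structure IsWeaklyRegularTriple (x₁ x₂ x₃ : R) : Prop where
  fst : ∀ g, x₁ * g = 0 → g = 0
  snd : ∀ g, x₂ * g ∈ Ideal.span {x₁} → g ∈ Ideal.span {x₁}
  thd : ∀ g, x₃ * g ∈ Ideal.span {x₂} ⊔ Ideal.span {x₁} → g ∈ Ideal.span {x₂} ⊔ Ideal.span {x₁}

theorem GradeGEAt.exists_isWeaklyRegularTriple [IsLocalRing R] {I : Ideal R}
    (h : GradeGEAt (IsLocalRing.maximalIdeal R) I 3) :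
    ∃ x₁ ∈ I, ∃ x₂ ∈ I, ∃ x₃ ∈ I, IsWeaklyRegularTriple x₁ x₂ x₃ := by
  obtain ⟨l, hl, hlI, hreg⟩ := h
  match l, hl with
  | [x₃, x₂, x₁], _ =>
    obtain ⟨h3, h2, h1, -⟩ := hreg
    have h3 := regular_of_regModAt_maximalIdeal h3
    have h2 := regular_of_regModAt_maximalIdeal h2
    have h1 := regular_of_regModAt_maximalIdeal h1
    simp only [Ideal.ofList_cons, Ideal.ofList_nil, sup_bot_eq, Ideal.mem_bot] at h1 h2 h3
    exact ⟨x₁, hlI _ (by simp), x₂, hlI _ (by simp), x₃, hlI _ (by simp), h1, h2, h3⟩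

namespace IsWeaklyRegularTriple

variable {x₁ x₂ x₃ : R} {M : Type*} [AddCommGroup M]
  [Module R M] [Module.Free R M] [Module.Finite R M]

theorem smul_fst_injective (hx : IsWeaklyRegularTriple x₁ x₂ x₃) {m m' : M} (h : x₁ • m = x₁ • m') : m = m' := by
  have := mem_smul_top_of_smul_mem (c := ⊥) (x := x₁) (by simpa using hx.fst) (m := m - m')
    (by rw [smul_sub, h, sub_self]; exact zero_mem _)
  rw [Submodule.bot_smul, Submodule.mem_bot] at this
  exact sub_eq_zero.mp this

theorem exists_eq_smul_fst (hx : IsWeaklyRegularTriple x₁ x₂ x₃) {m m' : M}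
    (h : x₂ • m = x₁ • m') : ∃ v, m = x₁ • v := by
  have := mem_smul_top_of_smul_mem hx.snd (m := m) (by
    rw [h]
    exact Submodule.smul_mem_smul (Ideal.mem_span_singleton_self _) trivial)
  rw [Submodule.ideal_span_singleton_smul] at this
  obtain ⟨v, -, hv⟩ := this
  exact ⟨v, hv.symm⟩

theorem exists_eq_smul_add_smul (hx : IsWeaklyRegularTriple x₁ x₂ x₃) {m p q : M}
    (h : x₃ • m = x₂ • p + x₁ • q) :
    ∃ p' q', m = x₂ • p' + x₁ • q' := by
  have := mem_smul_top_of_smul_mem hx.thd (m := m) (by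
    rw [h]
    exact add_mem
      (Submodule.smul_mem_smul (Ideal.mem_sup_left (Ideal.mem_span_singleton_self _)) trivial)
      (Submodule.smul_mem_smul (Ideal.mem_sup_right (Ideal.mem_span_singleton_self _)) trivial))
  rw [Submodule.sup_smul, Submodule.ideal_span_singleton_smul,
    Submodule.ideal_span_singleton_smul] at this
  obtain ⟨_, ⟨p', -, rfl⟩, _, ⟨q', -, rfl⟩, h⟩ := Submodule.mem_sup.mp this
  exact ⟨p', q', h.symm⟩

end IsWeaklyRegularTriple

variable {F₃ F₂ F₁ : Type*} [AddCommGroup F₃] [Module R F₃] [Module.Free R F₃]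
  [Module.Finite R F₃] [AddCommGroup F₂] [Module R F₂] [Module.Free R F₂]
  [Module.Finite R F₂] [AddCommGroup F₁] [Module R F₁] {d₃ : F₃ →ₗ[R] F₂} {d₂ : F₂ →ₗ[R] F₁} {I : Ideal R} {x₁ x₂ x₃ : R}

/-- With `x₁ • z = d₃ u₁` and `x₂ • z = d₃ u₂`, injectivity gives `x₂ • u₁ = x₁ • u₂`. Hence `u₁ =
x₁ • v`, and cancelling `x₁` yields `z = d₃ v`. -/
theorem exact_of_smul_mem_range (hx : IsWeaklyRegularTriple x₁ x₂ x₃) (h₁ : x₁ ∈ I) (h₂ : x₂ ∈ I)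
    (hinj : Function.Injective d₃) (hcomp : ∀ y, d₂ (d₃ y) = 0)
    (hk : ∀ z, d₂ z = 0 → ∀ x ∈ I, x • z ∈ LinearMap.range d₃) : Function.Exact d₃ d₂ := by
  refine fun z => ⟨fun hz => ?_, ?_⟩
  · obtain ⟨u₁, hu₁⟩ := hk z hz x₁ h₁
    obtain ⟨u₂, hu₂⟩ := hk z hz x₂ h₂
    obtain ⟨v, rfl⟩ := hx.exists_eq_smul_fst (m := u₁) (m' := u₂) (hinj (by
      rw [map_smul, map_smul, hu₁, hu₂, smul_comm]))
    rw [map_smul] at hu₁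
    exact ⟨v, hx.smul_fst_injective hu₁⟩
  · rintro ⟨y, rfl⟩
    exact hcomp y

/-- A Koszul chase. The relations among the lifts `uᵢ` of `xᵢ • z` come from elements `vᵢⱼ`, which
satisfy one relation of their own. Regularity of `x₃` splits `v₁₂`; correcting `u₁` accordingly
makes it divisible by `x₁`. -/
theorem exact_of_exact_of_smul_mem_range [Module.Free R F₁] [Module.Finite R F₁]
    {F₀ : Type*} [AddCommGroup F₀] [Module R F₀]
    {d₁ : F₁ →ₗ[R] F₀} (hx : IsWeaklyRegularTriple x₁ x₂ x₃)
    (h₁ : x₁ ∈ I) (h₂ : x₂ ∈ I) (h₃ : x₃ ∈ I) (hinj : Function.Injective d₃)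
    (hexact : Function.Exact d₃ d₂) (hcomp : ∀ y, d₁ (d₂ y) = 0)
    (hk : ∀ z, d₁ z = 0 → ∀ x ∈ I, x • z ∈ LinearMap.range d₂) : Function.Exact d₂ d₁ := by
  refine fun z => ⟨fun hz => ?_, ?_⟩
  · obtain ⟨u₁, hu₁⟩ := hk z hz x₁ h₁
    obtain ⟨u₂, hu₂⟩ := hk z hz x₂ h₂
    obtain ⟨u₃, hu₃⟩ := hk z hz x₃ h₃
    have key : ∀ {x y : R} {u v : F₂}, d₂ u = x • z → d₂ v = y • z →
        ∃ t, d₃ t = x • v - y • u := fun hu hv =>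
      (hexact _).mp (by rw [map_sub, map_smul, map_smul, hu, hv, smul_comm, sub_self])
    obtain ⟨v₁₂, h₁₂⟩ := key hu₁ hu₂
    obtain ⟨v₁₃, h₁₃⟩ := key hu₁ hu₃
    obtain ⟨v₂₃, h₂₃⟩ := key hu₂ hu₃
    obtain ⟨p, q, rfl⟩ := hx.exists_eq_smul_add_smul (m := v₁₂) (p := v₁₃) (q := - v₂₃) (hinj (by
      rw [map_add, map_smul, map_smul, map_smul, map_neg, h₁₂, h₁₃, h₂₃]
      module))
    obtain ⟨t, ht⟩ := hx.exists_eq_smul_fst (m := u₁ + d₃ p) (m' := u₂ - d₃ q) (by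
      rw [map_add, map_smul, map_smul] at h₁₂
      rw [smul_add, smul_sub, ← sub_eq_zero]
      rw [← sub_eq_zero] at h₁₂
      rw [← h₁₂]
      module)
    refine ⟨t, hx.smul_fst_injective ?_⟩
    rw [← map_smul, ← ht, map_add, hexact.apply_apply_eq_zero, add_zero, hu₁]
  · rintro ⟨y, rfl⟩
    exact hcomp y

end Acyclicity

/-! ### Lifts of the spinor map and acyclicity of the constructed complex -/

namespace SelfDualSequence

open Spinor IsLocalRing

variable {R : Type u} [CommRing R] {B₀ B₁ B₂ : Type v}
  [AddCommGroup B₀] [Module R B₀] [AddCommGroup B₁] [Module R B₁]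
  [AddCommGroup B₂] [Module R B₂] {B : SelfDualSequence R B₀ B₁ B₂} {n : ℕ}
  {D : IsotropicDecomposition B.form} {ε : B₂ ≃ₗ[R] (Fin n → R) × (Fin n → R)}

theorem d₁_eq (hε : D.IsAdapted ε) (a : D.VOdd) (d : Dual R D.H) :
    D.d₁ a d = ∑ i, d (hε.basisH i) * hε.toSpinor a {i} := by
  change d (ExteriorAlgebra.ιInv (a : ExteriorAlgebra R D.H)) = _
  rw [hε.dual_apply]
  exact Finset.sum_congr rfl fun i _ => by rw [hε.ιInv_eq]

theorem idealOf_eq (hε : D.IsAdapted ε) (a : D.VOdd) :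
    D.idealOf a = Ideal.span (Set.range fun i => hε.toSpinor a {i}) := by
  apply le_antisymm
  · rintro _ ⟨d, rfl⟩
    rw [d₁_eq hε]
    exact sum_mem fun i _ => Ideal.mul_mem_left _ _ (Ideal.subset_span ⟨i, rfl⟩)
  · rw [Ideal.span_le]
    rintro _ ⟨i, rfl⟩
    refine ⟨hε.basisH.coord i, ?_⟩
    rw [d₁_eq hε, Finset.sum_eq_single i]
    · simp
    · intro j _ hj
      simp [hj]
    · simp

variable {a : D.VOdd} {w : Dual R D.VEven →ₗ[R] Dual R B₁}

theorem d₂_apply (φ : Dual R B₁) (h : D.H) : B.d₂ D φ h = B.form (B.δ₃ φ) h := by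
  rw [form_δ₃]
  rfl

theorem d₂_eq_zero_iff (hε : D.IsAdapted ε) (φ : Dual R B₁) :
    B.d₂ D φ = 0 ↔ (ε (B.δ₃ φ)).2 = 0 := by
  constructor
  · intro h
    funext i
    have := LinearMap.congr_fun h (hε.basisH i)
    rw [d₂_apply, hε.isometry, hε.apply_basisH, hyp_comm, hyp_single_zero, one_mul] at this
    exact this
  · intro h
    ext x
    rw [d₂_apply, hε.isometry, hε.apply_coe, hyp, h]
    simp

/-- The distinguished column of the lift maps to the degree one part of the spinor coordinates. -/
theorem IsSpinorLift.δ₃_dualOneEven (hε : D.IsAdapted ε) (hw : B.IsSpinorLift D a w) :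
    B.δ₃ (w D.dualOneEven) = (ExteriorAlgebra.ιInv (a : ExteriorAlgebra R D.H) : D.H) := by
  have h1 : B.δ₃ (w D.dualOneEven) = B.formEquiv.symm ((D.actOn a).dualMap D.dualOneEven) :=
    LinearMap.congr_fun hw D.dualOneEven
  rw [h1, LinearEquiv.symm_apply_eq]
  ext x
  change ExteriorAlgebra.algebraMapInv (D.cliffordAction x a) = B.form _ x
  rw [hε.algebraMapInv_eq, hε.toSpinor_cliffordAction, act_empty, hε.isometry, hε.apply_coe, hyp]
  refine Finset.sum_congr rfl fun i _ => ?_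
  rw [hε.ιInv_eq]
  simp [mul_comm]

theorem annihilated_map (hε : D.IsAdapted ε) (ha : B.IsSpinorCoordinates D a)
    (x : (Fin n → R) × (Fin n → R)) (hx : x ∈ (LinearMap.range B.δ₃).map ε.toLinearMap) :
    act x (hε.toSpinor a) = 0 := by
  obtain ⟨x, hx, rfl⟩ := hx
  exact ((isSpinorCoordinates_iff hε a).mp ha).annihilated x hx

variable [Module.Free R B₁]

/-- The dual of the even half-spinors is projective. The map to be lifted lands in the image of
`δ₃`, because its values are orthogonal to that image, which is its own orthogonal. -/
theorem exists_isSpinorLift (hε : D.IsAdapted ε) (hB : B.IsAcyclic)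
    (ha : B.IsSpinorCoordinates D a) :
    ∃ w : Dual R D.VEven →ₗ[R] Dual R B₁, B.IsSpinorLift D a w := by
  have hfree : Module.Free R (Dual R (ExteriorAlgebra R D.H)) :=
    Module.Free.of_equiv (LinearEquiv.ofBijective hε.toSpinor
      ⟨hε.toSpinor_injective, hε.toSpinor_surjective⟩).dualMap
  have hc := CliffordAlgebra.evenOdd_isCompl (0 : QuadraticForm R D.H)
  have hproj : Module.Projective R (Dual R D.VEven) :=
    Module.Projective.of_split (M := Dual R (ExteriorAlgebra R D.H))
      (D.VEven.projectionOnto D.VOdd hc).dualMap D.VEven.subtype.dualMap (by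
        ext l x
        change l (D.VEven.projectionOnto D.VOdd hc x) = l x
        rw [Submodule.projectionOnto_apply_left])
  let f : Dual R D.VEven →ₗ[R] B₂ := B.formEquiv.symm.toLinearMap ∘ₗ (D.actOn a).dualMap
  have hf : ∀ l, f l ∈ LinearMap.range B.δ₃ := by
    intro l
    refine hB.mem_range_δ₃ ?_
    rintro _ ⟨φ, rfl⟩
    have : B.formEquiv (f l) = (D.actOn a).dualMap l := by simp [f]
    refine (LinearMap.congr_fun this _).trans ?_
    rw [LinearMap.dualMap_apply, ha.annihilated, map_zero]
  obtain ⟨w, hw⟩ := Module.projective_lifting_property B.δ₃.rangeRestrict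
    (f.codRestrict _ hf) B.δ₃.surjective_rangeRestrict
  refine ⟨w, LinearMap.ext fun l => ?_⟩
  exact congrArg Subtype.val (LinearMap.congr_fun hw l)

variable [IsLocalRing R] [Module.Finite R B₁] [Module.Free R B₀] [Module.Finite R B₀]

/-- Each degree one coordinate of the spinor multiplies cycles into boundaries; the grade of the
ideal they generate then gives exactness. -/
theorem isAcyclicA (hε : D.IsAdapted ε) (hB : B.IsAcyclic)
    (ha : B.IsSpinorCoordinates D a) (hw : B.IsSpinorLift D a w)
    (hgrade : GradeGEAt (maximalIdeal R) (D.idealOf a) 3) : B.IsAcyclicA D a w := by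
  obtain ⟨x₁, h₁, x₂, h₂, x₃, h₃, hx⟩ := hgrade.exists_isWeaklyRegularTriple
  have : Module.Free R D.H := Module.Free.of_basis hε.basisH
  have : Module.Finite R D.H := Module.Finite.of_basis hε.basisH
  have hu := hw.δ₃_dualOneEven hε
  have hεu : ∀ i, (ε (B.δ₃ (w D.dualOneEven))).1 i = hε.toSpinor a {i} := fun i => by
    rw [hu, hε.ιInv_eq]
  have hd₃ : ∀ y, B.d₃ D w y = B.δ₄ y.1 + y.2 • w D.dualOneEven := fun y => rfl
  have hδ : ∀ y, B.δ₃ (B.d₃ D w y) = y.2 • B.δ₃ (w D.dualOneEven) := fun y => by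
    rw [hd₃, map_add, hB.exact₃.apply_apply_eq_zero, zero_add, map_smul]
  have hideal : ∀ {N : Submodule R (Dual R B₁)} {z : Dual R B₁},
      (∀ j, hε.toSpinor a {j} • z ∈ N) → ∀ x ∈ D.idealOf a, x • z ∈ N := by
    intro N z h x hxI
    rw [idealOf_eq hε] at hxI
    have : Ideal.span (Set.range fun i => hε.toSpinor a {i}) ≤
        N.comap (LinearMap.toSpanSingleton R _ z) := by
      rw [Ideal.span_le]
      rintro _ ⟨j, rfl⟩
      exact h j
    exact this hxI
  have hinj : Function.Injective (B.d₃ D w) := by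
    rw [injective_iff_map_eq_zero]
    rintro ⟨ψ, r⟩ hy
    have h0 : r • B.δ₃ (w D.dualOneEven) = 0 := by rw [← hδ (ψ, r), hy, map_zero]
    have hr : r = 0 := by
      apply hx.fst
      have : D.idealOf a ≤ LinearMap.ker (LinearMap.mulRight R r) := by
        rw [idealOf_eq hε, Ideal.span_le]
        rintro _ ⟨j, rfl⟩
        have := congrArg (fun x => (ε x).1 j) h0
        simp only [map_smul, Prod.smul_fst, Pi.smul_apply, hεu, map_zero, Prod.fst_zero,
          Pi.zero_apply, smul_eq_mul] at this
        change hε.toSpinor a {j} * r = 0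
        rw [mul_comm, this]
      exact this h₁
    subst hr
    have : B.δ₄ ψ = 0 := by simpa [hd₃] using hy
    rw [hB.injective (this.trans (map_zero _).symm)]
    rfl
  have hcomp₂ : ∀ y, B.d₂ D (B.d₃ D w y) = 0 := by
    intro y
    rw [d₂_eq_zero_iff hε, hδ, hu, map_smul, hε.apply_coe]
    simp
  have hexact₂ : Function.Exact (B.d₃ D w) (B.d₂ D) := by
    refine exact_of_smul_mem_range hx h₁ h₂ hinj hcomp₂ fun z hz => hideal fun j => ?_
    rw [d₂_eq_zero_iff hε] at hz
    have hmem : ((ε (B.δ₃ z)).1, (0 : Fin n → R)) ∈ (LinearMap.range B.δ₃).map ε.toLinearMap :=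
      ⟨B.δ₃ z, ⟨z, rfl⟩, Prod.ext rfl hz⟩
    have hmul := mul_eq_mul_of_mem (annihilated_map hε ha) hmem
    -- The cycle `z` scaled by `s {j}` and the distinguished column scaled by the `j`-th coordinate
    -- of `δ₃ z` have the same image under `δ₃`, so they differ by an element of the image of `δ₄`.
    obtain ⟨ψ, hψ⟩ := (hB.exact₃ (hε.toSpinor a {j} • z -
      (ε (B.δ₃ z)).1 j • w D.dualOneEven)).mp (by
        apply ε.injective
        rw [map_sub, map_smul, map_smul, map_sub, map_smul, map_smul, map_zero]
        refine Prod.ext (funext fun i => ?_) ?_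
        · simp only [Prod.fst_sub, Prod.smul_fst, Pi.sub_apply, Pi.smul_apply, hεu, smul_eq_mul]
          rw [hmul i j, sub_self]
          rfl
        · rw [Prod.snd_sub, Prod.smul_snd, Prod.smul_snd, hz, hu, hε.apply_coe]
          simp)
    refine ⟨(ψ, (ε (B.δ₃ z)).1 j), ?_⟩
    rw [hd₃, hψ]
    exact sub_add_cancel _ _
  refine ⟨hinj, hexact₂, exact_of_exact_of_smul_mem_range hx h₁ h₂ h₃ hinj hexact₂ ?_ ?_⟩
  · intro φ
    change B.d₂ D φ (ExteriorAlgebra.ιInv (a : ExteriorAlgebra R D.H)) = 0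
    rw [d₂_apply, ← hu, B.form_symm, form_δ₃, hB.exact₂.apply_apply_eq_zero, map_zero]
  · intro d hd x hxI
    rw [d₁_eq hε] at hd
    rw [idealOf_eq hε] at hxI
    have : Ideal.span (Set.range fun i => hε.toSpinor a {i}) ≤
        (LinearMap.range (B.d₂ D)).comap (LinearMap.toSpanSingleton R _ d) := by
      rw [Ideal.span_le]
      rintro _ ⟨j, rfl⟩
      obtain ⟨y, _, ⟨φ, rfl⟩, hφ⟩ := exists_mem_of_sum_eq_zero (hB.mem_map_range_δ₃ hε.isometry)
        (annihilated_map hε ha) hd j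
      refine ⟨φ, LinearMap.ext fun h => ?_⟩
      have hφ' : ε (B.δ₃ φ) = _ := hφ
      rw [d₂_apply, hε.isometry, hφ', hε.apply_coe, hyp]
      change _ = hε.toSpinor a {j} * d h
      rw [hε.dual_apply d h, Finset.mul_sum]
      exact Finset.sum_congr rfl fun i _ => by simp [mul_assoc]
    exact this hxI

end SelfDualSequence

/-! ### Perfect ideals of grade three -/

section Ext

variable {R : Type u} [CommRing R]

theorem moduleCat_shortExact {M N K : Type u} [AddCommGroup M] [Module R M] [AddCommGroup N]
    [Module R N] [AddCommGroup K] [Module R K] {f : M →ₗ[R] N} {g : N →ₗ[R] K}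
    (hf : Function.Injective f) (hg : Function.Surjective g) (h : Function.Exact f g) :
    (ShortComplex.mk (ModuleCat.ofHom f) (ModuleCat.ofHom g)
      (by rw [← ModuleCat.ofHom_comp, h.linearMap_comp_eq_zero]; rfl)).ShortExact where
  exact := by
    rw [ShortComplex.ShortExact.moduleCat_exact_iff_function_exact]
    exact h
  mono_f := (ModuleCat.mono_iff_injective _).mpr hf
  epi_g := (ModuleCat.epi_iff_surjective _).mpr hg

/-- Dimension shifting along a projective middle term. -/
theorem subsingleton_ext_of_shortExact {S : ShortComplex (ModuleCat.{u} R)} (hS : S.ShortExact)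
    (hP : Projective S.X₂) (Y : ModuleCat.{u} R) (n : ℕ)
    (h : Subsingleton (Abelian.Ext S.X₃ Y (n + 2))) :
    Subsingleton (Abelian.Ext S.X₁ Y (n + 1)) := by
  refine subsingleton_of_forall_eq 0 fun x => ?_
  obtain ⟨y, rfl⟩ := Abelian.Ext.contravariant_sequence_exact₁ hS Y x (n₁ := n + 2) (by omega)
    (Subsingleton.elim _ _)
  rw [y.eq_zero_of_projective, Abelian.Ext.comp_zero]

/-- The obstruction to extending `φ` lies in Ext¹ of the quotient. -/
theorem exists_extension_of_subsingleton_ext {M N K : Type u} [AddCommGroup M] [Module R M]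
    [AddCommGroup N] [Module R N] [AddCommGroup K] [Module R K] {f : M →ₗ[R] N} {g : N →ₗ[R] K}
    (hf : Function.Injective f) (hg : Function.Surjective g) (h : Function.Exact f g)
    {Y : Type u} [AddCommGroup Y] [Module R Y]
    (hext : Subsingleton (Abelian.Ext (ModuleCat.of R K) (ModuleCat.of R Y) 1)) (φ : M →ₗ[R] Y) :
    ∃ ψ : N →ₗ[R] Y, ψ ∘ₗ f = φ := by
  obtain ⟨y, hy⟩ := Abelian.Ext.contravariant_sequence_exact₁ (moduleCat_shortExact hf hg h) _
    (Abelian.Ext.mk₀ (ModuleCat.ofHom φ)) (n₁ := 1) (by omega) (Subsingleton.elim _ _)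
  obtain ⟨ψ, rfl⟩ := Abelian.Ext.homEquiv₀.symm.surjective y
  refine ⟨ψ.hom, ?_⟩
  rw [Abelian.Ext.homEquiv₀_symm_apply, Abelian.Ext.mk₀_comp_mk₀] at hy
  have := Abelian.Ext.homEquiv₀.symm.injective hy
  exact congrArg ModuleCat.Hom.hom this

theorem IsWeaklyRegularTriple.isWeaklyRegular {x₁ x₂ x₃ : R} (hx : IsWeaklyRegularTriple x₁ x₂ x₃) :
    RingTheory.Sequence.IsWeaklyRegular R [x₁, x₂, x₃] := by
  have key : ∀ (c : Ideal R) (x : R), (∀ g, x * g ∈ c → g ∈ c) →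
      IsSMulRegular (R ⧸ (c • ⊤ : Submodule R R)) x := by
    intro c x h
    rw [isSMulRegular_iff_right_eq_zero_of_smul]
    intro m hm
    obtain ⟨r, rfl⟩ := Submodule.Quotient.mk_surjective _ m
    rw [← Submodule.Quotient.mk_smul, Submodule.Quotient.mk_eq_zero, smul_eq_mul, Ideal.mul_top] at hm
    rw [Submodule.Quotient.mk_eq_zero, smul_eq_mul, Ideal.mul_top]
    exact h r hm
  refine ⟨fun i hi => ?_⟩
  apply key
  intro g
  have hi' : i < 3 := hi
  interval_cases i
  · simpa using hx.fst g
  · simpa using hx.snd g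
  · simpa [sup_comm] using hx.thd g

theorem moduleGrade_eq_of_ext {M : Type u} [AddCommGroup M] [Module R M] {k : ℕ}
    (hlt : ∀ i < k, Subsingleton (Abelian.Ext (ModuleCat.of R M) (ModuleCat.of R R) i))
    (hk : Nontrivial (Abelian.Ext (ModuleCat.of R M) (ModuleCat.of R R) k)) :
    moduleGrade R M = k := by
  apply le_antisymm
  · exact sInf_le ⟨k, rfl, hk⟩
  · refine le_sInf ?_
    rintro _ ⟨i, rfl, hi⟩
    by_contra hcon
    have := hlt i (by exact_mod_cast not_le.mp hcon)
    exact not_subsingleton _ this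

variable [IsNoetherianRing R] {x₁ x₂ x₃ : R}

/-- An ideal of grade at least three with a free resolution of length three whose dual is not
exact at the end is perfect of grade three. -/
theorem isPerfectModule_of_resolution_same_universe {F₃ F₂ F₁ : Type u} [AddCommGroup F₃] [Module R F₃]
    [Module.Free R F₃] [AddCommGroup F₂] [Module R F₂] [Module.Free R F₂]
    [AddCommGroup F₁] [Module R F₁] [Module.Free R F₁] {d₃ : F₃ →ₗ[R] F₂} {d₂ : F₂ →ₗ[R] F₁}
    {d₁ : F₁ →ₗ[R] R} (hinj : Function.Injective d₃) (h₂ : Function.Exact d₃ d₂)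
    (h₁ : Function.Exact d₂ d₁) (htop : LinearMap.range d₁ ≠ ⊤)
    (hx : IsWeaklyRegularTriple x₁ x₂ x₃)
    (hx₁ : x₁ ∈ LinearMap.range d₁) (hx₂ : x₂ ∈ LinearMap.range d₁)
    (hx₃ : x₃ ∈ LinearMap.range d₁) (φ : Dual R F₃) (hφ : ∀ g : Dual R F₂, g ∘ₗ d₃ ≠ φ) :
    moduleGrade R (R ⧸ LinearMap.range d₁) = 3 ∧ IsPerfectModule R (R ⧸ LinearMap.range d₁) := by
  set I : Ideal R := LinearMap.range d₁ with hI
  have e₁ : Function.Exact I.subtype I.mkQ := fun x => by simp [Ideal.Quotient.eq_zero_iff_mem]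
  have e₂ : Function.Exact (LinearMap.range d₂).subtype d₁.rangeRestrict := fun x => by
    rw [← LinearMap.mem_ker, LinearMap.ker_rangeRestrict, LinearMap.mem_ker, h₁ x]
    simp
  have e₃ : Function.Exact d₃ d₂.rangeRestrict := fun x => by
    rw [← LinearMap.mem_ker, LinearMap.ker_rangeRestrict, LinearMap.mem_ker, h₂ x]
  have S₁ := moduleCat_shortExact I.subtype_injective I.mkQ_surjective e₁
  have S₂ := moduleCat_shortExact (LinearMap.range d₂).subtype_injective
    d₁.surjective_rangeRestrict e₂
  have S₃ := moduleCat_shortExact hinj d₂.surjective_rangeRestrict e₃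
  have hpR : Projective (ModuleCat.of R R) := inferInstance
  have hp₁ : Projective (ModuleCat.of R F₁) := inferInstance
  have hp₂ : Projective (ModuleCat.of R F₂) := inferInstance
  have hp₃ : Projective (ModuleCat.of R F₃) := inferInstance
  -- If Ext³ vanished, two dimension shifts would kill Ext¹ of the image of `d₂`, and `φ` would
  -- extend to `F₂`.
  have hnon : Nontrivial (Abelian.Ext (ModuleCat.of R (R ⧸ I)) (ModuleCat.of R R) 3) := by
    by_contra hcon
    rw [not_nontrivial_iff_subsingleton] at hcon
    have t₁ := subsingleton_ext_of_shortExact S₁ hpR (ModuleCat.of R R) 1 hcon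
    have t₂ := subsingleton_ext_of_shortExact S₂ hp₁ (ModuleCat.of R R) 0 t₁
    obtain ⟨g, hg⟩ := exists_extension_of_subsingleton_ext hinj d₂.surjective_rangeRestrict e₃ t₂ φ
    exact hφ g hg
  have hgrade : moduleGrade R (R ⧸ I) = (3 : ℕ) := by
    refine moduleGrade_eq_of_ext ?_ hnon
    -- Properness of the ideal makes the sequence regular, and its length bounds the grade from
    -- below by vanishing of Ext.
    have hreg : RingTheory.Sequence.IsRegular R [x₁, x₂, x₃] := by
      refine ⟨hx.isWeaklyRegular, fun h => htop ?_⟩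
      rw [smul_eq_mul, Ideal.mul_top] at h
      rw [eq_top_iff, h, Ideal.ofList, Ideal.span_le]
      rintro x hx
      simp only [List.mem_cons, List.not_mem_nil, or_false, Set.mem_ofPred_eq] at hx
      rcases hx with rfl | rfl | rfl <;> assumption
    refine ModuleCat.subsingleton_ext_of_exists_isRegular I (ModuleCat.of R (R ⧸ I)) ?_
      (ModuleCat.of R R) ?_ [x₁, x₂, x₃] ?_ hreg
    · rw [Module.support_eq_zeroLocus]
      exact PrimeSpectrum.zeroLocus_anti_mono Ideal.annihilator_quotient.ge
    · rw [smul_eq_mul, Ideal.mul_top]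
      exact lt_top_iff_ne_top.mpr htop
    · intro x hx
      simp only [List.mem_cons, List.not_mem_nil, or_false] at hx
      rcases hx with rfl | rfl | rfl <;> assumption
  refine ⟨hgrade, ?_⟩
  rw [IsPerfectModule, hgrade]
  apply le_antisymm
  · refine (projectiveDimension_le_iff _ 3).mpr ?_
    refine S₁.hasProjectiveDimensionLT_X₃ 3 ?_ inferInstance
    refine S₂.hasProjectiveDimensionLT_X₃ 2 ?_ inferInstance
    exact S₃.hasProjectiveDimensionLT_X₃ 1 inferInstance inferInstance
  · refine (projectiveDimension_ge_iff _ 3).mpr fun h => ?_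
    have := HasProjectiveDimensionLT.subsingleton _ 3 3 le_rfl (ModuleCat.of R R) (hX := h)
    exact not_subsingleton _ this

/-- Choosing bases replaces the modules by powers of `R`, which lie in the universe of `R`, where
the Ext groups are formed. -/
theorem isPerfectModule_of_resolution [Nontrivial R] {F₃ F₂ F₁ : Type*} [AddCommGroup F₃]
    [Module R F₃] [Module.Free R F₃] [Module.Finite R F₃] [AddCommGroup F₂] [Module R F₂]
    [Module.Free R F₂] [Module.Finite R F₂] [AddCommGroup F₁] [Module R F₁] [Module.Free R F₁]
    [Module.Finite R F₁] {d₃ : F₃ →ₗ[R] F₂} {d₂ : F₂ →ₗ[R] F₁}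
    {d₁ : F₁ →ₗ[R] R} (hinj : Function.Injective d₃) (h₂ : Function.Exact d₃ d₂)
    (h₁ : Function.Exact d₂ d₁) (htop : LinearMap.range d₁ ≠ ⊤)
    (hx : IsWeaklyRegularTriple x₁ x₂ x₃)
    (hx₁ : x₁ ∈ LinearMap.range d₁) (hx₂ : x₂ ∈ LinearMap.range d₁)
    (hx₃ : x₃ ∈ LinearMap.range d₁) (φ : Dual R F₃) (hφ : ∀ g : Dual R F₂, g ∘ₗ d₃ ≠ φ) :
    moduleGrade R (R ⧸ LinearMap.range d₁) = 3 ∧ IsPerfectModule R (R ⧸ LinearMap.range d₁) := by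
  let e₃ := (Module.finBasis R F₃).equivFun
  let e₂ := (Module.finBasis R F₂).equivFun
  let e₁ := (Module.finBasis R F₁).equivFun
  have hr : LinearMap.range (d₁ ∘ₗ e₁.symm.toLinearMap) = LinearMap.range d₁ :=
    LinearMap.range_comp_of_range_eq_top _ e₁.symm.range
  rw [← hr]
  rw [← hr] at htop hx₁ hx₂ hx₃
  refine isPerfectModule_of_resolution_same_universe
    (d₃ := e₂.toLinearMap ∘ₗ d₃ ∘ₗ e₃.symm.toLinearMap)
    (d₂ := e₁.toLinearMap ∘ₗ d₂ ∘ₗ e₂.symm.toLinearMap)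
    (e₂.injective.comp (hinj.comp e₃.symm.injective)) (fun x => ?_) (fun x => ?_) htop hx hx₁ hx₂
    hx₃ (φ ∘ₗ e₃.symm.toLinearMap) (fun g hg => hφ (g ∘ₗ e₂.toLinearMap) ?_)
  · change e₁ (d₂ (e₂.symm x)) = 0 ↔ _
    rw [map_eq_zero_iff _ e₁.injective, h₂]
    constructor
    · rintro ⟨y, hy⟩
      exact ⟨e₃ y, by simp [hy]⟩
    · rintro ⟨y, rfl⟩
      exact ⟨e₃.symm y, by simp⟩
  · change d₁ (e₁.symm x) = 0 ↔ _
    rw [h₁]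
    constructor
    · rintro ⟨y, hy⟩
      exact ⟨e₂ y, by simp [hy]⟩
    · rintro ⟨y, rfl⟩
      exact ⟨e₂.symm y, by simp⟩
  · ext x
    simpa using LinearMap.congr_fun hg (e₃ x)

end Ext

/-! ### Perfection of the ideal -/

namespace SelfDualSequence

open Spinor IsLocalRing

variable {R : Type u} [CommRing R] [IsNoetherianRing R] [IsLocalRing R] {B₀ B₁ B₂ : Type v}
  [AddCommGroup B₀] [Module R B₀] [Module.Free R B₀] [Module.Finite R B₀]
  [AddCommGroup B₁] [Module R B₁] [Module.Free R B₁] [Module.Finite R B₁]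
  [AddCommGroup B₂] [Module R B₂] {B : SelfDualSequence R B₀ B₁ B₂} {n : ℕ}
  {D : IsotropicDecomposition B.form} {ε : B₂ ≃ₗ[R] (Fin n → R) × (Fin n → R)}
  {a : D.VOdd} {w : Dual R D.VEven →ₗ[R] Dual R B₁}

/-- An extension of the projection to the summand `R` would be evaluation at some `b` with `δ₁ b =
0` on which the distinguished column takes the value 1. Writing `b = δ₂ e` exhibits 1 as the pairing
of `e` with the degree one part of `a`, so the ideal would be the unit ideal. -/
theorem grade_and_isPerfectModule (hε : D.IsAdapted ε) (hB : B.IsAcyclic)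
    (hw : B.IsSpinorLift D a w) (hA : B.IsAcyclicA D a w)
    (hgrade : GradeGEAt (maximalIdeal R) (D.idealOf a) 3) (htop : D.idealOf a ≠ ⊤) :
    moduleGrade R (R ⧸ D.idealOf a) = 3 ∧ IsPerfectModule R (R ⧸ D.idealOf a) := by
  have : Module.Free R D.H := Module.Free.of_basis hε.basisH
  have : Module.Finite R D.H := Module.Finite.of_basis hε.basisH
  obtain ⟨x₁, h₁, x₂, h₂, x₃, h₃, hx⟩ := hgrade.exists_isWeaklyRegularTriple
  refine isPerfectModule_of_resolution hA.injective hA.exact₂ hA.exact₁ htop hx h₁ h₂ h₃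
    (LinearMap.snd R (Dual R B₀) R) fun g hg => htop ?_
  obtain ⟨b, rfl⟩ := (Module.bijective_dual_eval R B₁).2 g
  have hg1 : w D.dualOneEven b = 1 := by
    have := LinearMap.congr_fun hg (0, 1)
    simpa [SelfDualSequence.d₃] using this
  have hg2 : B.δ₁ b = 0 := by
    refine (forall_dual_apply_eq_zero_iff R _).mp fun ψ => ?_
    have := LinearMap.congr_fun hg (ψ, 0)
    simpa [SelfDualSequence.d₃, δ₄] using this
  obtain ⟨e, rfl⟩ := (hB.exact₁ b).mp hg2
  rw [← form_δ₃, hw.δ₃_dualOneEven hε, B.form_symm] at hg1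
  rw [Ideal.eq_top_iff_one]
  exact ⟨B.form e ∘ₗ D.H.subtype, hg1⟩

end SelfDualSequence

theorem LinearMap.finrank_range_add_finrank_ker_of_isDomain {R : Type*} [CommRing R] [IsDomain R]
    {M N : Type*} [AddCommGroup M] [Module R M] [Module.Finite R M] [AddCommGroup N] [Module R N]
    (f : M →ₗ[R] N) :
    finrank R (LinearMap.range f) + finrank R (LinearMap.ker f) = finrank R M := by
  rw [← f.quotKerEquivRange.finrank_eq, Submodule.finrank_quotient_add_finrank]

/-! ### The line of spinors annihilated by a Lagrangian -/

namespace Spinor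

variable {R : Type u} [CommRing R] {n : ℕ}

/-- The spinors with all coordinates in an ideal. -/
def coordsIn (n : ℕ) (P : Ideal R) : Submodule R (Spinor R n) where
  carrier := {s | ∀ K, s K ∈ P}
  add_mem' hs ht K := add_mem (hs K) (ht K)
  zero_mem' _ := zero_mem _
  smul_mem' r _ hs K := P.mul_mem_left r (hs K)

theorem act_mem_coordsIn {P : Ideal R} {s : Spinor R n} (hs : s ∈ coordsIn n P)
    (x : (Fin n → R) × (Fin n → R)) : act x s ∈ coordsIn n P := by
  intro K
  rw [act_apply]
  refine sum_mem fun i _ => add_mem (P.mul_mem_left _ ?_) (P.mul_mem_left _ ?_)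
  · rw [create_apply]
    split_ifs
    · exact P.mul_mem_left _ (hs _)
    · exact zero_mem _
  · rw [annih_apply]
    split_ifs
    · exact zero_mem _
    · exact P.mul_mem_left _ (hs _)

/-- The composition of the actions of a family of vectors along a list of indices. -/
def actProd {ι : Type*} (l : ι → (Fin n → R) × (Fin n → R)) : List ι → Module.End R (Spinor R n)
  | [] => 1
  | i :: is => act (l i) * actProd l is

variable {ι : Type*} {l m : ι → (Fin n → R) × (Fin n → R)} {P : Ideal R}

theorem exists_act_actProd_sub_mem (y : (Fin n → R) × (Fin n → R)) (is : List ι)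
    (hy : ∀ i ∈ is, hyp y (l i) ∈ P) :
    ∃ c : R, ∀ t, act y (actProd l is t) - c • actProd l is (act y t) ∈ coordsIn n P := by
  induction is with
  | nil => exact ⟨1, fun t => by simp [actProd]⟩
  | cons i is ih =>
    obtain ⟨c, hc⟩ := ih fun j hj => hy j (by simp [hj])
    refine ⟨-c, fun t => ?_⟩
    have e : act y (actProd l (i :: is) t) - -c • actProd l (i :: is) (act y t) =
        hyp y (l i) • actProd l is t -
          act (l i) (act y (actProd l is t) - c • actProd l is (act y t)) := by
      rw [← act_act y (l i), map_sub, map_smul]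
      simp only [actProd, Module.End.mul_apply]
      module
    rw [e]
    exact sub_mem (fun K => P.mul_mem_right _ (hy i (by simp))) (act_mem_coordsIn (hc t) _)

/-- If the product along `i :: is` vanished modulo `P`, the Clifford relation with `m i`, which
passes through the remaining factors up to a scalar, would give vanishing of `r` times the shorter
product. Cancelling `r` and repeating reaches the empty product, the identity. -/
theorem exists_actProd_notMem [P.IsPrime] [DecidableEq ι] {r : R} (hr : r ∉ P)
    (h : ∀ i j, hyp (m i) (l j) - (if i = j then r else 0) ∈ P) (is : List ι) (his : is.Nodup) :
    ∃ t K, actProd l is t K ∉ P := by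
  by_contra! hcon
  have key : ∀ is : List ι, is.Nodup → (∀ t, actProd l is t ∈ coordsIn n P) →
      ∀ t : Spinor R n, t ∈ coordsIn n P := by
    intro is
    induction is with
    | nil => exact fun _ h t => h t
    | cons i is ih =>
      intro hnd hX
      rw [List.nodup_cons] at hnd
      refine ih hnd.2 fun t => ?_
      obtain ⟨c, hc⟩ := exists_act_actProd_sub_mem (l := l) (P := P) (m i) is fun j hj => by
        have := h i j
        rwa [if_neg (by rintro rfl; exact hnd.1 hj), sub_zero] at this
      have hX' : ∀ t, act (l i) (actProd l is t) ∈ coordsIn n P := hX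
      have h1 : hyp (m i) (l i) • actProd l is t ∈ coordsIn n P := by
        rw [← act_act]
        refine add_mem (act_mem_coordsIn (hX' t) _) ?_
        have e : act (l i) (act (m i) (actProd l is t)) =
            act (l i) (act (m i) (actProd l is t) - c • actProd l is (act (m i) t)) +
              c • act (l i) (actProd l is (act (m i) t)) := by
          rw [map_sub, map_smul, sub_add_cancel]
        rw [e]
        exact add_mem (act_mem_coordsIn (hc t) _) (Submodule.smul_mem _ _ (hX' _))
      intro K
      have h2 := sub_mem (h1 K) (P.mul_mem_right (actProd l is t K) (h i i))
      rw [if_pos rfl, Pi.smul_apply, smul_eq_mul, sub_mul, sub_sub_cancel] at h2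
      exact (Ideal.IsPrime.mem_or_mem ‹_› h2).resolve_left hr
  have := key is his hcon (Pi.single ∅ 1) ∅
  rw [Pi.single_eq_same] at this
  exact (Ideal.ne_top_iff_one _).mp (Ideal.IsPrime.ne_top ‹_›) this

theorem act_self_eq_zero (h2 : IsUnit (2 : R)) {x : (Fin n → R) × (Fin n → R)} (hx : hyp x x = 0)
    (s : Spinor R n) : act x (act x s) = 0 := by
  have := act_act x x s
  rw [hx, zero_smul, ← two_smul R] at this
  exact (h2.smul_eq_zero).mp this

theorem act_actProd_eq_zero (h2 : IsUnit (2 : R)) (hl : ∀ i j, hyp (l i) (l j) = 0) {i : ι}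
    {is : List ι} (hi : i ∈ is) (t : Spinor R n) : act (l i) (actProd l is t) = 0 := by
  induction is with
  | nil => simp at hi
  | cons j is ih =>
    simp only [actProd, Module.End.mul_apply]
    rcases List.mem_cons.mp hi with rfl | hi
    · exact act_self_eq_zero h2 (hl _ _) _
    · have := act_act (l i) (l j) (actProd l is t)
      rwa [ih hi, map_zero, add_zero, hl, zero_smul] at this

/-- The spinors annihilated by the vectors with indices in a finite set. -/
def annihilated (l : ι → (Fin n → R) × (Fin n → R)) (A : Finset ι) : Submodule R (Spinor R n) where
  carrier := {s | ∀ i ∈ A, act (l i) s = 0}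
  add_mem' hs ht i hi := by rw [map_add, hs i hi, ht i hi, add_zero]
  zero_mem' _ _ := map_zero _
  smul_mem' r _ hs i hi := by rw [map_smul, hs i hi, smul_zero]

theorem act_mem_annihilated {A : Finset ι} {x : (Fin n → R) × (Fin n → R)}
    (hx : ∀ i ∈ A, hyp (l i) x = 0) {s : Spinor R n} (hs : s ∈ annihilated l A) :
    act x s ∈ annihilated l A := by
  intro i hi
  have := act_act (l i) x s
  rwa [hs i hi, map_zero, add_zero, hx i hi, zero_smul] at this

/-- Each further vector halves the rank: on the spinors killed so far, `act (l i)` squares to zero,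
and `act (m i)` is a contracting homotopy up to the factor `r`. Its kernel and image thus have equal
rank. -/
theorem two_pow_mul_finrank_annihilated [IsDomain R] [IsNoetherianRing R] [DecidableEq ι]
    (h2 : IsUnit (2 : R)) (hl : ∀ i j, hyp (l i) (l j) = 0) {r : R} (hr : r ≠ 0)
    (h : ∀ i j, hyp (m i) (l j) = if i = j then r else 0) (A : Finset ι) :
    2 ^ A.card * finrank R (annihilated l A) = 2 ^ n := by
  induction A using Finset.induction_on with
  | empty =>
    have : annihilated l ∅ = ⊤ := by
      rw [eq_top_iff]
      intro s _ i hi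
      simp at hi
    rw [this, finrank_top]
    simp [Spinor, Module.finrank_fintype_fun_eq_card]
  | insert i A hi ih =>
    let W := annihilated l A
    let f : W →ₗ[R] W := (act (l i)).restrict fun s hs => act_mem_annihilated (fun j _ => hl j i) hs
    have hf : ∀ s, (f s : Spinor R n) = act (l i) s := fun s => rfl
    have hmap : annihilated l (insert i A) = (LinearMap.ker f).map W.subtype := by
      ext s
      constructor
      · intro hs
        refine ⟨⟨s, fun j hj => hs j (by simp [hj])⟩, Subtype.ext (hs i (by simp)), rfl⟩
      · rintro ⟨s, hs, rfl⟩ j hj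
        rcases Finset.mem_insert.mp hj with rfl | hj
        · exact congrArg Subtype.val hs
        · exact s.2 j hj
    have hle : LinearMap.range f ≤ LinearMap.ker f := by
      rintro _ ⟨s, rfl⟩
      exact Subtype.ext (act_self_eq_zero h2 (hl i i) _)
    have hge : ∀ s : LinearMap.ker f, r • (s : W) ∈ LinearMap.range f := by
      intro s
      refine ⟨⟨act (m i) (s : W), act_mem_annihilated (fun j hj => ?_) (s : W).2⟩,
        Subtype.ext ?_⟩
      · rw [hyp_comm, h, if_neg]
        rintro rfl
        exact hi hj
      · have h3 := act_act (m i) (l i) ((s : W) : Spinor R n)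
        have h4 : act (l i) ((s : W) : Spinor R n) = 0 := congrArg Subtype.val s.2
        rw [h4, map_zero, zero_add, h, if_pos rfl] at h3
        exact h3
    have h1 : finrank R (LinearMap.range f) ≤ finrank R (LinearMap.ker f) :=
      Submodule.finrank_mono hle
    have h2' : finrank R (LinearMap.ker f) ≤ finrank R (LinearMap.range f) := by
      let g : LinearMap.ker f →ₗ[R] LinearMap.range f :=
        (r • (LinearMap.ker f).subtype).codRestrict _ hge
      refine LinearMap.finrank_le_finrank_of_injective (f := g) fun x y hxy => ?_
      have e : r • (x : W) = r • (y : W) := congrArg Subtype.val hxy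
      exact Subtype.ext (smul_right_injective _ hr e)
    have h3 := LinearMap.finrank_range_add_finrank_ker_of_isDomain f
    rw [Finset.card_insert_of_notMem hi, hmap, Submodule.finrank_map_subtype_eq, pow_succ, ← ih]
    change _ = 2 ^ A.card * finrank R W
    rw [← h3, le_antisymm h1 h2', mul_assoc, two_mul]

/-- Two spinors annihilated by a Lagrangian are proportional. -/
theorem mul_eq_mul_of_annihilated [IsDomain R] [IsNoetherianRing R]
    (h2 : IsUnit (2 : R)) {l m : Fin n → (Fin n → R) × (Fin n → R)}
    (hl : ∀ i j, hyp (l i) (l j) = 0) {r : R} (hr : r ≠ 0)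
    (h : ∀ i j, hyp (m i) (l j) = if i = j then r else 0) {a b : Spinor R n}
    (ha : ∀ i, act (l i) a = 0) (hb : ∀ i, act (l i) b = 0) (T K : Finset (Fin n)) :
    b T * a K = a T * b K := by
  have hrank := two_pow_mul_finrank_annihilated h2 hl hr h Finset.univ
  rw [Finset.card_univ, Fintype.card_fin] at hrank
  have h1 : finrank R (annihilated l Finset.univ) = 1 := by
    exact Nat.eq_of_mul_eq_mul_left (pow_pos two_pos n) (hrank.trans (mul_one _).symm)
  by_contra hne
  -- A nonzero 2 × 2 minor would give two independent elements in a module of rank one.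
  have hind : LinearIndependent R
      ![(⟨a, fun i _ => ha i⟩ : annihilated l Finset.univ), ⟨b, fun i _ => hb i⟩] := by
    rw [LinearIndependent.pair_iff]
    intro x y hxy
    have e : x • a + y • b = 0 := congrArg Subtype.val hxy
    have eT : x * a T + y * b T = 0 := congrFun e T
    have eK : x * a K + y * b K = 0 := congrFun e K
    have hne' : b T * a K - a T * b K ≠ 0 := sub_ne_zero.mpr hne
    constructor
    · refine (mul_eq_zero.mp (?_ : x * (b T * a K - a T * b K) = 0)).resolve_right hne'
      linear_combination b T * eK - b K * eT
    · refine (mul_eq_zero.mp (?_ : y * (b T * a K - a T * b K) = 0)).resolve_right hne'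
      linear_combination a K * eT - a T * eK
  have := hind.fintype_card_le_finrank
  rw [h1] at this
  simp at this

end Spinor

/-! ### Existence of spinor coordinates over a factorial ring -/

/-- At a prime where the cokernel of `δ₁` vanishes, `δ₂` has the expected rank. -/
theorem exists_dual_families {R : Type u} [CommRing R] [Nontrivial R] {B₀ B₁ B₂ : Type*}
    [AddCommGroup B₀] [Module R B₀] [Module.Free R B₀] [Module.Finite R B₀]
    [AddCommGroup B₁] [Module R B₁] [Module.Free R B₁] [Module.Finite R B₁]
    [AddCommGroup B₂] [Module R B₂] {δ₁ : B₁ →ₗ[R] B₀} {δ₂ : B₂ →ₗ[R] B₁}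
    (hexact : Function.Exact δ₂ δ₁) {n : ℕ} (hn : finrank R B₁ = n + finrank R B₀)
    (P : Ideal R) [hPp : P.IsPrime]
    (hP : ⟨P, hPp⟩ ∉ Module.support R (B₀ ⧸ LinearMap.range δ₁)) :
    ∃ r ∉ P, ∃ (φ : Fin n → Dual R B₁) (m : Fin n → B₂),
      ∀ i j, φ i (δ₂ (m j)) - (if i = j then r else 0) ∈ P := by
  let k := P.ResidueField
  let b₀ := Module.finBasis R B₀
  let b₁ := Module.finBasis R B₁
  let ν : B₁ →ₗ[R] (Fin (finrank R B₁) → k) :=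
    (Algebra.linearMap R k).compLeft _ ∘ₗ b₁.equivFun.toLinearMap
  have hν : ∀ x c, ν x c = algebraMap R k (b₁.repr x c) := fun x c => rfl
  -- Near `P` the map `δ₁` is surjective, so it has a section up to a multiplier `t` outside `P`.
  obtain ⟨t, htP, σ, hσ⟩ : ∃ t ∉ P, ∃ σ : B₀ →ₗ[R] B₁, ∀ y, δ₁ (σ y) = t • y := by
    rw [Module.notMem_support_iff'] at hP
    choose t ht htz using fun i => hP (Submodule.Quotient.mk (b₀ i))
    have hrange : ∀ i, ∃ x, δ₁ x = (∏ j, t j) • b₀ i := by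
      intro i
      have h1 : t i • b₀ i ∈ LinearMap.range δ₁ := by
        rw [← Submodule.Quotient.mk_eq_zero]
        exact htz i
      rw [← Finset.prod_erase_mul _ _ (Finset.mem_univ i), mul_smul]
      exact (LinearMap.range δ₁).smul_mem _ h1
    choose x hx using hrange
    refine ⟨∏ j, t j, fun h => ?_, b₀.constr R x, fun y => ?_⟩
    · obtain ⟨j, -, hj⟩ := (hPp.prod_mem_iff).mp h
      exact ht j hj
    · have : δ₁ ∘ₗ b₀.constr R x = (∏ j, t j) • LinearMap.id := b₀.ext fun i => by
        simp [hx]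
      exact LinearMap.congr_fun this y
  have ht0 : algebraMap R k t ≠ 0 := fun h => htP (Ideal.algebraMap_residueField_eq_zero.mp h)
  let S := Submodule.span k (ν '' (LinearMap.range δ₂ : Set B₁))
  let T := Submodule.span k (Set.range fun i => ν (σ (b₀ i)))
  -- Over the residue field, the image of `δ₂` and the section span everything, by exactness; this
  -- bounds the rank of the image from below by `n`.
  have hST : S ⊔ T = ⊤ := by
    have hT : ∀ y, ν (σ y) ∈ T := by
      intro y
      rw [← b₀.sum_repr y, map_sum, map_sum]
      refine sum_mem fun i _ => ?_
      rw [map_smul, map_smul, ← algebraMap_smul k]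
      exact T.smul_mem _ (Submodule.subset_span ⟨i, rfl⟩)
    have hx : ∀ x, ν x ∈ S ⊔ T := by
      intro x
      have h1 : algebraMap R k t • ν x ∈ S ⊔ T := by
        rw [algebraMap_smul, ← map_smul,
          show t • x = (t • x - σ (δ₁ x)) + σ (δ₁ x) from (sub_add_cancel _ _).symm, map_add]
        refine add_mem (Submodule.mem_sup_left (Submodule.subset_span ⟨_, ?_, rfl⟩))
          (Submodule.mem_sup_right (hT _))
        exact (hexact _).mp (by rw [map_sub, hσ, map_smul, sub_self])
      exact (Submodule.smul_mem_iff _ ht0).mp h1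
    rw [eq_top_iff]
    intro v _
    have hv : v = ∑ c, v c • ν (b₁ c) := by
      funext c
      rw [Finset.sum_apply, Finset.sum_eq_single c]
      · simp [hν]
      · intro c' _ hc
        simp [hν, hc]
      · simp
    rw [hv]
    exact sum_mem fun c _ => Submodule.smul_mem _ _ (hx _)
  have hrank : n ≤ finrank k S := by
    have h1 := Submodule.finrank_add_le_finrank_add_finrank S T
    rw [hST, finrank_top, Module.finrank_fintype_fun_eq_card, Fintype.card_fin] at h1
    have h2 : finrank k T ≤ finrank R B₀ := by
      have := finrank_range_le_card (R := k) fun i => ν (σ (b₀ i))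
      rwa [Fintype.card_fin] at this
    omega
  obtain ⟨v, hvmem, -, hvind⟩ := Submodule.exists_fun_fin_finrank_span_eq k
    (ν '' (LinearMap.range δ₂ : Set B₁))
  choose x hx hxv using hvmem
  choose m hm using hx
  have hind := hvind.comp (Fin.castLE hrank) (Fin.castLE_injective hrank)
  -- The dual functionals come from a left inverse over the residue field; `r` is the common
  -- denominator of its entries.
  obtain ⟨g, hg⟩ := LinearMap.exists_leftInverse_of_injective
    (Finsupp.linearCombination k (v ∘ Fin.castLE hrank))
    (LinearMap.ker_eq_bot.mpr hind)
  have hgv : ∀ j, g (v (Fin.castLE hrank j)) = Finsupp.single j 1 := fun j => by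
    have := LinearMap.congr_fun hg (Finsupp.single j 1)
    simpa using this
  obtain ⟨r, hr, c, hc⟩ := exists_common_denominator P
    fun ia : Fin n × Fin (finrank R B₁) => g (Pi.single ia.2 1) ia.1
  refine ⟨r, hr, fun i => b₁.constr R fun a => c (i, a), fun j => m (Fin.castLE hrank j),
    fun i j => ?_⟩
  have key : ∀ y, algebraMap R k (b₁.constr R (fun a => c (i, a)) y) =
      algebraMap R k r * g (ν y) i := by
    intro y
    have e : ν y = ∑ a, algebraMap R k (b₁.repr y a) • Pi.single a 1 := by
      funext a
      simp [hν, Finset.sum_apply, Pi.single_apply, Algebra.algebraMap_eq_smul_one]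
    rw [e, map_sum, Finsupp.finsetSum_apply, Finset.mul_sum, Basis.constr_apply_fintype, map_sum]
    refine Finset.sum_congr rfl fun a _ => ?_
    rw [smul_eq_mul, map_mul, hc, map_smul, Finsupp.smul_apply, Basis.equivFun_apply, smul_eq_mul]
    ring
  rw [← Ideal.algebraMap_residueField_eq_zero, map_sub, key, hm, hxv, hgv, Finsupp.single_apply]
  by_cases hij : i = j
  · rw [if_pos hij, if_pos hij.symm, mul_one]
    exact sub_self _
  · simp [hij, Ne.symm hij]

/-! ### Coprime spinors, parity components and reflections -/

namespace Spinor

variable {R : Type u} [CommRing R] {n : ℕ}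

/-- Among spinors over a factorial ring that are pairwise proportional, one with coprime
coordinates vanishes only at the primes where all of them do. -/
theorem exists_coprime_multiple [IsDomain R] [UniqueFactorizationMonoid R] {a₀ : Spinor R n}
    (ha₀ : a₀ ≠ 0) :
    ∃ (d : R) (a : Spinor R n), d ≠ 0 ∧ a₀ = d • a ∧
      ∀ (b : Spinor R n), (∀ T K, b T * a K = a T * b K) → ∀ P : Ideal R, P.IsPrime →
        (∃ K, b K ∉ P) → ∃ K, a K ∉ P := by
  have : Nonempty (NormalizationMonoid R) := inferInstance
  let _ : NormalizationMonoid R := Classical.choice this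
  let _ : NormalizedGCDMonoid R := UniqueFactorizationMonoid.toNormalizedGCDMonoid R
  obtain ⟨a, ha, hgcd⟩ := Finset.extract_gcd a₀ (Finset.univ_nonempty (α := Finset (Fin n)))
  have e : a₀ = (Finset.univ.gcd a₀) • (a : Spinor R n) := funext fun K => ha K (Finset.mem_univ K)
  refine ⟨Finset.univ.gcd a₀, a, fun h => ha₀ (by rw [e, h, zero_smul]), e, ?_⟩
  rintro b hb P hP ⟨K₀, hK₀⟩
  by_contra! hcon
  have hne : a K₀ ≠ 0 := by
    intro h0
    apply ha₀
    have hz : ∀ T, a T = 0 := fun T => by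
      have := hb T K₀
      rw [h0, mul_zero] at this
      refine (mul_eq_zero.mp this.symm).resolve_right fun h => hK₀ ?_
      rw [h]
      exact zero_mem _
    funext K
    rw [ha K (Finset.mem_univ K), hz, mul_zero]
    rfl
  obtain ⟨f, hf, hassoc⟩ := UniqueFactorizationMonoid.exists_prime_factors _ hne
  obtain ⟨π, hπf, hπP⟩ := (hP.multiset_prod_mem_iff_exists_mem f).mp
    (P.mem_of_dvd hassoc.dvd' (hcon K₀))
  -- The prime factor `π` of `a K₀` lies in `P`, so it does not divide `b K₀`; proportionality
  -- spreads it to all coordinates, against coprimality.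
  have hdvd : ∀ T, π ∣ a T := by
    intro T
    have h1 : π ∣ a T * b K₀ := by
      rw [← hb]
      exact ((Multiset.dvd_prod hπf).trans hassoc.dvd).mul_left _
    exact ((hf π hπf).dvd_or_dvd h1).resolve_right fun h => hK₀ (P.mem_of_dvd h hπP)
  have h1 : π ∣ Finset.univ.gcd a := Finset.dvd_gcd fun T _ => hdvd T
  rw [hgcd] at h1
  exact (hf π hπf).not_isUnit (isUnit_of_dvd_one h1)

/-- The even part of a spinor. -/
def evenPart (s : Spinor R n) : Spinor R n := fun K => if Even K.card then s K else 0

/-- The odd part of a spinor. -/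
def oddPart (s : Spinor R n) : Spinor R n := fun K => if Even K.card then 0 else s K

theorem isEven_evenPart (s : Spinor R n) : IsEven (evenPart s) := fun _ hK =>
  if_neg (Nat.not_even_iff_odd.mpr hK)

theorem isOdd_oddPart (s : Spinor R n) : IsOdd (oddPart s) := fun _ hK => if_pos hK

theorem evenPart_add_oddPart (s : Spinor R n) : evenPart s + oddPart s = s := by
  funext K
  simp only [Pi.add_apply, evenPart, oddPart]
  split_ifs <;> simp

theorem act_evenPart_and_oddPart {x : (Fin n → R) × (Fin n → R)} {s : Spinor R n}
    (h : act x s = 0) : act x (evenPart s) = 0 ∧ act x (oddPart s) = 0 := by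
  rw [← evenPart_add_oddPart s, map_add] at h
  have h1 : act x (evenPart s) = 0 := by
    funext K
    rcases Nat.even_or_odd K.card with hK | hK
    · exact (isEven_evenPart s).act x K hK
    · have := congrFun h K
      rwa [Pi.add_apply, (isOdd_oddPart s).act x K hK, add_zero] at this
  exact ⟨h1, by rwa [h1, zero_add] at h⟩

/-- The vector `e_i + e'_i`. -/
def unitVector (i : Fin n) : (Fin n → R) × (Fin n → R) := (Pi.single i 1, Pi.single i 1)

theorem hyp_unitVector (i : Fin n) (x : (Fin n → R) × (Fin n → R)) :
    hyp (unitVector i) x = x.1 i + x.2 i := by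
  have : (unitVector i : (Fin n → R) × (Fin n → R)) =
      ((0 : Fin n → R), Pi.single i 1) + (Pi.single i 1, 0) := by simp [unitVector]
  rw [this, hyp_add_left, hyp_zero_single, hyp_single_zero, one_mul, one_mul]

theorem hyp_sub_smul (x y u : (Fin n → R) × (Fin n → R)) (c d : R) :
    hyp (x - c • u) (y - d • u) =
      hyp x y - d * hyp x u - c * hyp u y + c * d * hyp u u := by
  simp only [hyp, Finset.mul_sum, ← Finset.sum_sub_distrib, ← Finset.sum_add_distrib]
  refine Finset.sum_congr rfl fun i _ => ?_
  simp only [Prod.fst_sub, Prod.snd_sub, Prod.smul_fst, Prod.smul_snd, Pi.sub_apply, Pi.smul_apply,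
    smul_eq_mul]
  ring

/-- The linear map underlying `reflection`. -/
def reflectionMap (i : Fin n) :
    ((Fin n → R) × (Fin n → R)) →ₗ[R] (Fin n → R) × (Fin n → R) :=
  LinearMap.id - ((LinearMap.proj i ∘ₗ LinearMap.fst R (Fin n → R) (Fin n → R)) +
    (LinearMap.proj i ∘ₗ LinearMap.snd R (Fin n → R) (Fin n → R))).smulRight (unitVector i)

theorem reflectionMap_apply (i : Fin n) (x : (Fin n → R) × (Fin n → R)) :
    reflectionMap i x = x - hyp (unitVector i) x • unitVector i := by
  rw [hyp_unitVector]
  rfl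

theorem hyp_unitVector_self (i : Fin n) :
    hyp (unitVector i) (unitVector i : (Fin n → R) × (Fin n → R)) = 2 := by
  rw [hyp_unitVector]
  simp [unitVector, one_add_one_eq_two]

theorem hyp_unitVector_reflectionMap (i : Fin n) (x : (Fin n → R) × (Fin n → R)) :
    hyp (unitVector i) (reflectionMap i x) = - hyp (unitVector i) x := by
  have := hyp_sub_smul (unitVector i) x (unitVector i) 0 (hyp (unitVector i) x)
  rw [zero_smul, sub_zero, hyp_unitVector_self] at this
  rw [reflectionMap_apply, this]
  ring

theorem reflectionMap_reflectionMap (i : Fin n) (x : (Fin n → R) × (Fin n → R)) :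
    reflectionMap i (reflectionMap i x) = x := by
  rw [reflectionMap_apply i (reflectionMap i x), hyp_unitVector_reflectionMap,
    reflectionMap_apply]
  module

/-- The reflection in the vector `e_i + e'_i`. -/
def reflection (i : Fin n) :
    ((Fin n → R) × (Fin n → R)) ≃ₗ[R] (Fin n → R) × (Fin n → R) :=
  LinearEquiv.ofInvolutive (reflectionMap i) (reflectionMap_reflectionMap i)

theorem reflection_apply (i : Fin n) (x : (Fin n → R) × (Fin n → R)) :
    reflection i x = x - hyp (unitVector i) x • unitVector i := reflectionMap_apply i x

theorem hyp_reflection (i : Fin n) (x y : (Fin n → R) × (Fin n → R)) :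
    hyp (reflection i x) (reflection i y) = hyp x y := by
  rw [reflection_apply, reflection_apply, hyp_sub_smul, hyp_unitVector_self,
    hyp_comm x (unitVector i)]
  ring

theorem act_unitVector_act_unitVector (h2 : IsUnit (2 : R)) (i : Fin n) (s : Spinor R n) :
    act (unitVector i) (act (unitVector i) s) = s := by
  have := act_act (unitVector i) (unitVector i) s
  rw [hyp_unitVector_self, ← two_smul R] at this
  exact h2.smul_left_cancel.mp this

/-- Clifford multiplication by the unit vector lifts the reflection up to sign; being odd, it
exchanges the two half-spin parities. -/
theorem act_reflection (h2 : IsUnit (2 : R)) (i : Fin n) (x : (Fin n → R) × (Fin n → R))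
    (s : Spinor R n) :
    act (reflection i x) (act (unitVector i) s) = - act (unitVector i) (act x s) := by
  have h1 := act_act (unitVector i) x s
  rw [reflection_apply, map_sub, map_smul, LinearMap.sub_apply, LinearMap.smul_apply,
    act_unitVector_act_unitVector h2, ← h1]
  abel

end Spinor

/-! ### The spinor line of the complex over a domain -/

namespace SelfDualSequence

open Spinor IsLocalRing

variable {R : Type u} [CommRing R] {B₀ B₁ B₂ : Type v}
  [AddCommGroup B₀] [Module R B₀] [AddCommGroup B₁] [Module R B₁]
  [AddCommGroup B₂] [Module R B₂] {B : SelfDualSequence R B₀ B₁ B₂} {n : ℕ}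

theorem IsAcyclic.form_δ₃_δ₃ (hB : B.IsAcyclic) (φ ψ : Dual R B₁) :
    B.form (B.δ₃ φ) (B.δ₃ ψ) = 0 := by
  rw [form_δ₃, hB.exact₂.apply_apply_eq_zero, map_zero]

variable [Module.Free R B₀] [Module.Finite R B₀] [Module.Free R B₁] [Module.Finite R B₁]

theorem IsAcyclic.finrank_range_δ₃ [IsDomain R] (hB : B.IsAcyclic)
    (hn : finrank R B₁ = n + finrank R B₀) : finrank R (LinearMap.range B.δ₃) = n := by
  have h1 := LinearMap.finrank_range_add_finrank_ker_of_isDomain B.δ₃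
  rw [hB.exact₃.linearMap_ker_eq, LinearMap.finrank_range_of_inj hB.injective,
    (Module.Free.chooseBasis R B₀).toDualEquiv.finrank_eq.symm,
    (Module.Free.chooseBasis R B₁).toDualEquiv.finrank_eq.symm] at h1
  omega

/-- At a prime outside the support, there is a spinor annihilated by the image of `δ₃` that does
not vanish there. -/
theorem IsAcyclic.exists_annihilated_notMem [IsDomain R] (h2 : IsUnit (2 : R)) (hB : B.IsAcyclic)
    (hn : finrank R B₁ = n + finrank R B₀) {ε : B₂ ≃ₗ[R] (Fin n → R) × (Fin n → R)}
    (hε : ∀ x y, B.form x y = hyp (ε x) (ε y)) (P : Ideal R) [hPp : P.IsPrime]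
    (hP : ⟨P, hPp⟩ ∉ Module.support R (B₀ ⧸ LinearMap.range B.δ₁)) :
    ∃ b : Spinor R n, (∀ x ∈ LinearMap.range B.δ₃, act (ε x) b = 0) ∧ ∃ K, b K ∉ P := by
  have : Module.Finite R B₂ := Module.Finite.equiv ε.symm
  obtain ⟨r, hr, φ, m, hφm⟩ := exists_dual_families hB.exact₁ hn P hP
  let l : Fin n → (Fin n → R) × (Fin n → R) := fun i => ε (B.δ₃ (φ i))
  obtain ⟨t, K, hK⟩ := exists_actProd_notMem (l := l) (m := fun j => ε (m j)) hr (fun i j => by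
    have := hφm j i
    simp only [eq_comm (a := j)] at this
    rwa [← hε, B.form_symm, form_δ₃]) (List.finRange n) (List.nodup_finRange n)
  set b := actProd l (List.finRange n) t
  have hl : ∀ i, act (ε (B.δ₃ (φ i))) b = 0 := fun i =>
    act_actProd_eq_zero h2 (fun i j => by rw [← hε, hB.form_δ₃_δ₃]) (List.mem_finRange i) t
  refine ⟨b, fun x hx => ?_, K, hK⟩
  let v : Fin n → LinearMap.range B.δ₃ := fun i => ⟨B.δ₃ (φ i), φ i, rfl⟩
  -- Modulo `P` the matrix is `r` times the identity, so its determinant is nonzero and the vectors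
  -- `δ₃ (φ i)` are independent.
  have hdet : (Matrix.of fun i j => φ i (B.δ₂ (m j))).det ≠ 0 := by
    intro h0
    have h1 : (Ideal.Quotient.mk P) (Matrix.of fun i j => φ i (B.δ₂ (m j))).det =
        (Ideal.Quotient.mk P r) ^ n := by
      rw [RingHom.map_det]
      have : (Ideal.Quotient.mk P).mapMatrix (Matrix.of fun i j => φ i (B.δ₂ (m j))) =
          (Ideal.Quotient.mk P r) • (1 : Matrix (Fin n) (Fin n) (R ⧸ P)) := by
        ext i j
        have := Ideal.Quotient.eq.mpr (hφm i j)
        rw [RingHom.mapMatrix_apply, Matrix.map_apply, Matrix.of_apply, this, Matrix.smul_apply,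
          Matrix.one_apply]
        split_ifs <;> simp
      rw [this, Matrix.det_smul, Matrix.det_one, mul_one, Fintype.card_fin]
    rw [h0, map_zero] at h1
    exact hr (Ideal.Quotient.eq_zero_iff_mem.mp (eq_zero_of_pow_eq_zero h1.symm))
  have hv : LinearIndependent R v := by
    rw [Fintype.linearIndependent_iff]
    intro c hc
    have hc' : ∑ i, c i • B.δ₃ (φ i) = 0 := by
      have := congrArg Subtype.val hc
      simpa [v] using this
    have := Matrix.eq_zero_of_vecMul_eq_zero hdet (v := c) (by
      funext j
      have h3 := congrArg (fun x => B.form x (m j)) hc'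
      simp only [map_sum, map_smul, LinearMap.sum_apply, LinearMap.smul_apply, form_δ₃, map_zero,
        LinearMap.zero_apply, smul_eq_mul] at h3
      exact h3)
    exact fun i => congrFun this i
  have hspan : ∀ y ∈ Submodule.span R (Set.range v), act (ε y) b = 0 := by
    intro y hy
    induction hy using Submodule.span_induction with
    | mem y hy =>
      obtain ⟨i, rfl⟩ := hy
      exact hl i
    | zero => simp
    | add y z _ _ hy hz =>
      rw [Submodule.coe_add, map_add, map_add, LinearMap.add_apply, hy, hz, add_zero]
    | smul c y _ hy =>
      rw [Submodule.coe_smul, map_smul, map_smul, LinearMap.smul_apply, hy, smul_zero]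
  by_contra hne
  -- If `x` did not kill `b`, then `x` with the `n` vectors already found would be independent in
  -- the image of `δ₃`, whose rank is `n`.
  have hcons := LinearIndependent.finCons' (⟨x, hx⟩ : LinearMap.range B.δ₃) v hv (by
    intro c y hy hcy
    by_contra hc
    apply hne
    have h4 : act (ε (c • x + (y : B₂))) b = 0 := by
      have : c • x + (y : B₂) = 0 := congrArg Subtype.val hcy
      rw [this, map_zero, map_zero, LinearMap.zero_apply]
    rw [map_add, map_add, LinearMap.add_apply, hspan y hy, add_zero, map_smul, map_smul,
      LinearMap.smul_apply] at h4
    exact (smul_eq_zero.mp h4).resolve_left hc)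
  have := hcons.fintype_card_le_finrank
  rw [hB.finrank_range_δ₃ hn, Fintype.card_fin] at this
  omega

/-- A nonzero spinor over the generic point, divided by the gcd of its coordinates, is compared at
each prime outside the support with a local spinor that does not vanish there. Proportionality and
coprimality exclude a zero. -/
theorem IsAcyclic.hasSpinorCoordinates [IsNoetherianRing R] [IsLocalRing R] [IsDomain R] [UniqueFactorizationMonoid R]
    (h2 : IsUnit (2 : R)) (hB : B.IsAcyclic) (hn : finrank R B₁ = n + finrank R B₀) (hn0 : 0 < n)
    (hB₂ : HasHyperbolicBasis B.form n) : B.HasSpinorCoordinates := by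
  obtain ⟨ε, hε⟩ := hB₂.exists_coordinates B.form_symm
  have : Module.Free R B₂ := Module.Free.of_equiv ε.symm
  have : Module.Finite R B₂ := Module.Finite.equiv ε.symm
  let L := LinearMap.range B.δ₃
  have hbot : ⟨⊥, Ideal.isPrime_bot⟩ ∉ Module.support R (B₀ ⧸ LinearMap.range B.δ₁) :=
    hB.notMem_support (l := []) (by simp) trivial Ideal.isPrime_bot (g := 1) (by simp) (by simp)
  have hprop : ∀ a b : Spinor R n, (∀ x ∈ L, act (ε x) a = 0) → (∀ x ∈ L, act (ε x) b = 0) →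
      ∀ T K, b T * a K = a T * b K := by
    intro a b ha hb
    obtain ⟨r, hr, φ, m, hφm⟩ := exists_dual_families hB.exact₁ hn ⊥ hbot
    exact mul_eq_mul_of_annihilated h2 (l := fun i => ε (B.δ₃ (φ i))) (m := fun j => ε (m j))
      (fun i j => by rw [← hε, hB.form_δ₃_δ₃]) (r := r) (by simpa using hr) (fun i j => by
        have := hφm j i
        rw [Ideal.mem_bot, sub_eq_zero] at this
        rw [← hε, B.form_symm, form_δ₃, this]
        simp only [eq_comm]) (fun i => ha _ ⟨_, rfl⟩) (fun i => hb _ ⟨_, rfl⟩)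
  obtain ⟨a₀, ha₀, K₀, hK₀⟩ := hB.exists_annihilated_notMem h2 hn hε ⊥ hbot
  obtain ⟨d, a, hd, had, hmax⟩ := exists_coprime_multiple (a₀ := a₀) (by
    rintro rfl
    exact hK₀ (zero_mem _))
  have ha : ∀ x ∈ L, act (ε x) a = 0 := fun x hx => by
    have := ha₀ x hx
    rw [had, map_smul] at this
    exact (smul_eq_zero.mp this).resolve_left hd
  have hnv : ∀ P ∈ (Module.support R (B₀ ⧸ LinearMap.range B.δ₁))ᶜ, ∃ K, a K ∉ P.asIdeal := by
    intro P hP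
    obtain ⟨b, hb, hbK⟩ := hB.exists_annihilated_notMem h2 hn hε P.asIdeal hP
    exact hmax b (hprop a b ha hb) _ P.isPrime hbK
  suffices ∃ ε' s', IsSpinorOf B.form L (Module.support R (B₀ ⧸ LinearMap.range B.δ₁))ᶜ
      (n := n) ε' s' by
    obtain ⟨ε', s', hs'⟩ := this
    have hε' := IsotropicDecomposition.isAdapted_ofCoordinates ε' hs'.isometry
    obtain ⟨a', ha'⟩ := hε'.exists_VOdd hs'.isOdd
    exact ⟨_, a', (isSpinorCoordinates_iff hε' a').mpr (by rw [ha']; exact hs')⟩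
  by_cases hodd : IsOdd a
  · exact ⟨ε, a, hε, hodd, ha, hnv⟩
  -- The parity components of `a` are annihilated too, hence proportional, and this forces one of
  -- them to vanish.
  have heven : IsEven a := by
    rw [IsOdd] at hodd
    push Not at hodd
    obtain ⟨T, hT, haT⟩ := hodd
    intro K hK
    have h1 := hprop (oddPart a) (evenPart a)
      (fun x hx => (act_evenPart_and_oddPart (ha x hx)).2)
      (fun x hx => (act_evenPart_and_oddPart (ha x hx)).1) T K
    rw [isOdd_oddPart a T hT, zero_mul] at h1
    have h2 : evenPart a T = a T := if_pos hT
    have h3 : oddPart a K = a K := if_neg (Nat.not_even_iff_odd.mpr hK)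
    rw [h2, h3] at h1
    exact (mul_eq_zero.mp h1).resolve_left haT
  -- In the even case, reflecting one coordinate plane passes to the other family and makes the
  -- spinor odd.
  let i : Fin n := ⟨0, hn0⟩
  refine ⟨ε.trans (reflection i), act (unitVector i) a, fun x y => ?_, heven.act _,
    fun x hx => ?_, fun P hP => ?_⟩
  · rw [LinearEquiv.trans_apply, LinearEquiv.trans_apply, hyp_reflection, hε]
  · rw [LinearEquiv.trans_apply, act_reflection h2, ha x hx, map_zero, neg_zero]
  · by_contra! hcon
    obtain ⟨K, hK⟩ := hnv P hP
    apply hK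
    rw [← act_unitVector_act_unitVector h2 i a]
    exact act_mem_coordsIn (P := P.asIdeal) hcon _ K

end SelfDualSequence

theorem mainTheorem4 {R : Type u} [CommRing R] [IsNoetherianRing R] [IsLocalRing R]
    [Infinite (IsLocalRing.ResidueField R)] [IrreducibleSpace (PrimeSpectrum R)]
    (h2 : IsUnit (2 : R)) (p q : ℕ) (hp : 1 ≤ p) (hq : 3 ≤ q)
    {B₀ B₁ B₂ : Type v}
    [AddCommGroup B₀] [Module R B₀] [Module.Free R B₀] [Module.Finite R B₀]
    [AddCommGroup B₁] [Module R B₁] [Module.Free R B₁] [Module.Finite R B₁]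
    [AddCommGroup B₂] [Module R B₂]
    (hB₀ : Module.finrank R B₀ = q - 2) (hB₁ : Module.finrank R B₁ = p + q)
    (B : SelfDualSequence R B₀ B₁ B₂) (hB₂ : HasHyperbolicBasis B.form (p + 2))
    (hB : B.IsAcyclic) :
    -- over a factorial ring, spinor coordinates exist
    (IsDomain R → UniqueFactorizationMonoid R → B.HasSpinorCoordinates) ∧
    -- whenever they exist, some decomposition makes the constructed complex a resolution
    (B.HasSpinorCoordinates →
      ∃ D : IsotropicDecomposition B.form,
        (∃ a : D.VOdd, B.IsSpinorCoordinates D a) ∧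
        ∀ a : D.VOdd, B.IsSpinorCoordinates D a →
          (∃ w : Module.Dual R D.VEven →ₗ[R] Module.Dual R B₁,
            B.IsSpinorLift D a w) ∧
          ∀ w : Module.Dual R D.VEven →ₗ[R] Module.Dual R B₁,
            B.IsSpinorLift D a w →
              B.IsAcyclicA D a w ∧
              ((moduleGrade R (R ⧸ D.idealOf a) = 3 ∧
                  IsPerfectModule R (R ⧸ D.idealOf a)) ∨
                D.idealOf a = ⊤)) := by

  -- The truncated `q - 2` is a true difference because `q ≥ 3`; thus `δ₂` has the generic rank `p +
  -- 2`, half the rank of `B₂`.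
  have hn : Module.finrank R B₁ = (p + 2) + Module.finrank R B₀ := by omega
  refine ⟨fun _ _ => hB.hasSpinorCoordinates h2 hn (by omega) hB₂, fun h => ?_⟩
  obtain ⟨D, ε, hε, hex, hgrade⟩ := h.exists_generic hB hB₂
  refine ⟨D, hex, fun a ha => ⟨SelfDualSequence.exists_isSpinorLift hε hB ha, fun w hw => ?_⟩⟩
  have hI := hgrade a ha
  rw [← SelfDualSequence.idealOf_eq hε] at hI
  have hA := SelfDualSequence.isAcyclicA hε hB ha hw hI
  refine ⟨hA, ?_⟩
  by_cases htop : D.idealOf a = ⊤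
  · exact Or.inr htop
  · exact Or.inl (SelfDualSequence.grade_and_isPerfectModule hε hB hw hA hI htop)
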